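/- **Setting.** Let $a>0$, $b\in\mathbb R$, $\alpha>0$, $\Delta>0$, $M>0$, $t_i=i\Delta$, $c=-b/(2a)$. Put $\sigma_0=0$, $\psi_0=\sqrt{2c/(1-e^{-2c})}$ and, for $j\ge1$, $\sigma_j=a(c^2+(j\pi)^2)$, $\psi_j(x)=\sqrt2\,e^{cx}\sin(j\pi x+k_j)$, $k_j=\arctan(-j\pi/c)$ (if $c=0$: $\psi_0=1$, $k_j=-\pi/2$), and let $$P_t(y,x)=\sum_{j\ge0}e^{-\sigma_jt}\psi_j(y)\psi_j(x)$$ be the Green's function of $a\partial_x^2+b\partial_x$ on $[0,1]$ with Neumann boundary conditions. For a finite measure $\mu$ on $[0,1]$, a path $N$ of a standard (rate one) Poisson process, $\beta\in(0,1)$ and $\lambda>0$ let $$U^{\mu,N,\beta,\lambda}(t,x)=e^{-\alpha t}\int_{[0,1]}P_t(y,x)\,\mu(dy)+\int_0^te^{-\alpha(t-s)}P_{t-s}(\beta,x)\,dN_{\lambda s},$$ and write $\langle u,\phi\rangle=\int_0^1\phi(x)u(x)\,dx$. **Observations and estimators.** All random variables live on one probability space. Let $N$ be a standard Poisson process, $U_0$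 a random finite measure on $[0,1]$ independent of $N$, and $\varepsilon_1,\varepsilon_2,\dots$ independent standard normal variables, independent of $N$. Let $\Theta=\{(\beta,\lambda):0<\beta<1,\ 0<\lambda\le M\}$, and let the true parameter $\theta_0=(\beta_0,\lambda_0)$ satisfy $0<\beta_0<1$, $0<\lambda_0<M$. Let $U_t=U^{U_0,N,\beta_0,\lambda_0}(t,\cdot)$ and $$Y_i=h(\langle U_{t_i},\phi_0\rangle)+\varepsilon_i,\qquad i\ge1,$$ where $h:\mathbb R\to\mathbb R$ is bounded and continuous and $\phi_0$ is either a bounded continuous function on $[0,1]$ or a Dirac delta function at a point $z\in[0,1]$ (then $\langle u,\phi_0\rangle=u(z)$). For $\theta=(\beta,\lambda)\in\Theta$ let $F_\theta$ be the invariant probability measure of the signal with parameters $(\beta,\lambda)$, that is, the law of $V_\infty=\int_0^\infty e^{-\alpha s}P_s(\beta,\cdot)\,dN_{\lambda s}$, and let $g_r(\theta)=\int h(\langle\nu,\phi_0\rangle)^r\,F_\theta(d\nu)$ for $r=1,2$. Assume that $g_1,g_2$ have continuous partial derivatives on $\Theta$ and that the Jacobian determinant of $(g_1,g_2)$ with respect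 to $(\beta,\lambda)$ vanishes nowhere on $\Theta$. Put $m_r(n)=n^{-1}\sum_{i=1}^nY_i^r$. Let $\hat\theta_n=(\hat\beta_n,\hat\lambda_n)$ be $\Theta$-valued random variables such that, with probability one, for all sufficiently large $n$ the equations $$m_1(n)=g_1(\theta),\qquad m_2(n)=g_2(\theta)+1$$ have a unique solution $\theta\in\Theta$, and this solution is $\hat\theta_n$. **Approximating signal.** For each $n$ let $\tilde U^{(n)}_0$ be a random finite measure on $[0,1]$, of arbitrary law. Let $\tilde N$ be a standard Poisson process independent of $(U_0,N,(\varepsilon_i)_i,(\hat\theta_n)_n,(\tilde U_0^{(n)})_n)$. Put $$\tilde U^n_t=U^{\tilde U_0^{(n)},\tilde N,\hat\beta_n,\hat\lambda_n}(t,\cdot),\qquad \tilde U_t=U^{\tilde U_0^{(n)},\tilde N,\beta_0,\lambda_0}(t,\cdot),$$ both started from the same initial measure $\tilde U_0^{(n)}$. **Theorem.** For every bounded continuous function $\phi$ on $[0,1]$, the random variables $\langle\tilde U^n_{t_1},\phi\rangle-\langle\tilde U_{t_1},\phi\rangle$ are square integrable and $$\mathbb E\big|\langle\tilde U^n_{t_1},\phi\rangle-\langle\tilde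 U_{t_1},\phi\rangle\big|^2\to0\qquad\text{as }n\to\infty.$$ -/

import Mathlib

open Set Filter Topology MeasureTheory ProbabilityTheory
open scoped NNReal ENNReal unitInterval BoundedContinuousFunction

noncomputable section

namespace RiverFilter

/-! ### The Green's function of `L = a ∂² + b ∂` on `[0,1]` with Neumann boundary conditions -/

/-- `c = -b / (2a)`. -/
def drift (a b : ℝ) : ℝ := -b / (2 * a)

/-- The eigenvalues of `-L`: `σ₀ = 0` and `σ_j = a (c² + (jπ)²)` for `j ≥ 1`. -/
def eigenvalue (a b : ℝ) (j : ℕ) : ℝ :=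
  if j = 0 then 0 else a * (drift a b ^ 2 + (j * Real.pi) ^ 2)

/-- The phase `k_j = arctan (-jπ / c)`; for `c = 0` it is the limit `-π/2`, which is the phase
that produces the Neumann cosine basis. -/
def phase (a b : ℝ) (j : ℕ) : ℝ :=
  if drift a b = 0 then -(Real.pi / 2) else Real.arctan (-(j * Real.pi / drift a b))

/-- The eigenfunctions of `L`: `ψ₀ = √(2c / (1 - e^{-2c}))` (which is `1` for `c = 0`) and
`ψ_j(x) = √2 e^{cx} sin(jπx + k_j)` for `j ≥ 1`. -/
def eigenfunction (a b : ℝ) (j : ℕ) (x : ℝ) : ℝ :=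
  if j = 0 then
    if drift a b = 0 then 1
    else Real.sqrt (2 * drift a b / (1 - Real.exp (-(2 * drift a b))))
  else Real.sqrt 2 * Real.exp (drift a b * x) * Real.sin (j * Real.pi * x + phase a b j)

/-- `P_t(y,x) = ∑_j e^{-σ_j t} ψ_j(y) ψ_j(x)`; the series converges absolutely for `t > 0`. -/
def green (a b t y x : ℝ) : ℝ :=
  ∑' j : ℕ, Real.exp (-(eigenvalue a b j * t)) * eigenfunction a b j y * eigenfunction a b j x

/-! ### Poisson processes and integrals against their paths -/

/-- `N` is a standard (rate one) Poisson process under `P`: it starts at `0`, has nondecreasing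
right-continuous paths, and has independent increments with
`N t - N s ∼ Poisson (t - s)` for `s ≤ t`. -/
structure IsStandardPoisson {Ω : Type*} [MeasurableSpace Ω] (N : ℝ≥0 → Ω → ℕ)
    (P : Measure Ω) : Prop where
  measurable : ∀ t, Measurable (N t)
  zero : ∀ ω, N 0 ω = 0
  mono : ∀ ω, Monotone fun t => N t ω
  right_continuous : ∀ ω t, ContinuousWithinAt (fun s => N s ω) (Ici t) t
  indep_increments : HasIndepIncrements N P
  law_increment : ∀ s t, s ≤ t → HasLaw (fun ω => N t ω - N s ω) (poissonMeasure (t - s)) P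

open Classical in
/-- The Lebesgue–Stieltjes measure `dN_{l s}` on the time axis of the path `s ↦ N_{l s}`, where
`N` is a nondecreasing right-continuous path and `l ≥ 0`.  It charges neither `(-∞,0)` nor, since
`N 0 = 0`, the time `0`. -/
def pathMeasure (N : ℝ≥0 → ℕ) (l : ℝ) : Measure ℝ :=
  if hf : Monotone fun s : ℝ => (N (Real.toNNReal (l * s)) : ℝ) then hf.stieltjesFunction.measure
  else 0

/-! ### The signal -/

/-- `∫_0^t e^{-α (t-s)} P_{t-s}(β, x) dN_{l s}`, for one path `N`. -/
def injected (a b α : ℝ) (N : ℝ≥0 → ℕ) (β l t : ℝ) (x : I) : ℝ :=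
  ∫ s in Ioc 0 t, Real.exp (-(α * (t - s))) * green a b (t - s) β x ∂(pathMeasure N l)

/-- The solution of the signal equation with initial measure `μ`, driving path `N`, release
point `β` and intensity `l`:
`U(t,x) = e^{-αt} ∫ P_t(y,x) μ(dy) + ∫_0^t e^{-α (t-s)} P_{t-s}(β, x) dN_{l s}`. -/
def signal (a b α : ℝ) (μ : FiniteMeasure I) (N : ℝ≥0 → ℕ) (β l t : ℝ) (x : I) : ℝ :=
  Real.exp (-(α * t)) * ∫ y : I, green a b t y x ∂(μ : Measure I) + injected a b α N β l t x

/-- `V_∞(x) = ∫_0^∞ e^{-αs} P_s(β, x) dN_{l s}`.  Under the law of a standard Poisson process `N`,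
the law of `V_∞` is the invariant probability measure `F` of the signal with parameters
`(β, l)`. -/
def stationarySignal (a b α : ℝ) (N : ℝ≥0 → ℕ) (β l : ℝ) (x : I) : ℝ :=
  ∫ s in Ioi (0 : ℝ), Real.exp (-(α * s)) * green a b s β x ∂(pathMeasure N l)

/-- `⟨u, φ⟩ = ∫_0^1 φ(x) u(x) dx`. -/
def pairing (u : I → ℝ) (φ : I →ᵇ ℝ) : ℝ := ∫ x : I, φ x * u x

/-! ### Observations and moment estimation -/

/-- The observation weight `φ₀`: a bounded continuous function on `[0,1]` or the Dirac delta
function at a point of `[0,1]`. -/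
inductive Sensor where
  | weight (φ : I →ᵇ ℝ)
  | dirac (z : I)

/-- `⟨u, φ₀⟩`. -/
def Sensor.read : Sensor → (I → ℝ) → ℝ
  | .weight φ, u => pairing u φ
  | .dirac z, u => u z

/-- `Y_i = h(⟨U_{t_i}, φ₀⟩) + ε_i` with `t_i = i Δ`, where `U` is the signal with the parameters
`(β, l)`, started from `U₀` and driven by `N`. -/
def observation {Ω : Type*} (a b α Δ : ℝ) (h : ℝ →ᵇ ℝ) (φ₀ : Sensor)
    (U₀ : Ω → FiniteMeasure I) (N : ℝ≥0 → Ω → ℕ) (ε : ℕ → Ω → ℝ) (β l : ℝ)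
    (i : ℕ) (ω : Ω) : ℝ :=
  h (φ₀.read (signal a b α (U₀ ω) (fun t => N t ω) β l (i * Δ))) + ε i ω

/-- The sample moment `m_r(n) = n⁻¹ ∑_{i=1}^n Y_i^r`. -/
def sampleMoment {Ω : Type*} (Y : ℕ → Ω → ℝ) (r n : ℕ) (ω : Ω) : ℝ :=
  (n : ℝ)⁻¹ * ∑ i ∈ Finset.Icc 1 n, Y i ω ^ r

/-- `g_r(θ) = ∫ h(⟨ν, φ₀⟩)^r F(dν)` for `θ = (β, l)`, where `F` is the invariant probability
measure, i.e. the law of `stationarySignal`. -/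
def stationaryMoment {Ω : Type*} [MeasurableSpace Ω] (P : Measure Ω) (N : ℝ≥0 → Ω → ℕ)
    (a b α : ℝ) (h : ℝ →ᵇ ℝ) (φ₀ : Sensor) (r : ℕ) (θ : ℝ × ℝ) : ℝ :=
  ∫ ω, h (φ₀.read (stationarySignal a b α (fun t => N t ω) θ.1 θ.2)) ^ r ∂P

/-- `Θ = {(β, l) : 0 < β < 1, 0 < l ≤ M}`. -/
def paramSet (M : ℝ) : Set (ℝ × ℝ) := Ioo 0 1 ×ˢ Ioc 0 M

/-- `∂g/∂β` at a point of `Θ`. -/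
def partialβ (g : ℝ × ℝ → ℝ) (θ : ℝ × ℝ) : ℝ :=
  derivWithin (fun β => g (β, θ.2)) (Ioo 0 1) θ.1

/-- `∂g/∂l` at a point of `Θ` (one-sided on the edge `l = M`). -/
def partialL (M : ℝ) (g : ℝ × ℝ → ℝ) (θ : ℝ × ℝ) : ℝ :=
  derivWithin (fun l => g (θ.1, l)) (Ioc 0 M) θ.2

/-- `g` possesses continuous partial derivatives on `Θ`. -/
structure HasContinuousPartials (M : ℝ) (g : ℝ × ℝ → ℝ) : Prop where
  differentiable_β : ∀ θ ∈ paramSet M,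
    DifferentiableWithinAt ℝ (fun β => g (β, θ.2)) (Ioo 0 1) θ.1
  differentiable_l : ∀ θ ∈ paramSet M,
    DifferentiableWithinAt ℝ (fun l => g (θ.1, l)) (Ioc 0 M) θ.2
  continuous_β : ContinuousOn (partialβ g) (paramSet M)
  continuous_l : ContinuousOn (partialL M g) (paramSet M)

/-- The Jacobian matrix of `(g₁, g₂)`. -/
def jacobian (M : ℝ) (g₁ g₂ : ℝ × ℝ → ℝ) (θ : ℝ × ℝ) : Matrix (Fin 2) (Fin 2) ℝ :=
  !![partialβ g₁ θ, partialL M g₁ θ; partialβ g₂ θ, partialL M g₂ θ]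

/-- The moment equations `m₁ = g₁(θ)`, `m₂ = g₂(θ) + 1`. -/
def SolvesMoments (g₁ g₂ : ℝ × ℝ → ℝ) (m₁ m₂ : ℝ) (θ : ℝ × ℝ) : Prop :=
  m₁ = g₁ θ ∧ m₂ = g₂ θ + 1

/-- `θhat` is a sequence of moment estimators of the parameter: `Θ`-valued random variables such
that, with probability one, for all large `n` the moment equations have a unique solution in `Θ`,
and this solution is `θhat n`. -/
structure IsMomentEstimator {Ω : Type*} [MeasurableSpace Ω] (P : Measure Ω) (M : ℝ)
    (g₁ g₂ : ℝ × ℝ → ℝ) (Y : ℕ → Ω → ℝ) (θhat : ℕ → Ω → ℝ × ℝ) : Prop where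
  measurable : ∀ n, Measurable (θhat n)
  mem : ∀ n, ∀ᵐ ω ∂P, θhat n ω ∈ paramSet M
  unique_solution : ∀ᵐ ω ∂P, ∀ᶠ n in atTop, ∀ θ ∈ paramSet M,
    SolvesMoments g₁ g₂ (sampleMoment Y 1 n ω) (sampleMoment Y 2 n ω) θ ↔ θ = θhat n ω

end RiverFilter

end

noncomputable section

namespace RiverFilter

/-! ### Counting paths and their jump measures -/

/-! Put R(u,β) = e^{-αu}⟨P_u(β,·),φ⟩ for u > 0 and R = 0 for u ≤ 0. A jump of the unit rate process
at r is a release at time r/λ. Both readings are therefore integrals against one and the same jump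
measure, the common initial contribution cancels, and at time Δ the difference is ∫ (R(Δ - r/λ̂, β̂)
- R(Δ - r/λ₀, β₀)) dÑ_r. Since Ñ is independent of the estimator, the parameters may be frozen.
Since λ ≤ M, only jumps in (0,T] with T = MΔ matter, and Cauchy–Schwarz for the jump measure bounds
the second moment by (1+T) times the mean of ρ(θ̂), where ρ(θ) is the squared L²(0,T] distance of
the two kernels (`IsStandardPoisson.lintegral_jumps_sq_le`).

The function ρ is bounded on Θ and tends to 0 at θ₀ (`tendsto_lintegral_sq_dilation`). The delicate
point is the singularity at u = 0. The eigenfunction series is square summable against φ by Bessel's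
inequality, so R² is at most a constant times the trace ∑ e^{-σ_j u}, which is integrable near 0.
Dominated convergence then finishes the proof once θ̂ tends to θ₀ almost surely along subsequences
(`IsStandardPoisson.tendsto_pairing_signal`).

Consistency has two ingredients. First, the sample moments converge in L¹ to g₁(θ₀) and g₂(θ₀) + 1
(`IsStandardPoisson.tendstoInMean_sampleMoment`). The initial measure is forgotten exponentially
fast, and what remains is shot noise. Cutting off its memory gives variables with a finite range of
dependence, because Poisson integrals over disjoint supports are independent. The means converge
because a Poisson process on an interval is reversible in law. Both facts are read off the
characteristic functional E exp(i∫f dN) = exp ∫(e^{if} - 1), proved by Riemann sums and L¹ density.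
Second, the nonvanishing Jacobian makes the moment map open at θ₀. Sample moments close to the limit
are thus attained by a parameter close to θ₀, and uniqueness identifies that parameter with θ̂
(`IsMomentEstimator.exists_subseq_tendsto`). -/

/-- Nondecreasing right-continuous paths `ℝ≥0 → ℕ` starting at `0`. -/
abbrev CountingPath : Type :=
  {p : ℝ≥0 → ℕ // p 0 = 0 ∧ Monotone p ∧ ∀ t, ContinuousWithinAt p (Ici t) t}

lemma CountingPath.monotone_scaled (p : CountingPath) {l : ℝ} (hl : 0 ≤ l) :
    Monotone fun s : ℝ => (p.1 (Real.toNNReal (l * s)) : ℝ) := fun _ _ hst =>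
  Nat.cast_le.2 (p.2.2.1 (Real.toNNReal_le_toNNReal (mul_le_mul_of_nonneg_left hst hl)))

lemma CountingPath.continuousWithinAt_scaled (p : CountingPath) {l : ℝ} (hl : 0 ≤ l) (x : ℝ) :
    ContinuousWithinAt (fun s : ℝ => (p.1 (Real.toNNReal (l * s)) : ℝ)) (Ici x) x := by
  have h1 := p.2.2.2 (Real.toNNReal (l * x))
  have h2 : ContinuousWithinAt (fun s : ℝ => Real.toNNReal (l * s)) (Ici x) x := by fun_prop
  have h3 : ContinuousWithinAt (fun s : ℝ => p.1 (Real.toNNReal (l * s))) (Ici x) x :=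
    ContinuousWithinAt.comp (f := fun s : ℝ => Real.toNNReal (l * s)) (g := p.1) h1 h2
      fun s hs => Real.toNNReal_le_toNNReal (mul_le_mul_of_nonneg_left hs hl)
  exact (continuous_of_discreteTopology
    (f := fun n : ℕ => (n : ℝ))).continuousAt.comp_continuousWithinAt h3

/-- Right-continuity identifies the Stieltjes function, which is built from right limits, with the
path itself. Truncated subtraction gives the correct value 0 when y ≤ x. -/
lemma CountingPath.pathMeasure_Ioc (p : CountingPath) {l : ℝ} (hl : 0 ≤ l) (x y : ℝ) :
    pathMeasure p.1 l (Ioc x y) =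
      ((p.1 (Real.toNNReal (l * y)) - p.1 (Real.toNNReal (l * x)) : ℕ) : ℝ≥0∞) := by
  have hm := p.monotone_scaled hl
  have hr (x : ℝ) : hm.stieltjesFunction x = (p.1 (Real.toNNReal (l * x)) : ℝ) := by
    rw [hm.stieltjesFunction_eq]
    exact ContinuousWithinAt.rightLim_eq (f := fun s : ℝ => (p.1 (Real.toNNReal (l * s)) : ℝ))
      (p.continuousWithinAt_scaled hl x)
  rw [pathMeasure, dif_pos hm, StieltjesFunction.measure_Ioc, hr, hr]
  rcases le_total x y with h | h
  · rw [← Nat.cast_sub (p.2.2.1 (Real.toNNReal_le_toNNReal (mul_le_mul_of_nonneg_left h hl))),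
      ENNReal.ofReal_natCast]
  · have := p.2.2.1 (Real.toNNReal_le_toNNReal (mul_le_mul_of_nonneg_left h hl))
    rw [Nat.sub_eq_zero_of_le this, ENNReal.ofReal_of_nonpos]
    · simp
    · simpa using this

/-- The jump measure of a counting path. -/
def CountingPath.jumps (p : CountingPath) : Measure ℝ := pathMeasure p.1 1

lemma CountingPath.jumps_Ioc (p : CountingPath) (x y : ℝ) :
    p.jumps (Ioc x y) = ((p.1 (Real.toNNReal y) - p.1 (Real.toNNReal x) : ℕ) : ℝ≥0∞) := by
  rw [jumps, p.pathMeasure_Ioc zero_le_one, one_mul, one_mul]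

lemma CountingPath.jumps_Ioc_lt_top (p : CountingPath) (x y : ℝ) : p.jumps (Ioc x y) < ∞ := by
  rw [jumps_Ioc]; exact ENNReal.natCast_lt_top _

/-- This moves the intensity from the measure into the integrand, so that signals with different
intensities can be compared against one random measure. -/
lemma CountingPath.pathMeasure_eq_map (p : CountingPath) {l : ℝ} (hl : 0 < l) :
    pathMeasure p.1 l = p.jumps.map (fun r => r / l) := by
  refine Measure.ext_of_Ioc' _ _ (fun x y _ => ?_) fun x y _ => ?_
  · rw [p.pathMeasure_Ioc hl.le]; exact ENNReal.natCast_ne_top _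
  · rw [Measure.map_apply (by fun_prop) measurableSet_Ioc, p.pathMeasure_Ioc hl.le,
      ← p.jumps_Ioc]
    congr 1
    ext r
    simp [lt_div_iff₀ hl, div_le_iff₀ hl, mul_comm]

lemma CountingPath.jumps_Iic_zero (p : CountingPath) : p.jumps (Iic 0) = 0 := by
  have : Iic (0 : ℝ) = ⋃ n : ℕ, Ioc (-(n : ℝ)) 0 := by
    ext x
    simp only [mem_Iic, mem_iUnion, mem_Ioc]
    refine ⟨fun h => ?_, fun ⟨_, h⟩ => h.2⟩
    obtain ⟨n, hn⟩ := exists_nat_gt (-x)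
    exact ⟨n, by linarith, h⟩
  rw [this, measure_iUnion_null_iff]
  intro n
  rw [jumps_Ioc, Real.toNNReal_zero, Real.toNNReal_of_nonpos (by simp), Nat.sub_self]
  simp

lemma CountingPath.jumps_restrict_Ioi (p : CountingPath) : p.jumps.restrict (Ioi 0) = p.jumps := by
  refine Measure.restrict_eq_self_of_ae_mem ?_
  rw [ae_iff]
  simpa [Iic] using p.jumps_Iic_zero

/-- The π-system argument for measurability needs finite measures, hence the bounded window; the
full jump measure is assembled from unit windows afterwards. -/
lemma measurable_jumps_restrict (x y : ℝ) :
    Measurable fun p : CountingPath => p.jumps.restrict (Ioc x y) := by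
  have (p : CountingPath) : IsFiniteMeasure (p.jumps.restrict (Ioc x y)) :=
    ⟨by simpa using p.jumps_Ioc_lt_top x y⟩
  have hev (t : ℝ≥0) : Measurable fun p : CountingPath => p.1 t :=
    (measurable_pi_apply t).comp measurable_subtype_coe
  have hI (x y : ℝ) : Measurable fun p : CountingPath => p.jumps (Ioc x y) := by
    simp_rw [CountingPath.jumps_Ioc]
    exact (measurable_of_countable (fun n : ℕ => (n : ℝ≥0∞))).comp ((hev _).sub (hev _))
  refine Measurable.measure_of_isPiSystem (borel_eq_generateFrom_Ioc ℝ ▸ BorelSpace.measurable_eq)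
    (isPiSystem_Ioc id id) ?_ ?_
  · rintro _ ⟨u, v, _, rfl⟩
    simp only [id]
    simp_rw [Measure.restrict_apply measurableSet_Ioc, Ioc_inter_Ioc]
    exact hI _ _
  · simpa using hI x y

lemma iUnion_Ioc_nat_cast : ⋃ n : ℕ, Ioc (n : ℝ) (n + 1) = Ioi 0 := by
  ext x
  simp only [mem_iUnion, mem_Ioc, mem_Ioi]
  refine ⟨fun ⟨n, h, _⟩ => lt_of_le_of_lt n.cast_nonneg h, fun h => ?_⟩
  refine ⟨⌈x⌉₊ - 1, ?_, ?_⟩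
  · have := Nat.ceil_lt_add_one h.le
    rw [Nat.cast_sub (Nat.one_le_ceil_iff.2 h)]; push_cast; linarith
  · rw [Nat.cast_sub (Nat.one_le_ceil_iff.2 h)]; push_cast
    linarith [Nat.le_ceil x]

lemma pairwise_disjoint_Ioc_nat_cast :
    Pairwise (Function.onFun Disjoint fun n : ℕ => Ioc (n : ℝ) (n + 1)) := by
  have := pairwise_disjoint_Ioc_add_intCast (0 : ℝ)
  intro m n hmn
  simpa [Function.onFun] using this (i := (m : ℤ)) (j := n) (by exact_mod_cast hmn)

lemma CountingPath.jumps_eq_sum (p : CountingPath) :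
    p.jumps = Measure.sum fun n : ℕ => p.jumps.restrict (Ioc (n : ℝ) (n + 1)) := by
  rw [← Measure.restrict_iUnion pairwise_disjoint_Ioc_nat_cast fun _ => measurableSet_Ioc,
    iUnion_Ioc_nat_cast, jumps_restrict_Ioi]

lemma measurable_jumps : Measurable CountingPath.jumps := by
  refine Measure.measurable_of_measurable_coe _ fun s hs => ?_
  have (p : CountingPath) : p.jumps s = ∑' n : ℕ, p.jumps.restrict (Ioc (n : ℝ) (n + 1)) s := by
    conv_lhs => rw [p.jumps_eq_sum]
    rw [Measure.sum_apply _ hs]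
  simp_rw [this]
  exact Measurable.tsum fun n =>
    (Measure.measurable_coe hs).comp (measurable_jumps_restrict _ _)

/-- The jump measure as a kernel. -/
def jumpKernel : Kernel CountingPath ℝ := ⟨CountingPath.jumps, measurable_jumps⟩

@[simp] lemma jumpKernel_apply (p : CountingPath) : jumpKernel p = p.jumps := rfl

/-- The number of jumps in a unit interval is finite for each path but not bounded over paths. The
kernel is therefore cut by unit interval and also by the number of jumps there; on the piece with m
jumps it has mass at most m. -/
instance : IsSFiniteKernel jumpKernel := by
  classical
  have hev (t : ℝ≥0) : Measurable fun p : CountingPath => p.1 t :=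
    (measurable_pi_apply t).comp measurable_subtype_coe
  let c (n : ℕ) (p : CountingPath) : ℕ :=
    p.1 (Real.toNNReal (n + 1)) - p.1 (Real.toNNReal n)
  have hc (n : ℕ) : Measurable (c n) := (hev _).sub (hev _)
  have hs (i : ℕ × ℕ) : MeasurableSet {p | c i.1 p = i.2} := hc i.1 (measurableSet_singleton i.2)
  let κ (i : ℕ × ℕ) : Kernel CountingPath ℝ :=
    Kernel.piecewise (hs i) (jumpKernel.restrict (measurableSet_Ioc (a := (i.1 : ℝ)) (b := i.1 + 1))) 0
  have hκ (i : ℕ × ℕ) : IsFiniteKernel (κ i) := by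
    refine ⟨⟨i.2, ENNReal.natCast_lt_top _, fun p => ?_⟩⟩
    simp only [κ, Kernel.piecewise_apply]
    split_ifs with h
    · rw [Kernel.restrict_apply, Measure.restrict_apply_univ, jumpKernel_apply,
        CountingPath.jumps_Ioc]
      exact Nat.cast_le.2 (le_of_eq h)
    · simp
  have : jumpKernel = Kernel.sum κ := by
    ext p s hs'
    rw [Kernel.sum_apply' _ _ hs', ENNReal.tsum_prod (f := fun n m => κ (n, m) p s),
      jumpKernel_apply]
    conv_lhs => rw [p.jumps_eq_sum, Measure.sum_apply _ hs']
    refine tsum_congr fun n => ?_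
    rw [tsum_eq_single (c n p)]
    · simp [κ, Kernel.piecewise_apply, Kernel.restrict_apply]
    · intro m hm
      simp [κ, Kernel.piecewise_apply, hm.symm]
  rw [this]
  exact Kernel.isSFiniteKernel_sum

instance (p : CountingPath) : SFinite p.jumps := by
  rw [← jumpKernel_apply]; infer_instance

/-! ### Poisson processes as random counting paths -/

section Poisson

variable {Ω : Type*} [MeasurableSpace Ω] {P : Measure Ω} {N : ℝ≥0 → Ω → ℕ}

/-- The path of a Poisson process. -/
def IsStandardPoisson.path (hN : IsStandardPoisson N P) (ω : Ω) : CountingPath :=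
  ⟨fun t => N t ω, hN.zero ω, hN.mono ω, fun t => hN.right_continuous ω t⟩

lemma IsStandardPoisson.measurable_path (hN : IsStandardPoisson N P) : Measurable hN.path :=
  (measurable_pi_lambda _ hN.measurable).subtype_mk

lemma IsStandardPoisson.indepFun_path (hN : IsStandardPoisson N P) {E : Type*} [MeasurableSpace E]
    {X : Ω → E} (h : IndepFun (fun ω t => N t ω) X P) : IndepFun hN.path X P := by
  rw [IndepFun_iff_Indep] at h ⊢
  convert h using 1
  change MeasurableSpace.comap hN.path (MeasurableSpace.comap Subtype.val _) = _
  rw [MeasurableSpace.comap_comp]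
  rfl

/-- Size biasing: n · rⁿ/n! = r · rⁿ⁻¹/(n-1)!. Taking f = 1 and f(n) = n yields the first two
moments. -/
lemma lintegral_natCast_mul_poissonMeasure (r : ℝ≥0) (f : ℕ → ℝ≥0∞) :
    ∫⁻ n : ℕ, n * f n ∂(poissonMeasure r) = r * ∫⁻ n : ℕ, f (n + 1) ∂(poissonMeasure r) := by
  have h (f : ℕ → ℝ≥0∞) : ∫⁻ n : ℕ, f n ∂(poissonMeasure r) =
      ∑' n, ENNReal.ofReal (Real.exp (-r) * r ^ n / n.factorial) * f n := by
    simp [poissonMeasure, lintegral_sum_measure, lintegral_smul_measure]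
  rw [h, h, tsum_eq_zero_add' ENNReal.summable, ← ENNReal.tsum_mul_left]
  simp only [Nat.cast_zero, zero_mul, mul_zero, zero_add]
  refine tsum_congr fun n => ?_
  rw [← mul_assoc, ← mul_assoc, ← ENNReal.ofReal_natCast, ← ENNReal.ofReal_coe_nnreal,
    ← ENNReal.ofReal_mul (by positivity), ← ENNReal.ofReal_mul (by positivity)]
  congr 2
  rw [Nat.factorial_succ]
  push_cast
  field_simp
  ring

lemma lintegral_poissonMeasure (r : ℝ≥0) : ∫⁻ n : ℕ, (n : ℝ≥0∞) ∂(poissonMeasure r) = r := by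
  simpa using lintegral_natCast_mul_poissonMeasure r 1

lemma lintegral_sq_poissonMeasure (r : ℝ≥0) :
    ∫⁻ n : ℕ, (n : ℝ≥0∞) ^ 2 ∂(poissonMeasure r) = r + r ^ 2 := by
  simp_rw [sq]
  rw [lintegral_natCast_mul_poissonMeasure r fun n => (n : ℝ≥0∞)]
  push_cast
  rw [lintegral_add_right _ measurable_const, lintegral_poissonMeasure]
  simp [mul_add, add_comm]

end Poisson

section Poisson

variable {Ω : Type*} [MeasurableSpace Ω] {P : Measure Ω} {N : ℝ≥0 → Ω → ℕ}

/-! ### Moment formulas for Poisson integrals -/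

lemma IsStandardPoisson.jumps_path_Ioc (hN : IsStandardPoisson N P) (ω : Ω) (x y : ℝ) :
    (hN.path ω).jumps (Ioc x y) = ((N (Real.toNNReal y) ω - N (Real.toNNReal x) ω : ℕ) : ℝ≥0∞) :=
  (hN.path ω).jumps_Ioc x y

lemma IsStandardPoisson.lintegral_increment (hN : IsStandardPoisson N P) {s t : ℝ≥0} (h : s ≤ t) :
    ∫⁻ ω, ((N t ω - N s ω : ℕ) : ℝ≥0∞) ∂P = (t - s : ℝ≥0) := by
  rw [(hN.law_increment s t h).lintegral_comp (f := fun n : ℕ => (n : ℝ≥0∞))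
    (measurable_of_countable _).aemeasurable, lintegral_poissonMeasure]

/-- Split N_u at s and t. The outer pieces are independent of the middle increment, and the square
of the middle one has mean (t-s) + (t-s)². The products of means add up to u(t-s), and the variance
of the middle piece supplies the remaining t-s. -/
lemma IsStandardPoisson.lintegral_increment_mul (hN : IsStandardPoisson N P) {s t u : ℝ≥0}
    (hst : s ≤ t) (htu : t ≤ u) :
    ∫⁻ ω, (N u ω : ℝ≥0∞) * ((N t ω - N s ω : ℕ) : ℝ≥0∞) ∂P = (1 + u) * (t - s : ℝ≥0) := by
  have hmeas (s t : ℝ≥0) : Measurable fun ω => ((N t ω - N s ω : ℕ) : ℝ≥0∞) :=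
    (measurable_of_countable fun n : ℕ => (n : ℝ≥0∞)).comp
      ((hN.measurable t).sub (hN.measurable s))
  have hind {r s t : ℝ≥0} (hrs : r ≤ s) (hst : s ≤ t) :
      ∫⁻ ω, ((N s ω - N r ω : ℕ) : ℝ≥0∞) * ((N t ω - N s ω : ℕ) : ℝ≥0∞) ∂P =
        (s - r : ℝ≥0) * (t - s : ℝ≥0) := by
    have h1 : IndepFun (fun ω => ((N s ω - N r ω : ℕ) : ℝ≥0∞))
        (fun ω => ((N t ω - N s ω : ℕ) : ℝ≥0∞)) P :=
      (hN.indep_increments.indepFun_sub_sub hrs hst).comp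
        (φ := fun n : ℕ => (n : ℝ≥0∞)) (ψ := fun n : ℕ => (n : ℝ≥0∞))
        (measurable_of_countable _) (measurable_of_countable _)
    rw [lintegral_mul_eq_lintegral_mul_lintegral_of_indepFun'' (hmeas _ _).aemeasurable
      (hmeas _ _).aemeasurable h1, hN.lintegral_increment hrs, hN.lintegral_increment hst]
  have hsq : ∫⁻ ω, ((N t ω - N s ω : ℕ) : ℝ≥0∞) ^ 2 ∂P = (t - s : ℝ≥0) + (t - s : ℝ≥0) ^ 2 := by
    rw [(hN.law_increment s t hst).lintegral_comp (f := fun n : ℕ => (n : ℝ≥0∞) ^ 2)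
      (measurable_of_countable _).aemeasurable, lintegral_sq_poissonMeasure]
  have hdec (ω : Ω) : (N u ω : ℝ≥0∞) * ((N t ω - N s ω : ℕ) : ℝ≥0∞) =
      ((N s ω - N 0 ω : ℕ) : ℝ≥0∞) * ((N t ω - N s ω : ℕ) : ℝ≥0∞) +
      ((N t ω - N s ω : ℕ) : ℝ≥0∞) ^ 2 +
      ((N t ω - N s ω : ℕ) : ℝ≥0∞) * ((N u ω - N t ω : ℕ) : ℝ≥0∞) := by
    rw [hN.zero ω, Nat.sub_zero]
    have h1 : N s ω ≤ N t ω := hN.mono ω hst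
    have h2 : N t ω ≤ N u ω := hN.mono ω htu
    norm_cast
    zify [h1, h2]
    ring
  simp_rw [hdec]
  have hf1 : Measurable fun ω =>
      ((N s ω - N 0 ω : ℕ) : ℝ≥0∞) * ((N t ω - N s ω : ℕ) : ℝ≥0∞) := (hmeas _ _).mul (hmeas _ _)
  have hf2 : Measurable fun ω =>
      ((N s ω - N 0 ω : ℕ) : ℝ≥0∞) * ((N t ω - N s ω : ℕ) : ℝ≥0∞) +
      ((N t ω - N s ω : ℕ) : ℝ≥0∞) ^ 2 := hf1.add ((hmeas _ _).pow_const 2)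
  rw [lintegral_add_left hf2, lintegral_add_left hf1, hind zero_le hst, hsq, hind hst htu]
  norm_cast
  rw [tsub_zero]
  obtain ⟨a, rfl⟩ := exists_add_of_le hst
  obtain ⟨c, rfl⟩ := exists_add_of_le htu
  simp only [add_tsub_cancel_left]
  ring

/-- Campbell's formula. -/
theorem IsStandardPoisson.lintegral_jumps (hN : IsStandardPoisson N P) {H : ℝ → ℝ≥0∞}
    (hH : Measurable H) :
    ∫⁻ ω, ∫⁻ s, H s ∂(hN.path ω).jumps ∂P = ∫⁻ s in Ioi 0, H s := by
  have hm : Measurable fun ω => (hN.path ω).jumps := measurable_jumps.comp hN.measurable_path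
  -- It suffices that the mean of the jump measure is Lebesgue measure on the positive half-line,
  -- which is tested on half-open intervals.
  rw [← Measure.lintegral_bind hm.aemeasurable hH.aemeasurable]
  congr 1
  refine Measure.ext_of_Ioc' _ _ ?_ ?_
  all_goals
    intro x y hxy
    rw [Measure.bind_apply measurableSet_Ioc hm.aemeasurable]
    simp_rw [hN.jumps_path_Ioc]
    rw [hN.lintegral_increment (Real.toNNReal_le_toNNReal hxy.le)]
  · exact ENNReal.coe_ne_top
  · rw [Measure.restrict_apply measurableSet_Ioc, Ioc_inter_Ioi, Real.volume_Ioc,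
      ENNReal.ofReal, ENNReal.coe_inj]
    ext
    rw [NNReal.coe_sub (Real.toNNReal_le_toNNReal hxy.le)]
    simp only [Real.coe_toNNReal']
    rcases le_total x 0 with h | h <;> rcases le_total y 0 with h' | h' <;>
      simp [h, h'] <;> linarith

/-- Under the law weighted by N_T the mean jump measure on (0,T] is (1+T) dr: the jump at r counts
itself once, and the other jumps contribute T on average. -/
lemma IsStandardPoisson.lintegral_jumps_mul (hN : IsStandardPoisson N P) (T : ℝ≥0) {H : ℝ → ℝ≥0∞}
    (hH : Measurable H) :
    ∫⁻ ω, (hN.path ω).jumps (Ioc 0 T) * ∫⁻ s in Ioc 0 (T : ℝ), H s ∂(hN.path ω).jumps ∂P =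
      (1 + T) * ∫⁻ s in Ioc 0 (T : ℝ), H s := by
  have hm : Measurable fun ω => (hN.path ω).jumps.restrict (Ioc 0 (T : ℝ)) :=
    (measurable_jumps_restrict _ _).comp hN.measurable_path
  have hw : Measurable fun ω => (hN.path ω).jumps (Ioc 0 (T : ℝ)) :=
    (Measure.measurable_coe measurableSet_Ioc).comp (measurable_jumps.comp hN.measurable_path)
  have hm' : AEMeasurable (fun ω => (hN.path ω).jumps.restrict (Ioc 0 (T : ℝ)))
    (P.withDensity fun ω => (hN.path ω).jumps (Ioc 0 (T : ℝ))) := hm.aemeasurable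
  have h1 := lintegral_withDensity_eq_lintegral_mul P hw
    ((Measure.measurable_lintegral hH).comp hm)
  simp only [Pi.mul_apply, Function.comp_apply] at h1
  rw [← h1, ← Measure.lintegral_bind hm' hH.aemeasurable,
    ← smul_eq_mul (a := (1 + T : ℝ≥0∞)), ← lintegral_smul_measure]
  congr 1
  refine Measure.ext_of_Ioc' _ _ ?_ ?_
  all_goals
    intro x y hxy
    have h2 := lintegral_withDensity_eq_lintegral_mul P hw
      ((Measure.measurable_coe (measurableSet_Ioc (a := x) (b := y))).comp hm)
    simp only [Function.comp_apply] at h2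
    rw [Measure.bind_apply measurableSet_Ioc hm', h2]
    simp only [Pi.mul_apply, Function.comp_apply, Measure.restrict_apply measurableSet_Ioc,
      Ioc_inter_Ioc]
    simp_rw [hN.jumps_path_Ioc]
    have h0 (ω : Ω) : N (Real.toNNReal T) ω - N (Real.toNNReal 0) ω = N T ω := by
      simp [hN.zero]
    simp_rw [h0]
    rcases le_total (y ⊓ T) (x ⊔ 0) with h | h
    swap
    rw [hN.lintegral_increment_mul (Real.toNNReal_le_toNNReal h)
      (Real.toNNReal_le_iff_le_coe.2 inf_le_right)]
  · exact ENNReal.mul_ne_top (by simp) ENNReal.coe_ne_top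
  · have (ω : Ω) : N (Real.toNNReal (y ⊓ T)) ω - N (Real.toNNReal (x ⊔ 0)) ω = 0 :=
      Nat.sub_eq_zero_of_le (hN.mono ω (Real.toNNReal_le_toNNReal h))
    simp [this]
  · rw [Measure.smul_apply, Measure.restrict_apply measurableSet_Ioc, Ioc_inter_Ioc,
      Real.volume_Ioc, smul_eq_mul, ENNReal.ofReal]
    congr 2
    ext
    rw [NNReal.coe_sub (Real.toNNReal_le_toNNReal h), Real.coe_toNNReal _ (sub_nonneg.2 h),
      Real.coe_toNNReal _ (le_sup_right.trans h), Real.coe_toNNReal _ le_sup_right]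
  · have (ω : Ω) : N (Real.toNNReal (y ⊓ T)) ω - N (Real.toNNReal (x ⊔ 0)) ω = 0 :=
      Nat.sub_eq_zero_of_le (hN.mono ω (Real.toNNReal_le_toNNReal h))
    rw [Measure.smul_apply, Measure.restrict_apply measurableSet_Ioc, Ioc_inter_Ioc, Ioc_eq_empty
      (not_lt.2 h)]
    simp [this]

/-- Cauchy–Schwarz with respect to the jump measure on (0,T], whose total mass is N_T; the mean of
the resulting product is known exactly. -/
lemma IsStandardPoisson.lintegral_jumps_sq_le (hN : IsStandardPoisson N P) (T : ℝ≥0)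
    {H : ℝ → ℝ≥0∞} (hH : Measurable H) :
    ∫⁻ ω, (∫⁻ s in Ioc 0 (T : ℝ), H s ∂(hN.path ω).jumps) ^ 2 ∂P ≤
      (1 + T) * ∫⁻ s in Ioc 0 (T : ℝ), H s ^ 2 := by
  rw [← hN.lintegral_jumps_mul T (hH.pow_const 2)]
  refine lintegral_mono fun ω => ?_
  have h := ENNReal.lintegral_mul_le_Lp_mul_Lq ((hN.path ω).jumps.restrict (Ioc 0 (T : ℝ)))
    Real.HolderConjugate.two_two hH.aemeasurable (g := fun _ => 1) aemeasurable_const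
  simp only [Pi.mul_apply, mul_one, ENNReal.one_rpow, lintegral_const, Measure.restrict_apply_univ,
    one_mul] at h
  calc _ ≤ _ := pow_le_pow_left' h 2
    _ = _ := by
      rw [mul_pow, ← ENNReal.rpow_natCast, ← ENNReal.rpow_natCast, ← ENNReal.rpow_mul,
        ← ENNReal.rpow_mul]
      norm_num [mul_comm]

end Poisson

/-! ### Riemann sums -/

/-- Sampling g at ⌈sn⌉/n, the right endpoint of the cell of s, turns the integral into a finite sum
over increments of μ. For jump measures these increments are independent variables. -/
lemma setIntegral_ceil_step {E : Type*} [NormedAddCommGroup E] [NormedSpace ℝ E]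
    [CompleteSpace E] {μ : Measure ℝ}
    (hμ : ∀ x y, μ (Ioc x y) < ∞) {n : ℕ} (hn : 0 < n) (g : ℝ → E) (m : ℕ) :
    IntegrableOn (fun s : ℝ => g (⌈s * n⌉₊ / n)) (Ioc 0 (m / n)) μ ∧
    ∫ s in Ioc 0 ((m : ℝ) / n), g (⌈s * n⌉₊ / n) ∂μ =
      ∑ k ∈ Finset.range m, μ.real (Ioc (k / n) ((k + 1) / n)) • g ((k + 1) / n) := by
  have hn' : (0 : ℝ) < n := by exact_mod_cast hn
  induction m with
  | zero => simp
  | succ m ih =>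
    have hEq : EqOn (fun s : ℝ => g (⌈s * n⌉₊ / n)) (fun _ => g ((m + 1) / n))
        (Ioc ((m : ℝ) / n) ((m + 1) / n)) := by
      intro s hs
      have : ⌈s * n⌉₊ = m + 1 := by
        rw [Nat.ceil_eq_iff (Nat.succ_ne_zero m)]
        rw [mem_Ioc, div_lt_iff₀ hn', le_div_iff₀ hn'] at hs
        simpa using hs
      simp [this]
    have hU : Ioc (0 : ℝ) (((m + 1 : ℕ) : ℝ) / n) =
        Ioc (0 : ℝ) (m / n) ∪ Ioc ((m : ℝ) / n) ((m + 1) / n) := by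
      rw [Ioc_union_Ioc_eq_Ioc (by positivity) (by gcongr; simp)]
      simp
    have hI : IntegrableOn (fun s : ℝ => g (⌈s * n⌉₊ / n)) (Ioc ((m : ℝ) / n) ((m + 1) / n)) μ :=
      (integrableOn_const (hμ _ _).ne).congr_fun hEq.symm measurableSet_Ioc
    rw [hU, setIntegral_union (Ioc_disjoint_Ioc_of_le le_rfl) measurableSet_Ioc ih.1 hI, ih.2,
      Finset.sum_range_succ, setIntegral_congr_fun measurableSet_Ioc hEq, setIntegral_const]
    exact ⟨ih.1.union hI, rfl⟩

/-- The sampling points ⌈sn⌉/n tend to s, so dominated convergence applies. The measure is left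
general because the result serves both the jump measure of a path and Lebesgue measure. Using n + 1
cells per unit avoids division by zero. -/
lemma tendsto_setIntegral_ceil_step {E : Type*} [NormedAddCommGroup E] [NormedSpace ℝ E]
    [CompleteSpace E] {μ : Measure ℝ}
    (hμ : ∀ x y, μ (Ioc x y) < ∞) {g : ℝ → E} (hg : Continuous g) {B : ℝ} (hB : ∀ x, ‖g x‖ ≤ B)
    (T : ℕ) :
    Tendsto (fun n : ℕ => ∑ k ∈ Finset.range (T * (n + 1)),
      μ.real (Ioc ((k : ℝ) / (n + 1 : ℕ)) ((k + 1) / (n + 1 : ℕ))) • g ((k + 1) / (n + 1 : ℕ)))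
      atTop (𝓝 (∫ s in Ioc 0 (T : ℝ), g s ∂μ)) := by
  have h1 (n : ℕ) : ((T * (n + 1) : ℕ) : ℝ) / (n + 1 : ℕ) = T := by
    push_cast; field_simp
  simp_rw [← fun n : ℕ => (setIntegral_ceil_step hμ n.succ_pos g (T * (n + 1))).2, h1]
  have : IsFiniteMeasure (μ.restrict (Ioc 0 (T : ℝ))) := ⟨by simpa using hμ 0 T⟩
  refine tendsto_integral_of_dominated_convergence (fun _ => B) (fun n => ?_)
    (integrable_const B) (fun n => ae_of_all _ fun s => hB _) ?_
  · have := (setIntegral_ceil_step hμ n.succ_pos g (T * (n + 1))).1.aestronglyMeasurable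
    rwa [h1] at this
  · refine (ae_restrict_iff' measurableSet_Ioc).2 (ae_of_all _ fun s hs => ?_)
    refine (hg.tendsto s).comp ?_
    exact (tendsto_nat_ceil_mul_div_atTop hs.1.le).comp
      (tendsto_natCast_atTop_atTop.comp (tendsto_add_atTop_nat 1))

lemma norm_exp_ofReal_mul_I_sub_le (x y : ℝ) :
    ‖Complex.exp (x * Complex.I) - Complex.exp (y * Complex.I)‖ ≤ ‖x - y‖ := by
  have h : Complex.exp (x * Complex.I) - Complex.exp (y * Complex.I) =
      Complex.exp (y * Complex.I) * (Complex.exp (Complex.I * (x - y : ℝ)) - 1) := by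
    rw [mul_sub, ← Complex.exp_add, mul_one]
    congr 2
    push_cast
    ring
  rw [h, norm_mul, Complex.norm_exp_ofReal_mul_I, one_mul]
  exact Real.norm_exp_I_mul_ofReal_sub_one_le

lemma norm_exp_ofReal_mul_I_sub_one_le (x : ℝ) :
    ‖Complex.exp (x * Complex.I) - 1‖ ≤ ‖x‖ := by
  simpa using norm_exp_ofReal_mul_I_sub_le x 0

/-- The exponent `∫_0^∞ (e^{i f(s)} - 1) ds` of the characteristic function of `∫ f dN`. -/
def poissonExponent (f : ℝ → ℝ) : ℂ := ∫ s in Ioi 0, (Complex.exp (f s * Complex.I) - 1)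

lemma integrable_exp_sub_one {μ : Measure ℝ} {f : ℝ → ℝ} (hf : Integrable f μ) :
    Integrable (fun s => Complex.exp (f s * Complex.I) - 1) μ := by
  refine hf.mono ?_ (ae_of_all _ fun s => norm_exp_ofReal_mul_I_sub_one_le _)
  exact (Complex.continuous_exp.comp (by fun_prop : Continuous fun x : ℝ => (x : ℂ) * Complex.I)
    |>.comp_aestronglyMeasurable hf.1).sub aestronglyMeasurable_const

/-! ### The characteristic functional: independence and time reversal of Poisson integrals -/

section Poisson

variable {Ω : Type*} [MeasurableSpace Ω] {P : Measure Ω} {N : ℝ≥0 → Ω → ℕ}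

lemma measurable_integral_jumps {f : ℝ → ℝ} (hf : Measurable f) :
    Measurable fun p : CountingPath => ∫ s, f s ∂p.jumps :=
  (hf.stronglyMeasurable.comp_measurable measurable_snd).integral_kernel_prod_right'
    (κ := jumpKernel) (f := fun x : CountingPath × ℝ => f x.2) |>.measurable

lemma IsStandardPoisson.measurable_integral (hN : IsStandardPoisson N P) {f : ℝ → ℝ}
    (hf : Measurable f) : Measurable fun ω => ∫ s, f s ∂(hN.path ω).jumps :=
  (measurable_integral_jumps hf).comp hN.measurable_path

lemma IsStandardPoisson.ae_lintegral_lt_top (hN : IsStandardPoisson N P) {H : ℝ → ℝ≥0∞}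
    (hH : Measurable H) (hfin : ∫⁻ s in Ioi 0, H s ≠ ∞) :
    ∀ᵐ ω ∂P, ∫⁻ s, H s ∂(hN.path ω).jumps < ∞ := by
  refine ae_lt_top ?_ (by rwa [hN.lintegral_jumps hH])
  exact (Measure.measurable_lintegral hH).comp (measurable_jumps.comp hN.measurable_path)

lemma IsStandardPoisson.ae_integrable (hN : IsStandardPoisson N P) {f : ℝ → ℝ}
    (hf : Measurable f) (hfi : IntegrableOn f (Ioi 0)) :
    ∀ᵐ ω ∂P, Integrable f (hN.path ω).jumps := by
  filter_upwards [hN.ae_lintegral_lt_top hf.enorm hfi.2.ne] with ω h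
  exact ⟨hf.aestronglyMeasurable, h⟩

lemma IsStandardPoisson.lintegral_enorm_integral_sub_le (hN : IsStandardPoisson N P) {f g : ℝ → ℝ}
    (hf : Measurable f) (hfi : IntegrableOn f (Ioi 0))
    (hg : Measurable g) (hgi : IntegrableOn g (Ioi 0)) :
    ∫⁻ ω, ‖(∫ s, f s ∂(hN.path ω).jumps) - ∫ s, g s ∂(hN.path ω).jumps‖ₑ ∂P ≤
      ∫⁻ s in Ioi 0, ‖f s - g s‖ₑ := by
  rw [← hN.lintegral_jumps (H := fun s => ‖f s - g s‖ₑ) (hf.sub hg).enorm]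
  refine lintegral_mono_ae ?_
  filter_upwards [hN.ae_integrable hf hfi, hN.ae_integrable hg hgi] with ω h1 h2
  rw [← integral_sub h1 h2]
  exact enorm_integral_le_lintegral_enorm _

lemma IsStandardPoisson.integral_exp_increment (hN : IsStandardPoisson N P) {s t : ℝ≥0}
    (h : s ≤ t) (c : ℝ) :
    ∫ ω, Complex.exp (((N t ω - N s ω : ℕ) : ℝ) * c * Complex.I) ∂P =
      Complex.exp ((t - s : ℝ≥0) * (Complex.exp (c * Complex.I) - 1)) := by
  have h1 := (hN.law_increment s t h).integral_comp
    (f := fun n : ℕ => Complex.exp ((n : ℝ) * c * Complex.I)) .of_discrete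
  simp only [Function.comp_def] at h1
  rw [h1, ← charFun_map_cast_poissonMeasure, charFun_apply_real,
    integral_map .of_discrete (by fun_prop)]
  simp only [mul_comm]

/-- Independence of the increments factorizes the expectation, and each factor is the characteristic
function of a Poisson variable. -/
lemma IsStandardPoisson.integral_exp_step (hN : IsStandardPoisson N P) [IsProbabilityMeasure P]
    {n : ℕ} (hn : 0 < n) (m : ℕ) (c : ℕ → ℝ) :
    ∫ ω, Complex.exp ((∑ k ∈ Finset.range m,
        (hN.path ω).jumps.real (Ioc ((k : ℝ) / n) ((k + 1) / n)) • c k : ℝ) * Complex.I) ∂P =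
      Complex.exp (∑ k ∈ Finset.range m,
        volume.real (Ioc ((k : ℝ) / n) ((k + 1) / n)) • (Complex.exp (c k * Complex.I) - 1)) := by
  have hn' : (0 : ℝ) < n := by exact_mod_cast hn
  let t (k : ℕ) : ℝ≥0 := Real.toNNReal ((k : ℝ) / n)
  have ht : Monotone t := fun i j hij => Real.toNNReal_le_toNNReal (by gcongr)
  have hind := hN.indep_increments m (fun i : Fin (m + 1) => t i)
    (ht.comp (fun i j h => h))
  have h1 := hind.integral_fun_prod_comp (𝕜 := ℂ)
    (f := fun (k : Fin m) (x : ℕ) => Complex.exp ((x : ℝ) * c k * Complex.I))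
    (fun i => ((hN.measurable _).sub (hN.measurable _)).aemeasurable)
    (fun i => .of_discrete)
  have hreal (ω : Ω) (k : ℕ) : (hN.path ω).jumps.real (Ioc ((k : ℝ) / n) ((k + 1) / n)) =
      ((N (t (k + 1)) ω - N (t k) ω : ℕ) : ℝ) := by
    rw [measureReal_def, hN.jumps_path_Ioc, ENNReal.toReal_natCast]
    simp [t]
  have hlaw (k : ℕ) := hN.integral_exp_increment (ht k.le_succ) (c k)
  simp only [hreal]
  calc _ = ∫ ω, (∏ k : Fin m, Complex.exp
      (((N (t (k + 1)) ω - N (t k) ω : ℕ) : ℝ) * c k * Complex.I)) ∂P := by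
        refine integral_congr_ae (ae_of_all _ fun ω => ?_)
        simp only
        rw [← Complex.exp_sum, Finset.sum_range, Complex.ofReal_sum, Finset.sum_mul]
        simp
    _ = ∏ k : Fin m, (∫ ω, Complex.exp
      (((N (t (k + 1)) ω - N (t k) ω : ℕ) : ℝ) * c k * Complex.I) ∂P) := by
        simpa using h1
    _ = _ := by
        simp only [Nat.succ_eq_add_one] at hlaw
        rw [Finset.sum_range, Complex.exp_sum]
        refine Finset.prod_congr rfl fun k _ => ?_
        rw [hlaw k]
        congr 1
        rw [Complex.real_smul]
        congr 1
        rw [Real.volume_real_Ioc_of_le (by gcongr; simp)]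
        have : ((t (k + 1) - t k : ℝ≥0) : ℝ) = ((k : ℕ) + 1 : ℝ) / n - (k : ℕ) / n := by
          rw [NNReal.coe_sub (ht (Nat.le_succ _))]
          simp only [t]
          rw [Real.coe_toNNReal _ (by positivity), Real.coe_toNNReal _ (by positivity)]
          push_cast
          rfl
        rw [← this]

lemma IsStandardPoisson.integral_exp_of_continuous (hN : IsStandardPoisson N P)
    [IsProbabilityMeasure P] {f : ℝ → ℝ} (hf : Continuous f) (hfc : HasCompactSupport f) :
    ∫ ω, Complex.exp ((∫ s, f s ∂(hN.path ω).jumps : ℝ) * Complex.I) ∂P =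
      Complex.exp (poissonExponent f) := by
  obtain ⟨B, hB⟩ := hf.bounded_above_of_compact_support hfc
  obtain ⟨R, hR⟩ := hfc.isCompact.isBounded.subset_closedBall 0
  -- An integer endpoint makes the grid of mesh 1/(n+1) fit (0,T] exactly.
  obtain ⟨T, hT⟩ := exists_nat_ge R
  have hsupp (s : ℝ) (hs : s ∈ Ioi 0 \ Ioc 0 (T : ℝ)) : f s = 0 := by
    by_contra h
    have h1 := hR (subset_tsupport f h)
    rw [mem_closedBall_zero_iff, Real.norm_eq_abs, abs_le] at h1
    exact hs.2 ⟨hs.1, h1.2.trans hT⟩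
  have hX (ω : Ω) : ∫ s, f s ∂(hN.path ω).jumps =
      ∫ s in Ioc 0 (T : ℝ), f s ∂(hN.path ω).jumps := by
    rw [← (hN.path ω).jumps_restrict_Ioi,
      setIntegral_eq_of_subset_of_forall_sdiff_eq_zero measurableSet_Ioi Ioc_subset_Ioi_self hsupp]
    rw [(hN.path ω).jumps_restrict_Ioi]
  have hE : poissonExponent f = ∫ s in Ioc 0 (T : ℝ), (Complex.exp (f s * Complex.I) - 1) := by
    refine setIntegral_eq_of_subset_of_forall_sdiff_eq_zero measurableSet_Ioi Ioc_subset_Ioi_self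
      fun s hs => ?_
    simp [hsupp s hs]
  have hl1 (ω : Ω) := tendsto_setIntegral_ceil_step (hN.path ω).jumps_Ioc_lt_top hf hB T
  have hl2 := tendsto_setIntegral_ceil_step (μ := volume) (fun _ _ => measure_Ioc_lt_top)
    (g := fun s => Complex.exp (f s * Complex.I) - 1) (by fun_prop) (B := B)
    (fun s => (norm_exp_ofReal_mul_I_sub_one_le _).trans (hB s)) T
  simp_rw [hX, hE]
  refine tendsto_nhds_unique ?_ ((Complex.continuous_exp.tendsto _).comp hl2)
  simp only [Function.comp_def]
  simp_rw [← fun n : ℕ => hN.integral_exp_step n.succ_pos (T * (n + 1))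
    (fun k => f ((k + 1) / (n + 1 : ℕ)))]
  refine tendsto_integral_of_dominated_convergence (fun _ => 1) (fun n => ?_)
    (integrable_const 1) (fun n => ae_of_all _ fun ω => (Complex.norm_exp_ofReal_mul_I _).le)
    (ae_of_all _ fun ω => ?_)
  · refine Measurable.aestronglyMeasurable ?_
    have (x y : ℝ) : Measurable fun ω => (hN.path ω).jumps.real (Ioc x y) :=
      ((Measure.measurable_coe measurableSet_Ioc).comp
        (measurable_jumps.comp hN.measurable_path)).ennreal_toReal
    have h2 : Measurable fun ω => ∑ k ∈ Finset.range (T * (n + 1)),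
        (hN.path ω).jumps.real (Ioc ((k : ℝ) / (n + 1 : ℕ)) ((k + 1) / (n + 1 : ℕ))) •
          f ((k + 1) / (n + 1 : ℕ)) :=
      Finset.measurable_fun_sum _ fun k _ => (this _ _).smul_const _
    exact (Complex.measurable_ofReal.comp h2).mul_const _ |>.cexp
  · exact ((by fun_prop : Continuous fun x : ℝ => Complex.exp (x * Complex.I)).tendsto _).comp
      (hl1 ω)

/-- The characteristic functional of a Poisson process. -/
theorem IsStandardPoisson.integral_exp (hN : IsStandardPoisson N P) [IsProbabilityMeasure P]
    {f : ℝ → ℝ} (hf : Measurable f) (hfi : IntegrableOn f (Ioi 0)) :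
    ∫ ω, Complex.exp ((∫ s, f s ∂(hN.path ω).jumps : ℝ) * Complex.I) ∂P =
      Complex.exp (poissonExponent f) := by
  have hη (n : ℕ) : ((n : ℝ≥0∞) + 1)⁻¹ ≠ 0 := by simp
  -- Both sides are continuous in the L¹ norm of the integrand: the left one by Campbell's formula,
  -- the exponent on the right because |e^{ix} - e^{iy}| ≤ |x - y|. Hence density of compactly
  -- supported continuous functions suffices.
  choose g hgc hgf hg hgi using fun n => hfi.exists_hasCompactSupport_lintegral_sub_le (hη n)
  have hlim : Tendsto (fun n : ℕ => ((n : ℝ≥0∞) + 1)⁻¹) atTop (𝓝 0) := by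
    have := ENNReal.tendsto_inv_nat_nhds_zero.comp (tendsto_add_atTop_nat 1)
    simpa [Function.comp_def] using this
  have hexp (x y : ℝ) :
      ‖Complex.exp (x * Complex.I) - Complex.exp (y * Complex.I)‖ₑ ≤ ‖y - x‖ₑ := by
    rw [enorm_sub_rev y x]
    exact enorm_le_iff_norm_le.2 (norm_exp_ofReal_mul_I_sub_le x y)
  have hint {h : ℝ → ℝ} (hh : Measurable h) :
      Integrable (fun ω => Complex.exp ((∫ s, h s ∂(hN.path ω).jumps : ℝ) * Complex.I)) P := by
    refine (integrable_const (1 : ℝ)).mono ?_ (ae_of_all _ fun ω => ?_)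
    · exact ((Complex.measurable_ofReal.comp (hN.measurable_integral hh)).mul_const _
        |>.cexp).aestronglyMeasurable
    · rw [Complex.norm_exp_ofReal_mul_I]; simp
  have h1 : Tendsto (fun n => ∫ ω, Complex.exp
      ((∫ s, g n s ∂(hN.path ω).jumps : ℝ) * Complex.I) ∂P) atTop
      (𝓝 (∫ ω, Complex.exp ((∫ s, f s ∂(hN.path ω).jumps : ℝ) * Complex.I) ∂P)) := by
    refine tendsto_integral_of_L1 _ (hint hf).1 (Eventually.of_forall fun n =>
      hint (hg n).measurable) (tendsto_of_tendsto_of_tendsto_of_le_of_le tendsto_const_nhds hlim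
        (fun _ => zero_le) fun n => ?_)
    refine le_trans ?_ (hgf n)
    refine le_trans ?_ (hN.lintegral_enorm_integral_sub_le hf hfi (hg n).measurable (hgi n))
    exact lintegral_mono fun ω => hexp _ _
  have h2 : Tendsto (fun n => poissonExponent (g n)) atTop (𝓝 (poissonExponent f)) := by
    refine tendsto_integral_of_L1 _ (integrable_exp_sub_one hfi).1 (Eventually.of_forall fun n =>
      integrable_exp_sub_one (hgi n)) (tendsto_of_tendsto_of_tendsto_of_le_of_le tendsto_const_nhds
        hlim (fun _ => zero_le) fun n => ?_)
    refine le_trans (lintegral_mono fun s => ?_) (hgf n)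
    rw [sub_sub_sub_cancel_right]
    exact hexp _ _
  refine tendsto_nhds_unique h1 ?_
  simp_rw [fun n => hN.integral_exp_of_continuous (hg n) (hgc n)]
  exact (Complex.continuous_exp.tendsto _).comp h2

lemma IsStandardPoisson.charFun_integral (hN : IsStandardPoisson N P) [IsProbabilityMeasure P]
    {f : ℝ → ℝ} (hf : Measurable f) (hfi : IntegrableOn f (Ioi 0)) (t : ℝ) :
    charFun (P.map fun ω => ∫ s, f s ∂(hN.path ω).jumps) t =
      Complex.exp (poissonExponent fun s => t * f s) := by
  rw [← hN.integral_exp (hf.const_mul t) (hfi.const_mul t), charFun_apply_real,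
    integral_map (hN.measurable_integral hf).aemeasurable (by fun_prop)]
  simp_rw [integral_const_mul, Complex.ofReal_mul]

/-- Integrals of functions with disjoint supports are independent. -/
theorem IsStandardPoisson.indepFun_integral (hN : IsStandardPoisson N P) [IsProbabilityMeasure P]
    {f g : ℝ → ℝ} (hf : Measurable f) (hfi : IntegrableOn f (Ioi 0))
    (hg : Measurable g) (hgi : IntegrableOn g (Ioi 0)) (hfg : ∀ s, f s = 0 ∨ g s = 0) :
    IndepFun (fun ω => ∫ s, f s ∂(hN.path ω).jumps) (fun ω => ∫ s, g s ∂(hN.path ω).jumps) P := by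
  rw [indepFun_iff_charFun_prod (hN.measurable_integral hf).aemeasurable
    (hN.measurable_integral hg).aemeasurable]
  intro t
  rw [hN.charFun_integral hf hfi, hN.charFun_integral hg hgi, ← Complex.exp_add]
  have hsum : poissonExponent (fun s => t.ofLp.1 * f s) +
      poissonExponent (fun s => t.ofLp.2 * g s) =
      poissonExponent (fun s => t.ofLp.1 * f s + t.ofLp.2 * g s) := by
    rw [poissonExponent, poissonExponent, ← integral_add
      (integrable_exp_sub_one (hfi.const_mul _)) (integrable_exp_sub_one (hgi.const_mul _))]
    refine integral_congr_ae (ae_of_all _ fun s => ?_)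
    -- One of the two phases p, q vanishes at each s, so e^{i(p+q)} - 1 = (e^{ip} - 1) + (e^{iq} -
    -- 1).
    rcases hfg s with h | h <;> simp [h]
  rw [hsum, ← hN.integral_exp (f := fun s => t.ofLp.1 * f s + t.ofLp.2 * g s)
    ((hf.const_mul _).add (hg.const_mul _))
    ((hfi.const_mul _).add (hgi.const_mul _)), charFun_apply, integral_map]
  · refine integral_congr_ae ?_
    filter_upwards [hN.ae_integrable hf hfi, hN.ae_integrable hg hgi] with ω h1 h2
    rw [integral_add (h1.const_mul _) (h2.const_mul _), integral_const_mul, integral_const_mul]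
    simp [WithLp.prod_inner_apply, mul_comm]
  · have := ((hN.measurable_integral hf).prodMk (hN.measurable_integral hg))
    exact (WithLp.measurable_toLp 2 _ |>.comp this).aemeasurable
  · exact Continuous.aestronglyMeasurable (by fun_prop)

/-- A Poisson process on a finite interval is invariant in law under time reversal. -/
theorem IsStandardPoisson.map_integral_reverse (hN : IsStandardPoisson N P)
    [IsProbabilityMeasure P] {f : ℝ → ℝ} (hf : Measurable f) (hfi : IntegrableOn f (Ioi 0))
    {c : ℝ} (hc : 0 ≤ c) :
    P.map (fun ω => ∫ s in Ioc 0 c, f (c - s) ∂(hN.path ω).jumps) =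
      P.map (fun ω => ∫ s in Ioc 0 c, f s ∂(hN.path ω).jumps) := by
  have hfi' : IntegrableOn f (Ioc 0 c) := hfi.mono_set Ioc_subset_Ioi_self
  have hrev : IntegrableOn (fun s => f (c - s)) (Ioc 0 c) := by
    rw [← intervalIntegrable_iff_integrableOn_Ioc_of_le hc] at hfi' ⊢
    simpa using (hfi'.comp_sub_left c).symm
  have key {g : ℝ → ℝ} (hg : Measurable g) (hgi : IntegrableOn g (Ioc 0 c)) (t : ℝ) :
      charFun (P.map fun ω => ∫ s in Ioc 0 c, g s ∂(hN.path ω).jumps) t =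
        Complex.exp (∫ s in (0 : ℝ)..c, (Complex.exp ((t * g s : ℝ) * Complex.I) - 1)) := by
    have h1 : IntegrableOn ((Ioc 0 c).indicator g) (Ioi 0) :=
      ((integrable_indicator_iff measurableSet_Ioc).2 hgi).integrableOn
    simp_rw [← integral_indicator measurableSet_Ioc]
    rw [hN.charFun_integral (hg.indicator measurableSet_Ioc) h1,
      intervalIntegral.integral_of_le hc, poissonExponent]
    congr 1
    refine (setIntegral_eq_of_subset_of_forall_sdiff_eq_zero (μ := volume)
      (f := fun s => Complex.exp ((t * (Ioc 0 c).indicator g s : ℝ) * Complex.I) - 1)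
      measurableSet_Ioi (fun _ h => h.1 : Ioc 0 c ⊆ Ioi 0) fun s hs => ?_).trans
      (setIntegral_congr_fun measurableSet_Ioc fun s hs => ?_)
    · simp [indicator_of_notMem hs.2]
    · simp only [indicator_of_mem hs]
  have : IsFiniteMeasure (P.map fun ω => ∫ s in Ioc 0 c, f (c - s) ∂(hN.path ω).jumps) :=
    inferInstance
  -- The characteristic function depends on f only through ∫₀ᶜ (e^{itf} - 1) ds, which is unchanged
  -- by s ↦ c - s.
  refine Measure.ext_of_charFun (funext fun t => ?_)
  rw [key (g := fun s => f (c - s)) (hf.comp (measurable_const.sub measurable_id)) hrev,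
    key hf hfi']
  congr 1
  simpa using intervalIntegral.integral_comp_sub_left
    (fun s => Complex.exp ((t * f s : ℝ) * Complex.I) - 1) c (a := 0) (b := c)

end Poisson

/-! ### Bounds for the Green's function -/

lemma eigenvalue_ge {a : ℝ} (ha : 0 < a) (b : ℝ) (j : ℕ) : a * j ^ 2 ≤ eigenvalue a b j := by
  rw [eigenvalue]
  split_ifs with h
  · simp [h]
  · have h1 : (j : ℝ) ≤ j * Real.pi := le_mul_of_one_le_right j.cast_nonneg
      (by linarith [Real.pi_gt_three])
    gcongr
    nlinarith [sq_nonneg (drift a b), j.cast_nonneg (α := ℝ)]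

lemma eigenvalue_nonneg {a : ℝ} (ha : 0 < a) (b : ℝ) (j : ℕ) : 0 ≤ eigenvalue a b j :=
  le_trans (by positivity) (eigenvalue_ge ha b j)

lemma summable_exp_eigenvalue {a : ℝ} (ha : 0 < a) (b : ℝ) {u : ℝ} (hu : 0 < u) :
    Summable fun j => Real.exp (-(eigenvalue a b j * u)) := by
  refine Summable.of_nonneg_of_le (fun _ => (Real.exp_pos _).le) (fun j => ?_)
    (Real.summable_exp_nat_mul_iff.2 (by nlinarith : -(a * u) < 0))
  rw [Real.exp_le_exp]
  have h1 : (j : ℝ) ≤ (j : ℝ) ^ 2 := by exact_mod_cast Nat.le_self_pow two_ne_zero j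
  have h2 : a * j ≤ eigenvalue a b j := le_trans (by gcongr) (eigenvalue_ge ha b j)
  nlinarith

/-- The trace `∑_j e^{-σ_j u}` of the semigroup; it is infinite for `u ≤ 0`. -/
def heatTrace (a b u : ℝ) : ℝ≥0∞ := ∑' j : ℕ, ENNReal.ofReal (Real.exp (-(eigenvalue a b j * u)))

lemma measurable_heatTrace (a b : ℝ) : Measurable (heatTrace a b) :=
  Measurable.tsum fun _ => by fun_prop

lemma heatTrace_eq_ofReal {a : ℝ} (ha : 0 < a) (b : ℝ) {u : ℝ} (hu : 0 < u) :
    heatTrace a b u = ENNReal.ofReal (∑' j : ℕ, Real.exp (-(eigenvalue a b j * u))) :=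
  (ENNReal.ofReal_tsum_of_nonneg (fun _ => (Real.exp_pos _).le)
    (summable_exp_eigenvalue ha b hu)).symm

/-- The value ∞ acts as a marker: if a majorant containing the trace at t - s is integrable against
a jump measure, then almost no jump lies at or after t. -/
lemma heatTrace_of_nonpos {a : ℝ} (ha : 0 < a) (b : ℝ) {u : ℝ} (hu : u ≤ 0) :
    heatTrace a b u = ∞ := by
  refine top_le_iff.1 (le_trans (ENNReal.tsum_const_eq_top_of_ne_zero (α := ℕ) one_ne_zero).ge ?_)
  refine ENNReal.tsum_le_tsum fun j => ?_
  rw [ENNReal.one_le_ofReal, Real.one_le_exp_iff]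
  nlinarith [eigenvalue_nonneg ha b j]

lemma lintegral_exp_neg_mul_Ioi {c : ℝ} (hc : 0 < c) :
    ∫⁻ u in Ioi 0, ENNReal.ofReal (Real.exp (-(c * u))) = ENNReal.ofReal (1 / c) := by
  have hc' : -c < 0 := by linarith
  have h := integral_exp_mul_Ioi hc' 0
  rw [← ofReal_integral_eq_lintegral_ofReal]
  · simp only [neg_mul, mul_zero, Real.exp_zero] at h
    rw [h]; congr 1; ring
  · simpa [IntegrableOn] using integrableOn_exp_mul_Ioi hc' 0
  · exact ae_of_all _ fun _ => (Real.exp_pos _).le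

/-- Termwise integration gives ∑ 1/(α + σ_j), and σ_j grows like j². The integrability of the
Green's function near time 0 rests on this sum. -/
lemma lintegral_exp_mul_heatTrace_lt_top {a : ℝ} (ha : 0 < a) (b : ℝ) {α : ℝ} (hα : 0 < α) :
    ∫⁻ u in Ioi 0, ENNReal.ofReal (Real.exp (-(α * u))) * heatTrace a b u < ∞ := by
  have hpos (j : ℕ) : 0 < α + eigenvalue a b j := by linarith [eigenvalue_nonneg ha b j]
  have h1 : ∫⁻ u in Ioi 0, ENNReal.ofReal (Real.exp (-(α * u))) * heatTrace a b u =
      ∑' j, ENNReal.ofReal (1 / (α + eigenvalue a b j)) := by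
    simp_rw [← fun j => lintegral_exp_neg_mul_Ioi (hpos j), heatTrace, ← ENNReal.tsum_mul_left]
    rw [lintegral_tsum fun _ => by fun_prop]
    refine tsum_congr fun j => lintegral_congr fun u => ?_
    rw [← ENNReal.ofReal_mul (Real.exp_pos _).le, ← Real.exp_add]
    congr 2; ring
  rw [h1, ← ENNReal.ofReal_tsum_of_nonneg (fun j => (one_div_pos.2 (hpos j)).le)]
  · exact ENNReal.ofReal_lt_top
  · rw [← summable_nat_add_iff 1]
    refine Summable.of_nonneg_of_le (fun j => (one_div_pos.2 (hpos _)).le) (fun j => ?_)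
      (((summable_nat_add_iff 1).2 (Real.summable_one_div_nat_pow.2 one_lt_two)).mul_left a⁻¹)
    rw [← one_div, div_mul_div_comm, one_mul]
    refine one_div_le_one_div_of_le (by positivity) ?_
    linarith [eigenvalue_ge ha b (j + 1)]

lemma setLIntegral_heatTrace_lt_top {a : ℝ} (ha : 0 < a) (b T : ℝ) :
    ∫⁻ u in Ioc 0 T, heatTrace a b u < ∞ := by
  have h := lintegral_exp_mul_heatTrace_lt_top ha b one_pos
  refine lt_of_le_of_lt ?_ (ENNReal.mul_lt_top (a := ENNReal.ofReal (Real.exp T))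
    ENNReal.ofReal_lt_top h)
  rw [← lintegral_const_mul' _ _ ENNReal.ofReal_ne_top]
  refine le_trans (setLIntegral_mono' measurableSet_Ioc fun u hu => ?_)
    (lintegral_mono_set Ioc_subset_Ioi_self)
  rw [← mul_assoc, ← ENNReal.ofReal_mul (Real.exp_pos _).le, ← Real.exp_add]
  refine le_mul_of_one_le_left zero_le ?_
  rw [ENNReal.one_le_ofReal, Real.one_le_exp_iff]
  linarith [hu.2]

/-- A bound for the eigenfunctions on `[0,1]`. -/
def amplitude (a b : ℝ) : ℝ := |eigenfunction a b 0 0| + Real.sqrt 2 * Real.exp |drift a b|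

lemma amplitude_pos (a b : ℝ) : 0 < amplitude a b := by
  unfold amplitude; positivity

lemma abs_eigenfunction_le (a b : ℝ) (j : ℕ) {x : ℝ} (hx : x ∈ Icc (0 : ℝ) 1) :
    |eigenfunction a b j x| ≤ amplitude a b := by
  rcases eq_or_ne j 0 with rfl | hj
  · have : eigenfunction a b 0 x = eigenfunction a b 0 0 := by simp [eigenfunction]
    rw [this, amplitude]
    have : 0 ≤ Real.sqrt 2 * Real.exp |drift a b| := by positivity
    linarith
  · have h1 : drift a b * x ≤ |drift a b| := by
      have h2 := abs_nonneg (drift a b)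
      calc drift a b * x ≤ |drift a b| * x := by gcongr; exacts [hx.1, le_abs_self _]
        _ ≤ |drift a b| := mul_le_of_le_one_right h2 hx.2
    simp only [eigenfunction, hj, if_false, amplitude]
    rw [abs_mul, abs_of_nonneg (by positivity : 0 ≤ √2 * Real.exp (drift a b * x))]
    calc _ ≤ √2 * Real.exp (drift a b * x) * 1 := by gcongr; exact Real.abs_sin_le_one _
      _ ≤ √2 * Real.exp |drift a b| := by rw [mul_one]; gcongr
      _ ≤ _ := le_add_of_nonneg_left (abs_nonneg _)

lemma continuous_eigenfunction (a b : ℝ) (j : ℕ) : Continuous (eigenfunction a b j) := by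
  unfold eigenfunction
  split_ifs <;> fun_prop

lemma norm_green_term_le (a b : ℝ) (j : ℕ) (u : ℝ) {y x : ℝ} (hy : y ∈ Icc (0 : ℝ) 1)
    (hx : x ∈ Icc (0 : ℝ) 1) :
    ‖Real.exp (-(eigenvalue a b j * u)) * eigenfunction a b j y * eigenfunction a b j x‖ ≤
      amplitude a b ^ 2 * Real.exp (-(eigenvalue a b j * u)) := by
  rw [norm_mul, norm_mul, Real.norm_eq_abs, Real.norm_eq_abs, Real.norm_eq_abs, Real.abs_exp]
  have h1 := abs_eigenfunction_le a b j hy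
  have h2 := abs_eigenfunction_le a b j hx
  have := amplitude_pos a b
  calc _ ≤ Real.exp (-(eigenvalue a b j * u)) * amplitude a b * amplitude a b := by gcongr
    _ = _ := by ring

/-- Working in the extended reals makes the bound valid for all u: for u ≤ 0 the right side is
infinite. -/
lemma enorm_green_le {a : ℝ} (ha : 0 < a) (b u : ℝ) {y x : ℝ} (hy : y ∈ Icc (0 : ℝ) 1)
    (hx : x ∈ Icc (0 : ℝ) 1) :
    ‖green a b u y x‖ₑ ≤ ENNReal.ofReal (amplitude a b ^ 2) * heatTrace a b u := by
  have hA := amplitude_pos a b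
  rcases le_or_gt u 0 with hu | hu
  · rw [heatTrace_of_nonpos ha b hu, ENNReal.mul_top (by simpa using hA.ne')]
    exact le_top
  · rw [heatTrace_eq_ofReal ha b hu, ← ENNReal.ofReal_mul (by positivity), ← ofReal_norm,
      ← tsum_mul_left]
    exact ENNReal.ofReal_le_ofReal (tsum_of_norm_bounded
      ((summable_exp_eigenvalue ha b hu).mul_left _).hasSum
      fun j => norm_green_term_le a b j u hy hx)

lemma measurable_green (a b : ℝ) :
    Measurable fun p : ℝ × ℝ × ℝ => green a b p.1 p.2.1 p.2.2 := by
  refine Measurable.tsum fun j => ?_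
  have := (continuous_eigenfunction a b j).measurable
  fun_prop

/-! ### Reading the Green's function by a sensor -/

/-- The bound of a sensor as a functional on bounded functions. -/
def Sensor.bound : Sensor → ℝ
  | .weight φ => ‖φ‖
  | .dirac _ => 1

lemma Sensor.bound_nonneg (φ₀ : Sensor) : 0 ≤ φ₀.bound := by
  cases φ₀ <;> simp [Sensor.bound]

lemma Sensor.enorm_read_le (φ₀ : Sensor) (v : I → ℝ) (B : ℝ≥0∞) (hB : ∀ x, ‖v x‖ₑ ≤ B) :
    ‖φ₀.read v‖ₑ ≤ ENNReal.ofReal φ₀.bound * B := by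
  cases φ₀ with
  | dirac z => simpa [Sensor.read, Sensor.bound] using hB z
  | weight φ =>
    simp only [Sensor.read, Sensor.bound, pairing]
    refine (enorm_integral_le_lintegral_enorm _).trans ?_
    calc _ ≤ ∫⁻ _ : I, ENNReal.ofReal ‖φ‖ * B := by
          refine lintegral_mono fun x => ?_
          rw [enorm_mul, ← ofReal_norm (φ x)]
          gcongr
          exacts [φ.norm_coe_le_norm x, hB x]
      _ = _ := by simp

/-- The response `⟨P_u(β, ·), φ₀⟩` of a sensor to a release at `β` after the time `u`, set to zero
for `u ≤ 0`. -/
def Sensor.response (φ₀ : Sensor) (a b u β : ℝ) : ℝ :=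
  if 0 < u then φ₀.read fun x => green a b u β x else 0

lemma Sensor.measurable_response (φ₀ : Sensor) (a b : ℝ) :
    Measurable fun p : ℝ × ℝ => φ₀.response a b p.1 p.2 := by
  refine Measurable.ite (measurableSet_lt measurable_const measurable_fst) ?_ measurable_const
  cases φ₀ with
  | dirac z =>
    exact (measurable_green a b).comp
      (measurable_fst.prodMk (measurable_snd.prodMk measurable_const))
  | weight φ =>
    simp only [Sensor.read, pairing]
    refine StronglyMeasurable.measurable ?_
    refine StronglyMeasurable.integral_prod_right' (f := fun q : (ℝ × ℝ) × I =>
      φ q.2 * green a b q.1.1 q.1.2 q.2) (Measurable.stronglyMeasurable ?_)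
    exact (φ.continuous.measurable.comp measurable_snd).mul ((measurable_green a b).comp
      (by fun_prop : Measurable fun q : (ℝ × ℝ) × I => (q.1.1, q.1.2, (q.2 : ℝ))))

lemma Sensor.enorm_response_le (φ₀ : Sensor) {a : ℝ} (ha : 0 < a) (b u : ℝ) {β : ℝ}
    (hβ : β ∈ Icc (0 : ℝ) 1) :
    ‖φ₀.response a b u β‖ₑ ≤
      ENNReal.ofReal (φ₀.bound * amplitude a b ^ 2) * heatTrace a b u := by
  rw [Sensor.response]
  split_ifs with h
  · rw [ENNReal.ofReal_mul φ₀.bound_nonneg, mul_assoc]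
    exact φ₀.enorm_read_le _ _ fun x => enorm_green_le ha b u hβ x.2
  · simp

/-- Superposition: the reading of a continuous superposition of releases. -/
lemma Sensor.read_add_integral (φ₀ : Sensor) {a : ℝ} (ha : 0 < a) (b α : ℝ) {β : ℝ}
    (hβ : β ∈ Icc (0 : ℝ) 1) {A : I → ℝ} (hA : Measurable A) {B : ℝ} (hB : ∀ x, ‖A x‖ ≤ B)
    {ν : Measure ℝ} [SFinite ν] {u : ℝ → ℝ} (hu : Measurable u)
    (hfin : ∫⁻ s, ENNReal.ofReal (Real.exp (-(α * u s))) * heatTrace a b (u s) ∂ν ≠ ∞) :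
    φ₀.read (fun x => A x + ∫ s, Real.exp (-(α * u s)) * green a b (u s) β x ∂ν) =
      φ₀.read A + ∫ s, Real.exp (-(α * u s)) * φ₀.response a b (u s) β ∂ν := by
  -- The majorant is infinite where u ≤ 0, so its integrability excludes these points. The
  -- convention that the response is zero there is then harmless.
  have hpos : ∀ᵐ s ∂ν, 0 < u s := by
    have hm : Measurable fun s => ENNReal.ofReal (Real.exp (-(α * u s))) * heatTrace a b (u s) :=
      (by fun_prop : Measurable fun s => ENNReal.ofReal (Real.exp (-(α * u s)))).mul
        ((measurable_heatTrace a b).comp hu)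
    filter_upwards [ae_lt_top hm hfin] with s hs
    by_contra h
    rw [heatTrace_of_nonpos ha b (not_lt.1 h), ENNReal.mul_top] at hs
    · exact lt_irrefl _ hs
    · simpa using Real.exp_pos _
  have hresp : ∫ s, Real.exp (-(α * u s)) * φ₀.response a b (u s) β ∂ν =
      ∫ s, Real.exp (-(α * u s)) * φ₀.read (fun x => green a b (u s) β x) ∂ν := by
    refine integral_congr_ae ?_
    filter_upwards [hpos] with s hs
    rw [Sensor.response, if_pos hs]
  rw [hresp]
  cases φ₀ with
  -- Evaluation at a point commutes with the integral by definition; only a weight needs Fubini's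
  -- theorem.
  | dirac z => rfl
  | weight φ =>
    simp only [Sensor.read, pairing]
    have hgm : Measurable fun q : I × ℝ => Real.exp (-(α * u q.2)) * green a b (u q.2) β q.1 := by
      refine Measurable.mul (by fun_prop) ?_
      exact (measurable_green a b).comp
        (by fun_prop : Measurable fun q : I × ℝ => (u q.2, β, (q.1 : ℝ)))
    have hmeas : Measurable fun q : I × ℝ =>
        φ q.1 * (Real.exp (-(α * u q.2)) * green a b (u q.2) β q.1) :=
      (φ.continuous.measurable.comp measurable_fst).mul hgm
    have hbd (x : I) (s : ℝ) : ‖φ x * (Real.exp (-(α * u s)) * green a b (u s) β x)‖ₑ ≤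
        ENNReal.ofReal (‖φ‖ * amplitude a b ^ 2) *
          (ENNReal.ofReal (Real.exp (-(α * u s))) * heatTrace a b (u s)) := by
      rw [enorm_mul, enorm_mul, ← ofReal_norm (φ x), ← ofReal_norm (Real.exp _), Real.norm_eq_abs,
        Real.norm_eq_abs, Real.abs_exp, ENNReal.ofReal_mul (norm_nonneg _)]
      calc _ ≤ ENNReal.ofReal ‖φ‖ * (ENNReal.ofReal (Real.exp (-(α * u s))) *
            (ENNReal.ofReal (amplitude a b ^ 2) * heatTrace a b (u s))) := by
            gcongr
            exacts [φ.norm_coe_le_norm x, enorm_green_le ha b _ hβ x.2]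
        _ = _ := by ring
    have hint : Integrable (fun q : I × ℝ =>
        φ q.1 * (Real.exp (-(α * u q.2)) * green a b (u q.2) β q.1))
        ((volume : Measure I).prod ν) := by
      refine ⟨hmeas.aestronglyMeasurable, ?_⟩
      rw [hasFiniteIntegral_iff_enorm, lintegral_prod _ hmeas.enorm.aemeasurable]
      refine lt_of_le_of_lt (lintegral_mono fun x => lintegral_mono fun s => hbd x s) ?_
      rw [lintegral_const, measure_univ, mul_one, lintegral_const_mul' _ _ ENNReal.ofReal_ne_top]
      exact ENNReal.mul_lt_top ENNReal.ofReal_lt_top hfin.lt_top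
    have hA' : Integrable (fun x : I => φ x * A x) := by
      refine (integrable_const (‖φ‖ * B)).mono'
        (φ.continuous.measurable.mul hA).aestronglyMeasurable (ae_of_all _ fun x => ?_)
      rw [norm_mul]
      exact mul_le_mul (φ.norm_coe_le_norm x) (hB x) (norm_nonneg _) (norm_nonneg _)
    simp_rw [mul_add, ← integral_const_mul]
    rw [integral_add hA' hint.integral_prod_left]
    congr 1
    rw [integral_integral_swap hint]
    refine integral_congr_ae (ae_of_all _ fun s => integral_congr_ae (ae_of_all _ fun x => ?_))
    simp only
    ring

/-! ### Bessel's inequality for the eigenfunctions -/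

/-- Up to constants and a phase, these pairings are Fourier integrals of φ(x)e^{cx}, extended by
zero, on an interval of length 2. Parseval's identity for Fourier coefficients there suffices;
orthogonality of the eigenfunctions is not needed. -/
lemma summable_sq_pairing_eigenfunction (a b : ℝ) (φ : I →ᵇ ℝ) :
    Summable fun j => pairing (fun x => eigenfunction a b j x) φ ^ 2 := by
  let g : ℝ → ℝ := (Icc (0 : ℝ) 1).indicator fun x =>
    φ (projIcc 0 1 zero_le_one x) * Real.exp (drift a b * x)
  have hgm : Measurable g := by
    refine Measurable.indicator ?_ measurableSet_Icc
    exact (Continuous.measurable (by fun_prop))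
  have hgB (x : ℝ) : ‖g x‖ ≤ ‖φ‖ * Real.exp |drift a b| := by
    by_cases hx : x ∈ Icc (0 : ℝ) 1
    · simp only [g, indicator_of_mem hx]
      rw [norm_mul, Real.norm_eq_abs (Real.exp _), Real.abs_exp]
      have h1 : drift a b * x ≤ |drift a b| := by
        calc drift a b * x ≤ |drift a b| * x := by gcongr; exacts [hx.1, le_abs_self _]
          _ ≤ |drift a b| := mul_le_of_le_one_right (abs_nonneg _) hx.2
      gcongr
      exact φ.norm_coe_le_norm _
    · simp only [g, indicator_of_notMem hx, norm_zero]
      positivity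
  have hgI : Integrable (fun x => (g x : ℂ)) (volume.restrict (Ioc 0 2)) :=
    ((integrable_const (‖φ‖ * Real.exp |drift a b|)).mono' hgm.aestronglyMeasurable
      (ae_of_all _ hgB)).ofReal
  have hL2 : MemLp (fun x => (g x : ℂ)) 2 (volume.restrict (Ioc 0 2)) :=
    MemLp.of_bound (Complex.measurable_ofReal.comp hgm).aestronglyMeasurable _
      (ae_of_all _ fun x => by simpa using hgB x)
  have hsum := (hasSum_sq_fourierCoeffOn two_pos hL2).summable
  have hsum' : Summable fun j : ℕ =>
      ‖fourierCoeffOn two_pos (fun x => (g x : ℂ)) (-(j + 1 : ℕ))‖ ^ 2 :=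
    hsum.comp_injective (i := fun j : ℕ => (-(j + 1 : ℕ) : ℤ)) fun i j h => by
      simpa using h
  rw [← summable_nat_add_iff 1]
  -- The constant is 8 = 2 · 2²: a 2 from the factor √2 of the eigenfunction, and 2² from the
  -- normalization 1/2 of Fourier coefficients on an interval of length 2.
  refine Summable.of_nonneg_of_le (fun _ => sq_nonneg _) (fun j => ?_) (hsum'.mul_left 8)
  set n : ℕ := j + 1
  have hn : n ≠ 0 := Nat.succ_ne_zero j
  have h1 : pairing (fun x => eigenfunction a b n x) φ =
      √2 * ∫ x in Ioc (0 : ℝ) 2, g x * Real.sin (n * Real.pi * x + phase a b n) := by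
    have h2 : pairing (fun x => eigenfunction a b n x) φ =
        ∫ x : I, (fun y : ℝ => √2 * (g y * Real.sin (n * Real.pi * y + phase a b n))) x := by
      refine integral_congr_ae (ae_of_all _ fun x => ?_)
      simp only [eigenfunction, hn, if_false, g, indicator_of_mem x.2, projIcc_val]
      ring
    rw [h2, unitInterval.volume_def, integral_subtype_comap measurableSet_Icc
      (fun y : ℝ => √2 * (g y * Real.sin (n * Real.pi * y + phase a b n))), integral_const_mul,
      integral_Icc_eq_integral_Ioc]
    congr 1
    refine (setIntegral_eq_of_subset_of_forall_sdiff_eq_zero measurableSet_Ioc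
      (Ioc_subset_Ioc_right one_le_two) fun x hx => ?_).symm
    have : x ∉ Icc (0 : ℝ) 1 := fun h => hx.2 ⟨hx.1.1, h.2⟩
    simp [g, indicator_of_notMem this]
  have h3 : |∫ x in Ioc (0 : ℝ) 2, g x * Real.sin (n * Real.pi * x + phase a b n)| ≤
      2 * ‖fourierCoeffOn two_pos (fun x => (g x : ℂ)) (-(n : ℕ))‖ := by
    -- The index is negative because the coefficient of index m integrates against the conjugate
    -- character e^{-iπmx}.
    have h4 : fourierCoeffOn two_pos (fun x => (g x : ℂ)) (-(n : ℕ)) = (1 / 2 : ℝ) •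
        ∫ x in Ioc (0 : ℝ) 2, Complex.exp ((n * Real.pi * x : ℝ) * Complex.I) * g x := by
      rw [fourierCoeffOn_eq_integral, sub_zero, intervalIntegral.integral_of_le two_pos.le]
      congr 1
      refine integral_congr_ae (ae_of_all _ fun x => ?_)
      simp only [neg_neg, fourier_coe_apply, smul_eq_mul]
      congr 2
      push_cast
      ring
    have hI2 : Integrable (fun x => Complex.exp ((n * Real.pi * x + phase a b n : ℝ) * Complex.I) *
        g x) (volume.restrict (Ioc 0 2)) := by
      refine hgI.mono (.mul (Continuous.aestronglyMeasurable (by fun_prop)) hgI.1)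
        (ae_of_all _ fun x => ?_)
      rw [norm_mul, Complex.norm_exp_ofReal_mul_I, one_mul]
    -- The phase enters as a factor of modulus one before the imaginary part is taken, so it drops
    -- out of the estimate and its dependence on n is irrelevant.
    have h5 : ∫ x in Ioc (0 : ℝ) 2, g x * Real.sin (n * Real.pi * x + phase a b n) =
        (Complex.exp (phase a b n * Complex.I) * ∫ x in Ioc (0 : ℝ) 2,
          Complex.exp ((n * Real.pi * x : ℝ) * Complex.I) * g x).im := by
      have h6 : (Complex.exp (phase a b n * Complex.I) * ∫ x in Ioc (0 : ℝ) 2,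
          Complex.exp ((n * Real.pi * x : ℝ) * Complex.I) * g x) =
          ∫ x in Ioc (0 : ℝ) 2, Complex.exp ((n * Real.pi * x + phase a b n : ℝ) * Complex.I) *
            g x := by
        rw [← integral_const_mul]
        refine integral_congr_ae (ae_of_all _ fun x => ?_)
        simp only [← mul_assoc, ← Complex.exp_add]
        congr 2
        push_cast
        ring
      rw [h6]
      have := integral_im hI2
      refine Eq.trans ?_ this
      refine integral_congr_ae (ae_of_all _ fun x => ?_)
      simp only [RCLike.im_to_complex]
      rw [Complex.im_mul_ofReal, Complex.exp_ofReal_mul_I_im, mul_comm]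
    rw [h5, h4]
    refine (Complex.abs_im_le_norm _).trans ?_
    rw [norm_mul, Complex.norm_exp_ofReal_mul_I, norm_smul, Real.norm_of_nonneg (by norm_num)]
    linarith
  calc pairing (fun x => eigenfunction a b n x) φ ^ 2 ≤
      2 * (2 * ‖fourierCoeffOn two_pos (fun x => (g x : ℂ)) (-(n : ℕ))‖) ^ 2 := by
        rw [h1, mul_pow, Real.sq_sqrt two_pos.le, ← sq_abs (∫ x in Ioc (0 : ℝ) 2, _)]
        gcongr
    _ = _ := by ring

/-! ### Square bound and continuity of the response of a weight -/

lemma abs_pairing_eigenfunction_le (a b : ℝ) (φ : I →ᵇ ℝ) (j : ℕ) :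
    |pairing (fun x => eigenfunction a b j x) φ| ≤ ‖φ‖ * amplitude a b := by
  have h := norm_integral_le_of_norm_le_const (μ := (volume : Measure I))
    (f := fun x => φ x * eigenfunction a b j x) (C := ‖φ‖ * amplitude a b)
    (ae_of_all _ fun x => by
      rw [norm_mul]
      exact mul_le_mul (φ.norm_coe_le_norm x) (abs_eigenfunction_le a b j x.2) (norm_nonneg _)
        (norm_nonneg _))
  simpa [pairing] using h

lemma hasSum_response_weight {a : ℝ} (ha : 0 < a) (b : ℝ) (φ : I →ᵇ ℝ) {u β : ℝ} (hu : 0 < u)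
    (hβ : β ∈ Icc (0 : ℝ) 1) :
    HasSum (fun j => Real.exp (-(eigenvalue a b j * u)) * eigenfunction a b j β *
      pairing (fun x => eigenfunction a b j x) φ) ((Sensor.weight φ).response a b u β) := by
  have hA := amplitude_pos a b
  have hbd (j : ℕ) (x : I) : ‖φ x * (Real.exp (-(eigenvalue a b j * u)) * eigenfunction a b j β *
      eigenfunction a b j x)‖ ≤ ‖φ‖ * (amplitude a b ^ 2 * Real.exp (-(eigenvalue a b j * u))) := by
    rw [norm_mul]
    exact mul_le_mul (φ.norm_coe_le_norm x) (norm_green_term_le a b j u hβ x.2) (norm_nonneg _)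
      (norm_nonneg _)
  have hint (j : ℕ) : Integrable fun x : I => φ x * (Real.exp (-(eigenvalue a b j * u)) *
      eigenfunction a b j β * eigenfunction a b j x) := by
    refine (integrable_const (‖φ‖ * (amplitude a b ^ 2 *
      Real.exp (-(eigenvalue a b j * u))))).mono' ?_ (ae_of_all _ (hbd j))
    have := continuous_eigenfunction a b j
    exact (Continuous.measurable (by fun_prop)).aestronglyMeasurable
  have h := hasSum_integral_of_summable_integral_norm hint (by
    refine Summable.of_nonneg_of_le (fun j => integral_nonneg fun x => norm_nonneg _) (fun j => ?_)
      (((summable_exp_eigenvalue ha b hu).mul_left (amplitude a b ^ 2)).mul_left ‖φ‖)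
    refine (integral_mono (hint j).norm (integrable_const _) (hbd j)).trans ?_
    simp)
  have e1 (j : ℕ) : Real.exp (-(eigenvalue a b j * u)) * eigenfunction a b j β *
      pairing (fun x => eigenfunction a b j x) φ = ∫ x : I, φ x *
        (Real.exp (-(eigenvalue a b j * u)) * eigenfunction a b j β * eigenfunction a b j x) := by
    rw [pairing, ← integral_const_mul]
    exact integral_congr_ae (ae_of_all _ fun x => by ring)
  have e2 : (Sensor.weight φ).response a b u β = ∫ x : I, ∑' j, φ x *
      (Real.exp (-(eigenvalue a b j * u)) * eigenfunction a b j β * eigenfunction a b j x) := by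
    simp only [Sensor.response, if_pos hu, Sensor.read, pairing, green]
    exact integral_congr_ae (ae_of_all _ fun x => tsum_mul_left.symm)
  simp_rw [e1]
  rw [e2]
  exact h

/-- Cauchy–Schwarz in j, with Bessel's inequality for the pairings and e^{-2σu} ≤ e^{-σu}. Squaring
the bound by the trace would give a singularity of order 1/u, which is not integrable; here the
square is bounded by the trace itself. -/
lemma sq_response_weight_le {a : ℝ} (ha : 0 < a) (b : ℝ) (φ : I →ᵇ ℝ) (u : ℝ) {β : ℝ}
    (hβ : β ∈ Icc (0 : ℝ) 1) :
    ‖(Sensor.weight φ).response a b u β‖ₑ ^ 2 ≤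
      ENNReal.ofReal (amplitude a b ^ 2 *
        ∑' j, pairing (fun x => eigenfunction a b j x) φ ^ 2) * heatTrace a b u := by
  rcases le_or_gt u 0 with hu | hu
  · simp [Sensor.response, not_lt.2 hu]
  set c : ℕ → ℝ := fun j => pairing (fun x => eigenfunction a b j x) φ
  have hc : Summable fun j => c j ^ 2 := summable_sq_pairing_eigenfunction a b φ
  have hs := hasSum_response_weight ha b φ hu hβ
  have he := summable_exp_eigenvalue ha b hu
  rw [heatTrace_eq_ofReal ha b hu, ← ENNReal.ofReal_mul (by
    exact mul_nonneg (sq_nonneg _) (tsum_nonneg fun j => sq_nonneg _)), ← ofReal_norm,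
    ← ENNReal.ofReal_pow (norm_nonneg _)]
  refine ENNReal.ofReal_le_ofReal ?_
  rw [Real.norm_eq_abs, sq_abs]
  refine le_of_tendsto (hs.tendsto_sum_nat.pow 2) (Eventually.of_forall fun n => ?_)
  refine (Finset.sum_mul_sq_le_sq_mul_sq _ _ _).trans ?_
  have h1 : ∑ j ∈ Finset.range n, (Real.exp (-(eigenvalue a b j * u)) * eigenfunction a b j β) ^ 2 ≤
      amplitude a b ^ 2 * ∑' j, Real.exp (-(eigenvalue a b j * u)) := by
    calc _ ≤ ∑ j ∈ Finset.range n, amplitude a b ^ 2 * Real.exp (-(eigenvalue a b j * u)) := by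
          refine Finset.sum_le_sum fun j _ => ?_
          have h2 : Real.exp (-(eigenvalue a b j * u)) ≤ 1 := by
            rw [Real.exp_le_one_iff]
            nlinarith [eigenvalue_nonneg ha b j]
          have h3 := Real.exp_pos (-(eigenvalue a b j * u))
          have h4 : eigenfunction a b j β ^ 2 ≤ amplitude a b ^ 2 :=
            sq_le_sq' (abs_le.1 (abs_eigenfunction_le a b j hβ)).1
              (abs_le.1 (abs_eigenfunction_le a b j hβ)).2
          rw [mul_pow, mul_comm]
          refine mul_le_mul h4 ?_ (sq_nonneg _) (sq_nonneg _)
          nlinarith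
      _ = amplitude a b ^ 2 * ∑ j ∈ Finset.range n, Real.exp (-(eigenvalue a b j * u)) := by
          rw [Finset.mul_sum]
      _ ≤ _ := by
          gcongr
          exact he.sum_le_tsum _ fun j _ => (Real.exp_pos _).le
  have h2 : ∑ j ∈ Finset.range n, c j ^ 2 ≤ ∑' j, c j ^ 2 :=
    hc.sum_le_tsum _ fun j _ => sq_nonneg _
  calc _ ≤ (amplitude a b ^ 2 * ∑' j, Real.exp (-(eigenvalue a b j * u))) * ∑' j, c j ^ 2 := by
        refine mul_le_mul h1 h2 (Finset.sum_nonneg fun j _ => sq_nonneg _) ?_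
        exact mul_nonneg (sq_nonneg _) (tsum_nonneg fun j => (Real.exp_pos _).le)
    _ = _ := by ring

/-- On the region where time exceeds u/2 the series is dominated by its exponential weights at u/2
and converges uniformly. -/
lemma continuousAt_response_weight {a : ℝ} (ha : 0 < a) (b : ℝ) (φ : I →ᵇ ℝ) {u β : ℝ}
    (hu : 0 < u) (hβ : β ∈ Ioo (0 : ℝ) 1) :
    ContinuousAt (fun p : ℝ × ℝ => (Sensor.weight φ).response a b p.1 p.2) (u, β) := by
  have hA := amplitude_pos a b
  have hopen : Ioi (u / 2) ×ˢ Ioo (0 : ℝ) 1 ∈ 𝓝 (u, β) :=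
    prod_mem_nhds (Ioi_mem_nhds (by linarith)) (Ioo_mem_nhds hβ.1 hβ.2)
  refine ContinuousOn.continuousAt (s := Ioi (u / 2) ×ˢ Ioo (0 : ℝ) 1) ?_ hopen
  have heq : EqOn (fun p : ℝ × ℝ => ∑' j, Real.exp (-(eigenvalue a b j * p.1)) *
      eigenfunction a b j p.2 * pairing (fun x => eigenfunction a b j x) φ)
      (fun p : ℝ × ℝ => (Sensor.weight φ).response a b p.1 p.2) (Ioi (u / 2) ×ˢ Ioo (0 : ℝ) 1) :=
    fun p hp => (hasSum_response_weight ha b φ (lt_trans (by linarith) hp.1)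
      (Ioo_subset_Icc_self hp.2)).tsum_eq
  refine ContinuousOn.congr ?_ heq.symm
  refine continuousOn_tsum (fun j => ?_) (((summable_exp_eigenvalue ha b (half_pos hu)).mul_right
    (amplitude a b)).mul_right (‖φ‖ * amplitude a b)) fun j p hp => ?_
  · have := continuous_eigenfunction a b j
    exact Continuous.continuousOn (by fun_prop)
  · rw [norm_mul, norm_mul, Real.norm_eq_abs, Real.norm_eq_abs, Real.norm_eq_abs, Real.abs_exp]
    have h1 := abs_eigenfunction_le a b j (Ioo_subset_Icc_self hp.2)
    have h2 := abs_pairing_eigenfunction_le a b φ j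
    have h3 : u / 2 ≤ p.1 := (hp.1 : u / 2 < p.1).le
    have h4 := eigenvalue_nonneg ha b j
    gcongr

/-! ### Changes of variables -/

lemma lintegral_comp_div {l : ℝ} (hl : 0 < l) (H : ℝ → ℝ≥0∞) :
    ∫⁻ r, H (r / l) = ENNReal.ofReal l * ∫⁻ s, H s := by
  have h := (Homeomorph.mulRight₀ l⁻¹ (inv_ne_zero hl.ne')).measurableEmbedding.lintegral_map
    (μ := volume) H
  have h2 : Measure.map (Homeomorph.mulRight₀ l⁻¹ (inv_ne_zero hl.ne')) volume =
      ENNReal.ofReal l • (volume : Measure ℝ) := by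
    have := Real.map_volume_mul_right (inv_ne_zero hl.ne')
    rw [inv_inv, abs_of_pos hl] at this
    exact this
  rw [h2, lintegral_smul_measure, smul_eq_mul] at h
  simpa [div_eq_mul_inv] using h.symm

lemma setLIntegral_Ioi_comp_div {l : ℝ} (hl : 0 < l) (H : ℝ → ℝ≥0∞) :
    ∫⁻ r in Ioi 0, H (r / l) = ENNReal.ofReal l * ∫⁻ s in Ioi 0, H s := by
  rw [← lintegral_indicator measurableSet_Ioi, ← lintegral_indicator measurableSet_Ioi,
    ← lintegral_comp_div hl]
  refine lintegral_congr fun r => ?_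
  simp only [indicator, mem_Ioi, div_pos_iff_of_pos_right hl]

lemma setLIntegral_Ioi_comp_sub_div {l : ℝ} (hl : 0 < l) (t : ℝ) (H : ℝ → ℝ≥0∞) :
    ∫⁻ r in Ioi 0, H (t - r / l) = ENNReal.ofReal l * ∫⁻ s in Iio t, H s := by
  rw [setLIntegral_Ioi_comp_div hl fun s => H (t - s), ← lintegral_indicator measurableSet_Ioi,
    ← lintegral_indicator measurableSet_Iio, ← lintegral_sub_left_eq_self _ t]
  congr 1
  refine lintegral_congr fun s => ?_
  simp [indicator]

/-! ### Continuity in mean square of dilated kernels -/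

lemma enorm_sq_eq_ofReal (x : ℝ) : ‖x‖ₑ ^ 2 = ENNReal.ofReal (x ^ 2) := by
  rw [← ofReal_norm, ← ENNReal.ofReal_pow (norm_nonneg _), Real.norm_eq_abs, sq_abs]

/-- `R(t - r/l, β)` depends on `(β, l)` continuously in `L²(dr)`. -/
lemma tendsto_lintegral_sq_dilation {R : ℝ × ℝ → ℝ} (hR : Measurable R)
    (hR0 : ∀ u β, u ≤ 0 → R (u, β) = 0)
    (hRc : ∀ u β, 0 < u → β ∈ Ioo (0 : ℝ) 1 → ContinuousAt R (u, β))
    {S : ℝ → ℝ≥0∞} (hS : Measurable S) {t : ℝ} (hSi : ∫⁻ u in Ioc 0 t, S u ≠ ∞)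
    (hRS : ∀ u β, u ≤ t → β ∈ Ioo (0 : ℝ) 1 → ‖R (u, β)‖ₑ ^ 2 ≤ S u)
    {M : ℝ} (T : ℝ) {θ : ℕ → ℝ × ℝ} {θ₀ : ℝ × ℝ} (hθ : ∀ n, θ n ∈ paramSet M)
    (hθ₀ : θ₀ ∈ paramSet M) (hlim : Tendsto θ atTop (𝓝 θ₀)) :
    Tendsto (fun n => ∫⁻ r in Ioc 0 T, ‖R (t - r / (θ n).2, (θ n).1) - R (t - r / θ₀.2, θ₀.1)‖ₑ ^ 2)
      atTop (𝓝 0) := by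
  -- Clip the kernel at level B. Clipped kernels converge by dominated convergence, while the
  -- clipping error is controlled uniformly in the parameters by `G`, the part of S exceeding B².
  let c (B x : ℝ) : ℝ := max (-B) (min x B)
  have hc (B : ℝ) : Continuous (c B) := by fun_prop
  let G (B u : ℝ) : ℝ≥0∞ := (Ioc 0 t).indicator
    (fun u => if ENNReal.ofReal (B ^ 2) < S u then S u else 0) u
  have hGm (B : ℝ) : Measurable (G B) :=
    (Measurable.ite (measurableSet_lt measurable_const hS) hS measurable_const).indicator
      measurableSet_Ioc
  have hdG {B u β : ℝ} (hB : 0 ≤ B) (hu : u ≤ t) (hβ : β ∈ Ioo (0 : ℝ) 1) :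
      ‖R (u, β) - c B (R (u, β))‖ₑ ^ 2 ≤ G B u := by
    rcases le_or_gt u 0 with h0 | h0
    · simp [hR0 u β h0, c, hB]
    · simp only [G, indicator_of_mem (show u ∈ Ioc 0 t from ⟨h0, hu⟩)]
      by_cases hab : |R (u, β)| ≤ B
      · rw [abs_le] at hab
        simp [c, hab.1, hab.2]
      · rw [not_le] at hab
        have h1 := hRS u β hu hβ
        have h2 : ENNReal.ofReal (B ^ 2) < S u := by
          refine lt_of_lt_of_le ?_ h1
          rw [enorm_sq_eq_ofReal, ENNReal.ofReal_lt_ofReal_iff_of_nonneg (sq_nonneg _),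
            ← sq_abs (R _)]
          exact pow_lt_pow_left₀ hab hB two_ne_zero
        rw [if_pos h2]
        refine le_trans ?_ h1
        rw [enorm_sq_eq_ofReal, enorm_sq_eq_ofReal]
        refine ENNReal.ofReal_le_ofReal (sq_le_sq.2 ?_)
        simp only [c]
        rcases le_total 0 (R (u, β)) with hp | hp
        · rw [abs_of_nonneg hp] at hab ⊢
          rw [min_eq_right hab.le, max_eq_right (by linarith), abs_of_nonneg (by linarith)]
          linarith
        · rw [abs_of_nonpos hp] at hab ⊢
          rw [min_eq_left (by linarith), max_eq_left (by linarith), abs_of_nonpos (by linarith)]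
          linarith
  have hη : Tendsto (fun k : ℕ => ∫⁻ u in Ioc 0 t, G k u) atTop (𝓝 0) := by
    have h := tendsto_lintegral_of_dominated_convergence (μ := volume.restrict (Ioc 0 t)) S
      (fun k : ℕ => hGm k) (fun k => ae_of_all _ fun u => ?_) hSi (f := fun _ => 0) ?_
    · simpa using h
    · simp only [G, indicator]
      split_ifs <;> simp
    · filter_upwards [ae_lt_top hS hSi] with u hu
      refine tendsto_const_nhds.congr' ?_
      obtain ⟨k, hk⟩ := exists_nat_gt (S u).toReal
      filter_upwards [eventually_ge_atTop k, eventually_ge_atTop 1] with n hn hn1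
      have : ¬ ENNReal.ofReal ((n : ℝ) ^ 2) < S u := by
        rw [not_lt, ← ENNReal.ofReal_toReal hu.ne]
        refine ENNReal.ofReal_le_ofReal (hk.le.trans ?_)
        have h1 : (k : ℝ) ≤ n := by exact_mod_cast hn
        have h2 : (1 : ℝ) ≤ n := by exact_mod_cast hn1
        nlinarith
      simp only [G, indicator, if_neg this, ite_self]
  -- Substituting u = t - r/λ costs the Jacobian λ ≤ M, which is where the bound on the intensities
  -- enters.
  have htail (B : ℝ) (hB : 0 ≤ B) {τ : ℝ × ℝ} (hτ : τ ∈ paramSet M) :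
      ∫⁻ r in Ioc 0 T, ‖R (t - r / τ.2, τ.1) - c B (R (t - r / τ.2, τ.1))‖ₑ ^ 2 ≤
        ENNReal.ofReal M * ∫⁻ u in Ioc 0 t, G B u := by
    have hl : 0 < τ.2 := hτ.2.1
    calc _ ≤ ∫⁻ r in Ioi 0, G B (t - r / τ.2) := by
          refine le_trans (setLIntegral_mono' measurableSet_Ioc fun r hr => hdG hB ?_ hτ.1)
            (lintegral_mono_set Ioc_subset_Ioi_self)
          have := div_nonneg hr.1.le hl.le
          linarith
      _ = ENNReal.ofReal τ.2 * ∫⁻ u in Iio t, G B u := setLIntegral_Ioi_comp_sub_div hl t _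
      _ ≤ _ := by
          refine mul_le_mul' (ENNReal.ofReal_le_ofReal hτ.2.2) ?_
          refine (setLIntegral_le_lintegral _ _).trans (le_of_eq ?_)
          rw [← lintegral_indicator measurableSet_Ioc]
          simp only [G, indicator_indicator, inter_self]
  have hmeas (τ : ℝ × ℝ) : Measurable fun r : ℝ => R (t - r / τ.2, τ.1) :=
    hR.comp (by fun_prop)
  have hbdd (B : ℝ) (hB : 0 ≤ B) : Tendsto (fun n => ∫⁻ r in Ioc 0 T,
      ‖c B (R (t - r / (θ n).2, (θ n).1)) - c B (R (t - r / θ₀.2, θ₀.1))‖ₑ ^ 2) atTop (𝓝 0) := by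
    have habs (x : ℝ) : -B ≤ c B x ∧ c B x ≤ B :=
      ⟨le_max_left _ _, max_le (by linarith) (min_le_right _ _)⟩
    have h := tendsto_lintegral_of_dominated_convergence (μ := volume.restrict (Ioc 0 T))
      (fun _ => ENNReal.ofReal ((2 * B) ^ 2)) (F := fun n r =>
        ‖c B (R (t - r / (θ n).2, (θ n).1)) - c B (R (t - r / θ₀.2, θ₀.1))‖ₑ ^ 2)
      (fun n => ?_) (fun n => ae_of_all _ fun r => ?_) ?_ (f := fun _ => 0) ?_
    · simpa using h
    · exact ((((hc B).measurable.comp (hmeas _)).sub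
        ((hc B).measurable.comp (hmeas _))).enorm).pow_const 2
    · beta_reduce
      rw [enorm_sq_eq_ofReal]
      refine ENNReal.ofReal_le_ofReal (sq_le_sq' ?_ ?_)
      · linarith [(habs (R (t - r / (θ n).2, (θ n).1))).1, (habs (R (t - r / θ₀.2, θ₀.1))).2]
      · linarith [(habs (R (t - r / (θ n).2, (θ n).1))).2, (habs (R (t - r / θ₀.2, θ₀.1))).1]
    · rw [lintegral_const]
      exact ENNReal.mul_ne_top ENNReal.ofReal_ne_top (by simp)
    -- At r = tλ₀ the kernel is read at time 0, where it need not be continuous. This is a single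
    -- point.
    · have hne : ∀ᵐ r ∂volume.restrict (Ioc 0 T), r ≠ t * θ₀.2 :=
        ae_restrict_of_ae (by simp [ae_iff])
      filter_upwards [hne] with r hr
      have hl₀ : 0 < θ₀.2 := hθ₀.2.1
      have hu : Tendsto (fun n => (t - r / (θ n).2, (θ n).1)) atTop
          (𝓝 (t - r / θ₀.2, θ₀.1)) :=
        (tendsto_const_nhds.sub (tendsto_const_nhds.div ((continuous_snd.tendsto _).comp hlim)
          hl₀.ne')).prodMk_nhds ((continuous_fst.tendsto _).comp hlim)
      have hRlim : Tendsto (fun n => R (t - r / (θ n).2, (θ n).1)) atTop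
          (𝓝 (R (t - r / θ₀.2, θ₀.1))) := by
        rcases lt_trichotomy (t - r / θ₀.2) 0 with h0 | h0 | h0
        · rw [hR0 _ _ h0.le]
          refine tendsto_const_nhds.congr' ?_
          filter_upwards [((continuous_fst.tendsto _).comp hu).eventually_lt_const h0] with n hn
          exact (hR0 _ _ hn.le).symm
        · exact absurd (by field_simp at h0; linarith) hr
        · exact (hRc _ _ h0 hθ₀.1).tendsto.comp hu
      have h1 : Tendsto (fun n => c B (R (t - r / (θ n).2, (θ n).1)) - c B (R (t - r / θ₀.2, θ₀.1)))
          atTop (𝓝 0) := by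
        simpa using (((hc B).tendsto _).comp hRlim).sub_const (c B (R (t - r / θ₀.2, θ₀.1)))
      have h2 : Tendsto (fun x : ℝ => ‖x‖ₑ ^ 2) (𝓝 0) (𝓝 0) := by
        have : Continuous fun x : ℝ => ‖x‖ₑ ^ 2 := by fun_prop
        simpa using this.tendsto 0
      exact h2.comp h1
  have hsplit (B : ℝ) (hB : 0 ≤ B) (n : ℕ) :
      ∫⁻ r in Ioc 0 T, ‖R (t - r / (θ n).2, (θ n).1) - R (t - r / θ₀.2, θ₀.1)‖ₑ ^ 2 ≤
      3 * (ENNReal.ofReal M * (∫⁻ u in Ioc 0 t, G B u) +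
        ENNReal.ofReal M * ∫⁻ u in Ioc 0 t, G B u) + 3 * ∫⁻ r in Ioc 0 T,
      ‖c B (R (t - r / (θ n).2, (θ n).1)) - c B (R (t - r / θ₀.2, θ₀.1))‖ₑ ^ 2 := by
    have h3 (x y p q : ℝ) :
        ‖x - y‖ₑ ^ 2 ≤ 3 * (‖x - p‖ₑ ^ 2 + ‖y - q‖ₑ ^ 2) + 3 * ‖p - q‖ₑ ^ 2 := by
      simp only [enorm_sq_eq_ofReal]
      rw [show (3 : ℝ≥0∞) = ENNReal.ofReal 3 by simp, ← ENNReal.ofReal_add (by positivity)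
        (by positivity), ← ENNReal.ofReal_mul (by positivity), ← ENNReal.ofReal_mul (by positivity),
        ← ENNReal.ofReal_add (by positivity) (by positivity)]
      refine ENNReal.ofReal_le_ofReal ?_
      nlinarith [sq_nonneg ((x - p) - (p - q)), sq_nonneg ((x - p) + (y - q)),
        sq_nonneg ((p - q) + (y - q))]
    have hm1 (τ : ℝ × ℝ) : Measurable fun r : ℝ =>
        ‖R (t - r / τ.2, τ.1) - c B (R (t - r / τ.2, τ.1))‖ₑ ^ 2 :=
      (((hmeas τ).sub ((hc B).measurable.comp (hmeas τ))).enorm).pow_const 2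
    calc _ ≤ ∫⁻ r in Ioc 0 T, (3 * (‖R (t - r / (θ n).2, (θ n).1) -
          c B (R (t - r / (θ n).2, (θ n).1))‖ₑ ^ 2 + ‖R (t - r / θ₀.2, θ₀.1) -
          c B (R (t - r / θ₀.2, θ₀.1))‖ₑ ^ 2) + 3 *
          ‖c B (R (t - r / (θ n).2, (θ n).1)) - c B (R (t - r / θ₀.2, θ₀.1))‖ₑ ^ 2) :=
          lintegral_mono fun r => h3 _ _ _ _
      _ = 3 * ((∫⁻ r in Ioc 0 T, ‖R (t - r / (θ n).2, (θ n).1) -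
          c B (R (t - r / (θ n).2, (θ n).1))‖ₑ ^ 2) + ∫⁻ r in Ioc 0 T, ‖R (t - r / θ₀.2, θ₀.1) -
          c B (R (t - r / θ₀.2, θ₀.1))‖ₑ ^ 2) + 3 * ∫⁻ r in Ioc 0 T,
          ‖c B (R (t - r / (θ n).2, (θ n).1)) - c B (R (t - r / θ₀.2, θ₀.1))‖ₑ ^ 2 := by
          rw [lintegral_add_left (f := fun r => 3 * (‖R (t - r / (θ n).2, (θ n).1) -
            c B (R (t - r / (θ n).2, (θ n).1))‖ₑ ^ 2 + ‖R (t - r / θ₀.2, θ₀.1) -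
            c B (R (t - r / θ₀.2, θ₀.1))‖ₑ ^ 2)) (((hm1 _).add (hm1 _)).const_mul 3),
            lintegral_const_mul' _ _ (by simp), lintegral_const_mul' _ _ (by simp),
            lintegral_add_left (hm1 _)]
      _ ≤ _ := by
          gcongr
          exacts [htail B hB (hθ n), htail B hB hθ₀]
  rw [ENNReal.tendsto_nhds_zero]
  intro ε hε
  have hε2 : 0 < ε / 2 := ENNReal.half_pos hε.ne'
  have hη' : Tendsto (fun k : ℕ => 3 * (ENNReal.ofReal M * (∫⁻ u in Ioc 0 t, G k u) +
        ENNReal.ofReal M * ∫⁻ u in Ioc 0 t, G k u)) atTop (𝓝 0) := by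
    have h1 := ENNReal.Tendsto.const_mul (a := ENNReal.ofReal M) hη (Or.inr ENNReal.ofReal_ne_top)
    have h2 := ENNReal.Tendsto.const_mul (a := 3) (h1.add h1) (Or.inr (by simp))
    simpa using h2
  obtain ⟨k, hk⟩ := (hη'.eventually_le_const hε2).exists
  have h3 := ENNReal.Tendsto.const_mul (a := 3) (hbdd k k.cast_nonneg) (Or.inr (by simp))
  rw [mul_zero] at h3
  filter_upwards [h3.eventually_le_const hε2] with n hn
  calc _ ≤ _ := hsplit k k.cast_nonneg n
    _ ≤ ε / 2 + ε / 2 := add_le_add hk hn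
    _ = ε := ENNReal.add_halves ε

/-! ### Readings of the signal as Poisson integrals -/

/-- The response to a release, with exponential killing at rate `α`. -/
def Sensor.kernel (φ₀ : Sensor) (a b α u β : ℝ) : ℝ :=
  Real.exp (-(α * u)) * φ₀.response a b u β

/-- A majorant of the kernels of all sensors, infinite for `u ≤ 0`. -/
def kernelBound (a b α u : ℝ) : ℝ≥0∞ := ENNReal.ofReal (Real.exp (-(α * u))) * heatTrace a b u

lemma measurable_kernelBound (a b α : ℝ) : Measurable (kernelBound a b α) :=
  Measurable.mul (by fun_prop) (measurable_heatTrace a b)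

lemma Sensor.measurable_kernel (φ₀ : Sensor) (a b α : ℝ) :
    Measurable fun p : ℝ × ℝ => φ₀.kernel a b α p.1 p.2 :=
  Measurable.mul (by fun_prop) (φ₀.measurable_response a b)

lemma Sensor.kernel_of_nonpos (φ₀ : Sensor) (a b α : ℝ) {u : ℝ} (hu : u ≤ 0) (β : ℝ) :
    φ₀.kernel a b α u β = 0 := by
  simp [Sensor.kernel, Sensor.response, not_lt.2 hu]

lemma Sensor.enorm_kernel_le (φ₀ : Sensor) {a : ℝ} (ha : 0 < a) (b α u : ℝ) {β : ℝ}
    (hβ : β ∈ Icc (0 : ℝ) 1) :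
    ‖φ₀.kernel a b α u β‖ₑ ≤
      ENNReal.ofReal (φ₀.bound * amplitude a b ^ 2) * kernelBound a b α u := by
  rw [Sensor.kernel, enorm_mul, kernelBound, Real.enorm_of_nonneg (Real.exp_pos _).le,
    mul_left_comm]
  gcongr
  exact φ₀.enorm_response_le ha b u hβ

lemma Sensor.integrableOn_kernel (φ₀ : Sensor) {a : ℝ} (ha : 0 < a) (b : ℝ) {α : ℝ} (hα : 0 < α)
    {β : ℝ} (hβ : β ∈ Icc (0 : ℝ) 1) : IntegrableOn (fun u => φ₀.kernel a b α u β) (Ioi 0) := by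
  refine ⟨((φ₀.measurable_kernel a b α).comp
    (measurable_id.prodMk measurable_const)).aestronglyMeasurable, ?_⟩
  rw [hasFiniteIntegral_iff_enorm]
  refine lt_of_le_of_lt (lintegral_mono fun u => φ₀.enorm_kernel_le ha b α u hβ) ?_
  rw [lintegral_const_mul' _ _ ENNReal.ofReal_ne_top]
  exact ENNReal.mul_lt_top ENNReal.ofReal_lt_top (lintegral_exp_mul_heatTrace_lt_top ha b hα)

/-- The contribution of the initial measure to the signal. -/
def initialPart (a b α : ℝ) (μ : FiniteMeasure I) (t : ℝ) (x : I) : ℝ :=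
  Real.exp (-(α * t)) * ∫ y : I, green a b t y x ∂(μ : Measure I)

lemma measurable_initialPart (a b α : ℝ) (μ : FiniteMeasure I) (t : ℝ) :
    Measurable (initialPart a b α μ t) := by
  refine Measurable.const_mul ?_ _
  refine StronglyMeasurable.measurable ?_
  refine StronglyMeasurable.integral_prod_right' (f := fun q : I × I => green a b t q.2 q.1)
    (Measurable.stronglyMeasurable ?_)
  exact (measurable_green a b).comp
    (by fun_prop : Measurable fun q : I × I => (t, (q.2 : ℝ), (q.1 : ℝ)))

lemma enorm_initialPart_le {a : ℝ} (ha : 0 < a) (b α : ℝ) (μ : FiniteMeasure I) (t : ℝ) (x : I) :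
    ‖initialPart a b α μ t x‖ₑ ≤
      ENNReal.ofReal (amplitude a b ^ 2) * (μ : Measure I) univ * kernelBound a b α t := by
  rw [initialPart, enorm_mul, Real.enorm_of_nonneg (Real.exp_pos _).le, kernelBound]
  calc _ ≤ ENNReal.ofReal (Real.exp (-(α * t))) *
        ∫⁻ _ : I, ENNReal.ofReal (amplitude a b ^ 2) * heatTrace a b t ∂(μ : Measure I) := by
        gcongr
        exact (enorm_integral_le_lintegral_enorm _).trans
          (lintegral_mono fun y => enorm_green_le ha b t y.2 x.2)
    _ = _ := by rw [lintegral_const]; ring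

lemma kernelBound_lt_top {a : ℝ} (ha : 0 < a) (b α : ℝ) {u : ℝ} (hu : 0 < u) :
    kernelBound a b α u < ∞ := by
  rw [kernelBound, heatTrace_eq_ofReal ha b hu]
  exact ENNReal.mul_lt_top ENNReal.ofReal_lt_top ENNReal.ofReal_lt_top

/-- The reading of the signal at time `t`, for a path whose jumps are summable against the
majorant. -/
lemma Sensor.read_signal (φ₀ : Sensor) {a : ℝ} (ha : 0 < a) (b α : ℝ) (μ : FiniteMeasure I)
    (p : CountingPath) {β l t : ℝ} (hβ : β ∈ Icc (0 : ℝ) 1) (hl : 0 < l) (ht : 0 < t)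
    (hfin : ∫⁻ r, (Iic t).indicator (fun s => kernelBound a b α (t - s)) (r / l) ∂p.jumps ≠ ∞) :
    φ₀.read (signal a b α μ p.1 β l t) = φ₀.read (initialPart a b α μ t) +
      ∫ r, φ₀.kernel a b α (t - r / l) β ∂p.jumps := by
  have hH : Measurable ((Iic t).indicator fun s => kernelBound a b α (t - s)) :=
    ((measurable_kernelBound a b α).comp (by fun_prop)).indicator measurableSet_Iic
  have hdiv : Measurable fun r : ℝ => r / l := by fun_prop
  have hB : ENNReal.ofReal (amplitude a b ^ 2) * (μ : Measure I) univ * kernelBound a b α t ≠ ∞ :=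
    ENNReal.mul_ne_top (ENNReal.mul_ne_top ENNReal.ofReal_ne_top (measure_ne_top _ _))
      (kernelBound_lt_top ha b α ht).ne
  have hsf : SFinite (pathMeasure p.1 l) := by
    rw [p.pathMeasure_eq_map hl]; infer_instance
  have h := φ₀.read_add_integral ha b α hβ (measurable_initialPart a b α μ t)
    (B := (ENNReal.ofReal (amplitude a b ^ 2) * (μ : Measure I) univ *
      kernelBound a b α t).toReal) (fun x => ?_)
    (ν := (pathMeasure p.1 l).restrict (Ioc 0 t)) (u := fun s => t - s) (by fun_prop) ?_
  · refine Eq.trans h ?_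
    congr 1
    -- The kernel vanishes at nonpositive times, so the upper limit t may be dropped.
    have h1 : ∫ s in Ioc 0 t, φ₀.kernel a b α (t - s) β ∂(pathMeasure p.1 l) =
        ∫ s in Ioi 0, φ₀.kernel a b α (t - s) β ∂(pathMeasure p.1 l) := by
      refine (setIntegral_eq_of_subset_of_forall_sdiff_eq_zero measurableSet_Ioi
        (fun _ h => h.1) fun s hs => φ₀.kernel_of_nonpos _ _ _ ?_ _).symm
      have : ¬ s ≤ t := fun h => hs.2 ⟨hs.1, h⟩
      linarith
    have hk : Measurable fun s => φ₀.kernel a b α (t - s) β :=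
      (φ₀.measurable_kernel a b α).comp (by fun_prop : Measurable fun s : ℝ => (t - s, β))
    refine h1.trans ?_
    rw [p.pathMeasure_eq_map hl, setIntegral_map measurableSet_Ioi hk.aestronglyMeasurable
      hdiv.aemeasurable]
    have : (fun r : ℝ => r / l) ⁻¹' Ioi 0 = Ioi 0 := by ext r; simp [hl]
    rw [this, p.jumps_restrict_Ioi]
  · have := enorm_initialPart_le ha b α μ t x
    rw [← ofReal_norm] at this
    exact (ENNReal.ofReal_le_iff_le_toReal hB).1 this
  · refine ne_top_of_le_ne_top hfin ?_
    rw [← lintegral_map hH hdiv, ← p.pathMeasure_eq_map hl, lintegral_indicator measurableSet_Iic]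
    exact lintegral_mono_set fun s hs => hs.2

lemma Sensor.read_stationarySignal (φ₀ : Sensor) {a : ℝ} (ha : 0 < a) (b α : ℝ)
    (p : CountingPath) {β l : ℝ} (hβ : β ∈ Icc (0 : ℝ) 1) (hl : 0 < l)
    (hfin : ∫⁻ r, kernelBound a b α (r / l) ∂p.jumps ≠ ∞) :
    φ₀.read (stationarySignal a b α p.1 β l) = ∫ r, φ₀.kernel a b α (r / l) β ∂p.jumps := by
  have hdiv : Measurable fun r : ℝ => r / l := by fun_prop
  have hsf : SFinite (pathMeasure p.1 l) := by
    rw [p.pathMeasure_eq_map hl]; infer_instance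
  have hpre : (fun r : ℝ => r / l) ⁻¹' Ioi 0 = Ioi 0 := by ext r; simp [hl]
  have h := φ₀.read_add_integral ha b α hβ (A := fun _ => 0) measurable_const (B := 0) (by simp)
    (ν := (pathMeasure p.1 l).restrict (Ioi 0)) (u := fun s => s) measurable_id ?_
  · have h0 : φ₀.read (fun _ => 0) = 0 := by cases φ₀ <;> simp [Sensor.read, pairing]
    rw [h0, zero_add] at h
    simp only [zero_add] at h
    refine Eq.trans h ?_
    have hk : Measurable fun s => φ₀.kernel a b α s β :=
      (φ₀.measurable_kernel a b α).comp (measurable_id.prodMk measurable_const)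
    change ∫ s in Ioi 0, φ₀.kernel a b α s β ∂(pathMeasure p.1 l) = _
    rw [p.pathMeasure_eq_map hl, setIntegral_map measurableSet_Ioi hk.aestronglyMeasurable
      hdiv.aemeasurable, hpre, p.jumps_restrict_Ioi]
  · refine ne_top_of_le_ne_top hfin ?_
    rw [← lintegral_map (measurable_kernelBound a b α) hdiv, ← p.pathMeasure_eq_map hl]
    exact setLIntegral_le_lintegral _ _

/-- The bound does not depend on t and is linear in l, hence uniform over intensities l ≤ M. -/
lemma setLIntegral_kernelBound_comp (a b α : ℝ) {l : ℝ}
    (hl : 0 < l) (t : ℝ) :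
    ∫⁻ r in Ioi 0, (Iic t).indicator (fun s => kernelBound a b α (t - s)) (r / l) ≤
      ENNReal.ofReal l * ∫⁻ u in Ioi 0, kernelBound a b α u := by
  rw [setLIntegral_Ioi_comp_div hl]
  refine mul_le_mul_right ?_ _
  rw [setLIntegral_indicator measurableSet_Iic, ← lintegral_indicator
    (measurableSet_Iic.inter measurableSet_Ioi), ← lintegral_sub_left_eq_self _ t,
    restrict_Ioi_eq_restrict_Ici, ← lintegral_indicator measurableSet_Ici]
  refine lintegral_mono fun s => ?_
  by_cases h : 0 ≤ s
  · refine (indicator_le_self' (fun _ _ => zero_le) _).trans ?_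
    simp [h]
  · rw [indicator_of_notMem]
    · exact zero_le
    · simp [h]

/-- Fubini's theorem for a function of two independent variables. -/
lemma lintegral_comp_prod_of_indepFun {Ω A B : Type*} [MeasurableSpace Ω] [MeasurableSpace A]
    [MeasurableSpace B] {P : Measure Ω} [IsProbabilityMeasure P] {X : Ω → A} {Y : Ω → B}
    (hX : Measurable X) (hY : Measurable Y) (hXY : IndepFun X Y P) {f : A × B → ℝ≥0∞}
    (hf : Measurable f) :
    ∫⁻ ω, f (X ω, Y ω) ∂P = ∫⁻ ω', ∫⁻ ω, f (X ω, Y ω') ∂P ∂P := by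
  have h1 := (indepFun_iff_map_prod_eq_prod_map_map hX.aemeasurable hY.aemeasurable).1 hXY
  have : IsProbabilityMeasure (P.map X) := Measure.isProbabilityMeasure_map hX.aemeasurable
  have : IsProbabilityMeasure (P.map Y) := Measure.isProbabilityMeasure_map hY.aemeasurable
  rw [← lintegral_map (f := f) (g := fun ω => (X ω, Y ω)) hf (hX.prodMk hY), h1,
    lintegral_prod_symm' _ hf, lintegral_map hf.lintegral_prod_left' hY]
  refine lintegral_congr fun ω' => ?_
  rw [lintegral_map (f := fun x => f (x, Y ω'))
    (hf.comp (measurable_id.prodMk measurable_const)) hX]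

/-! ### Mean square convergence of the approximating signals -/

section Approximation

variable {Ω : Type*} [MeasurableSpace Ω] {P : Measure Ω} {N : ℝ≥0 → Ω → ℕ}

lemma measurable_kernelBound_comp (a b α t : ℝ) :
    Measurable fun q : (CountingPath × (ℝ × ℝ)) × ℝ =>
      (Iic t).indicator (fun s => kernelBound a b α (t - s)) (q.2 / q.1.2.2) :=
  (((measurable_kernelBound a b α).comp (by fun_prop)).indicator measurableSet_Iic).comp
    (by fun_prop : Measurable fun q : (CountingPath × (ℝ × ℝ)) × ℝ => q.2 / q.1.2.2)

/-- Independence allows θ to be frozen, and Campbell's formula bounds the mean. Almost every path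
thus meets the summability condition of `Sensor.read_signal`, even at random parameters. -/
lemma IsStandardPoisson.ae_lintegral_kernelBound_ne_top [IsProbabilityMeasure P]
    (hN : IsStandardPoisson N P) {a : ℝ} (ha : 0 < a) (b : ℝ) {α : ℝ} (hα : 0 < α) (t : ℝ) {M : ℝ}
    {θ : Ω → ℝ × ℝ} (hθm : Measurable θ) (hθ : ∀ᵐ ω ∂P, θ ω ∈ paramSet M)
    (hind : IndepFun hN.path θ P) :
    ∀ᵐ ω ∂P, ∫⁻ r, (Iic t).indicator (fun s => kernelBound a b α (t - s)) (r / (θ ω).2)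
      ∂(hN.path ω).jumps ≠ ∞ := by
  have hm : Measurable fun q : CountingPath × (ℝ × ℝ) =>
      ∫⁻ r, (Iic t).indicator (fun s => kernelBound a b α (t - s)) (r / q.2.2) ∂q.1.jumps :=
    (measurable_kernelBound_comp a b α t).lintegral_kernel_prod_right'
      (κ := jumpKernel.prodMkRight (ℝ × ℝ))
  refine (ae_lt_top (hm.comp (hN.measurable_path.prodMk hθm)) ?_).mono fun ω h => h.ne
  refine ne_top_of_le_ne_top (b := ENNReal.ofReal M * ∫⁻ u in Ioi 0, kernelBound a b α u)
    (ENNReal.mul_ne_top ENNReal.ofReal_ne_top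
      (lintegral_exp_mul_heatTrace_lt_top ha b hα).ne) ?_
  refine (lintegral_comp_prod_of_indepFun hN.measurable_path hθm hind hm).trans_le ?_
  calc _ ≤ ∫⁻ _ : Ω, ENNReal.ofReal M * (∫⁻ u in Ioi 0, kernelBound a b α u) ∂P := by
        refine lintegral_mono_ae ?_
        filter_upwards [hθ] with ω' h'
        rw [hN.lintegral_jumps (H := fun r => (Iic t).indicator
          (fun s => kernelBound a b α (t - s)) (r / (θ ω').2))]
        · refine (setLIntegral_kernelBound_comp a b α h'.2.1 t).trans ?_
          exact mul_le_mul_left (ENNReal.ofReal_le_ofReal h'.2.2) _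
        · exact (((measurable_kernelBound a b α).comp (by fun_prop)).indicator
            measurableSet_Iic).comp (by fun_prop : Measurable fun r : ℝ => r / (θ ω').2)
    _ = _ := by simp

lemma Sensor.integrable_kernel_comp (φ₀ : Sensor) {a : ℝ} (ha : 0 < a) (b α t : ℝ)
    (p : CountingPath) {β l : ℝ} (hβ : β ∈ Icc (0 : ℝ) 1)
    (hfin : ∫⁻ r, (Iic t).indicator (fun s => kernelBound a b α (t - s)) (r / l) ∂p.jumps ≠ ∞) :
    Integrable (fun r => φ₀.kernel a b α (t - r / l) β) p.jumps := by
  refine ⟨((φ₀.measurable_kernel a b α).comp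
    (by fun_prop : Measurable fun r : ℝ => (t - r / l, β))).aestronglyMeasurable, ?_⟩
  rw [hasFiniteIntegral_iff_enorm]
  refine lt_of_le_of_lt (b := ∫⁻ r, ENNReal.ofReal (φ₀.bound * amplitude a b ^ 2) *
    (Iic t).indicator (fun s => kernelBound a b α (t - s)) (r / l) ∂p.jumps)
    (lintegral_mono fun r => ?_) ?_
  · by_cases h : r / l ≤ t
    · rw [indicator_of_mem (show r / l ∈ Iic t from h)]
      exact φ₀.enorm_kernel_le ha b α _ hβ
    · rw [φ₀.kernel_of_nonpos _ _ _ (by linarith)]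
      simp
  · rw [lintegral_const_mul' _ _ ENNReal.ofReal_ne_top]
    exact ENNReal.mul_lt_top ENNReal.ofReal_lt_top hfin.lt_top

lemma sq_kernel_weight_le {a : ℝ} (ha : 0 < a) (b : ℝ) {α : ℝ} (hα : 0 < α) (φ : I →ᵇ ℝ) (u : ℝ)
    {β : ℝ} (hβ : β ∈ Icc (0 : ℝ) 1) :
    ‖(Sensor.weight φ).kernel a b α u β‖ₑ ^ 2 ≤
      ENNReal.ofReal (amplitude a b ^ 2 *
        ∑' j, pairing (fun x => eigenfunction a b j x) φ ^ 2) * heatTrace a b u := by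
  rcases le_or_gt u 0 with hu | hu
  · simp [Sensor.kernel_of_nonpos _ a b α hu β]
  · refine le_trans ?_ (sq_response_weight_le ha b φ u hβ)
    gcongr
    rw [Sensor.kernel, enorm_mul, Real.enorm_of_nonneg (Real.exp_pos _).le]
    refine mul_le_of_le_one_left zero_le ?_
    rw [ENNReal.ofReal_le_one, Real.exp_le_one_iff]
    have := mul_pos hα hu
    linarith

/-- Convergence in mean square of the readings of the approximating signals, when the parameters
are consistent and independent of the driving Poisson process. -/
theorem IsStandardPoisson.tendsto_pairing_signal [IsProbabilityMeasure P]
    (hN : IsStandardPoisson N P) {a : ℝ} (ha : 0 < a) (b : ℝ) {α : ℝ} (hα : 0 < α) {t : ℝ}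
    (ht : 0 < t) {M : ℝ} {θ₀ : ℝ × ℝ} (hθ₀ : θ₀ ∈ paramSet M) {θ : ℕ → Ω → ℝ × ℝ}
    (hθm : ∀ n, Measurable (θ n)) (hθ : ∀ n, ∀ᵐ ω ∂P, θ n ω ∈ paramSet M)
    (hind : ∀ n, IndepFun hN.path (θ n) P)
    (hcons : ∀ ns : ℕ → ℕ, Tendsto ns atTop atTop → ∃ ms : ℕ → ℕ, ∀ᵐ ω ∂P,
      Tendsto (fun k => θ (ns (ms k)) ω) atTop (𝓝 θ₀))
    (V₀ : ℕ → Ω → FiniteMeasure I) (φ : I →ᵇ ℝ) :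
    (∀ n, MemLp (fun ω =>
      pairing (signal a b α (V₀ n ω) (fun t => N t ω) (θ n ω).1 (θ n ω).2 t) φ -
      pairing (signal a b α (V₀ n ω) (fun t => N t ω) θ₀.1 θ₀.2 t) φ) 2 P) ∧
    Tendsto (fun n => ∫ ω,
      |pairing (signal a b α (V₀ n ω) (fun t => N t ω) (θ n ω).1 (θ n ω).2 t) φ -
      pairing (signal a b α (V₀ n ω) (fun t => N t ω) θ₀.1 θ₀.2 t) φ| ^ 2 ∂P) atTop (𝓝 0) := by
  set D : ℕ → Ω → ℝ := fun n ω =>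
    pairing (signal a b α (V₀ n ω) (fun t => N t ω) (θ n ω).1 (θ n ω).2 t) φ -
      pairing (signal a b α (V₀ n ω) (fun t => N t ω) θ₀.1 θ₀.2 t) φ
  let R : ℝ × ℝ → ℝ := fun p => (Sensor.weight φ).kernel a b α p.1 p.2
  have hR : Measurable R := (Sensor.weight φ).measurable_kernel a b α
  let S : ℝ → ℝ≥0∞ := fun u => ENNReal.ofReal (amplitude a b ^ 2 *
        ∑' j, pairing (fun x => eigenfunction a b j x) φ ^ 2) * heatTrace a b u
  have hS : Measurable S := (measurable_heatTrace a b).const_mul _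
  have hSi : ∫⁻ u in Ioc 0 t, S u ≠ ∞ := by
    simp only [S]
    rw [lintegral_const_mul' _ _ ENNReal.ofReal_ne_top]
    exact ENNReal.mul_ne_top ENNReal.ofReal_ne_top (setLIntegral_heatTrace_lt_top ha b t).ne
  have hRS (u β : ℝ) (hβ : β ∈ Ioo (0 : ℝ) 1) : ‖R (u, β)‖ₑ ^ 2 ≤ S u :=
    sq_kernel_weight_le ha b hα φ u (Ioo_subset_Icc_self hβ)
  have hR0 (u β : ℝ) (hu : u ≤ 0) : R (u, β) = 0 :=
    (Sensor.weight φ).kernel_of_nonpos a b α hu β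
  have hRc (u β : ℝ) (hu : 0 < u) (hβ : β ∈ Ioo (0 : ℝ) 1) : ContinuousAt R (u, β) :=
    ContinuousAt.mul (Continuous.continuousAt (by fun_prop))
      (continuousAt_response_weight ha b φ hu hβ)
  have hM : 0 < M := hθ₀.2.1.trans_le hθ₀.2.2
  -- A jump at r acts before time t only if r < λt ≤ Mt, so one interval serves all parameters.
  let T : ℝ≥0 := Real.toNNReal (M * t)
  have hT : (T : ℝ) = M * t := Real.coe_toNNReal _ (by positivity)
  let E : CountingPath × (ℝ × ℝ) → ℝ → ℝ := fun q r =>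
    R (t - r / q.2.2, q.2.1) - R (t - r / θ₀.2, θ₀.1)
  have hRm : Measurable fun x : (CountingPath × (ℝ × ℝ)) × ℝ => R (t - x.2 / x.1.2.2, x.1.2.1) :=
    hR.comp (by fun_prop)
  have hRm₀ : Measurable fun x : (CountingPath × (ℝ × ℝ)) × ℝ => R (t - x.2 / θ₀.2, θ₀.1) :=
    hR.comp (by fun_prop)
  have hEm : Measurable fun x : (CountingPath × (ℝ × ℝ)) × ℝ => E x.1 x.2 := hRm.sub hRm₀
  -- the difference as a Poisson integral
  have hae (n : ℕ) : ∀ᵐ ω ∂P, D n ω = ∫ r in Ioc 0 (T : ℝ), E (hN.path ω, θ n ω) r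
      ∂(hN.path ω).jumps := by
    filter_upwards [hN.ae_lintegral_kernelBound_ne_top ha b hα t (hθm n) (hθ n) (hind n),
      hN.ae_lintegral_kernelBound_ne_top ha b hα t (measurable_const (a := θ₀))
        (ae_of_all P fun _ => hθ₀) (indepFun_const_right _ _), hθ n] with ω h1 h2 h3
    have e1 := (Sensor.weight φ).read_signal ha b α (V₀ n ω) (hN.path ω)
      (Ioo_subset_Icc_self h3.1) h3.2.1 ht h1
    have e2 := (Sensor.weight φ).read_signal ha b α (V₀ n ω) (hN.path ω)
      (Ioo_subset_Icc_self hθ₀.1) hθ₀.2.1 ht h2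
    have i1 := (Sensor.weight φ).integrable_kernel_comp ha b α t (hN.path ω)
      (Ioo_subset_Icc_self h3.1) h1
    have i2 := (Sensor.weight φ).integrable_kernel_comp ha b α t (hN.path ω)
      (Ioo_subset_Icc_self hθ₀.1) h2
    have e3 : D n ω = ∫ r, E (hN.path ω, θ n ω) r ∂(hN.path ω).jumps := by
      refine (congrArg₂ (· - ·) e1 e2).trans ?_
      -- Both signals start from the same measure, whose contributions cancel.
      rw [add_sub_add_left_eq_sub]
      exact (integral_sub i1 i2).symm
    rw [e3, ← (hN.path ω).jumps_restrict_Ioi]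
    rw [setIntegral_eq_of_subset_of_forall_sdiff_eq_zero measurableSet_Ioi
      (Ioc_subset_Ioi_self : Ioc 0 (T : ℝ) ⊆ _) fun r hr => ?_]
    · rw [(hN.path ω).jumps_restrict_Ioi]
    · have hrT : M * t < r := by
        by_contra h
        exact hr.2 ⟨hr.1, by rw [hT]; linarith⟩
      have hz {l : ℝ} (hl : 0 < l) (hlM : l ≤ M) : t - r / l ≤ 0 := by
        have : t ≤ r / l := by
          rw [le_div_iff₀ hl]
          nlinarith
        linarith
      simp only [E]
      rw [hR0 _ _ (hz h3.2.1 h3.2.2), hR0 _ _ (hz hθ₀.2.1 hθ₀.2.2), sub_zero]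
  -- Measurability is taken from the Poisson integral, in which the initial measure no longer
  -- occurs.
  have hDm (n : ℕ) : AEStronglyMeasurable (D n) P := by
    refine AEStronglyMeasurable.congr ?_ ((hae n).mono fun ω h => h.symm)
    have h1 : StronglyMeasurable fun q : CountingPath × (ℝ × ℝ) =>
        ∫ r, (Ioc 0 (T : ℝ)).indicator (E q) r ∂q.1.jumps := by
      refine StronglyMeasurable.integral_kernel_prod_right'
        (κ := jumpKernel.prodMkRight (ℝ × ℝ))
        (f := fun x : (CountingPath × (ℝ × ℝ)) × ℝ => (Ioc 0 (T : ℝ)).indicator (E x.1) x.2) ?_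
      exact (hEm.indicator (measurable_snd measurableSet_Ioc)).stronglyMeasurable
    simp_rw [integral_indicator measurableSet_Ioc] at h1
    exact (h1.comp_measurable (hN.measurable_path.prodMk (hθm n))).aestronglyMeasurable
  let ρ : ℝ × ℝ → ℝ≥0∞ := fun τ =>
    ∫⁻ r in Ioc 0 (T : ℝ), ‖R (t - r / τ.2, τ.1) - R (t - r / θ₀.2, θ₀.1)‖ₑ ^ 2
  have hρm : Measurable ρ := by
    refine Measurable.lintegral_prod_right' (f := fun x : (ℝ × ℝ) × ℝ =>
      ‖R (t - x.2 / x.1.2, x.1.1) - R (t - x.2 / θ₀.2, θ₀.1)‖ₑ ^ 2) ?_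
    exact (((hR.comp (by fun_prop)).sub (hR.comp (by fun_prop))).enorm).pow_const 2
  -- second moment bound
  have hL2 (n : ℕ) : ∫⁻ ω, ‖D n ω‖ₑ ^ 2 ∂P ≤ (1 + T) * ∫⁻ ω, ρ (θ n ω) ∂P := by
    have hf : Measurable fun q : CountingPath × (ℝ × ℝ) =>
        (∫⁻ r in Ioc 0 (T : ℝ), ‖E q r‖ₑ ∂q.1.jumps) ^ 2 := by
      refine Measurable.pow_const ?_ 2
      simp_rw [← lintegral_indicator measurableSet_Ioc]
      refine Measurable.lintegral_kernel_prod_right' (κ := jumpKernel.prodMkRight (ℝ × ℝ))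
        (f := fun x : (CountingPath × (ℝ × ℝ)) × ℝ =>
          (Ioc 0 (T : ℝ)).indicator (fun r => ‖E x.1 r‖ₑ) x.2) ?_
      exact hEm.enorm.indicator (measurable_snd measurableSet_Ioc)
    calc _ ≤ ∫⁻ ω, (∫⁻ r in Ioc 0 (T : ℝ), ‖E (hN.path ω, θ n ω) r‖ₑ ∂(hN.path ω).jumps) ^ 2
          ∂P := by
          refine lintegral_mono_ae ?_
          filter_upwards [hae n] with ω h
          rw [h]
          gcongr
          exact enorm_integral_le_lintegral_enorm _
      -- Independence separates the randomness of the path, ω, from that of the parameters, ω',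
      -- which are then constants in the inner integral.
      _ = ∫⁻ ω', ∫⁻ ω, (∫⁻ r in Ioc 0 (T : ℝ), ‖E (hN.path ω, θ n ω') r‖ₑ
          ∂(hN.path ω).jumps) ^ 2 ∂P ∂P :=
          lintegral_comp_prod_of_indepFun hN.measurable_path (hθm n) (hind n) hf
      _ ≤ ∫⁻ ω', (1 + T) * ρ (θ n ω') ∂P := by
          refine lintegral_mono fun ω' => ?_
          refine hN.lintegral_jumps_sq_le T (H := fun r =>
            ‖R (t - r / (θ n ω').2, (θ n ω').1) - R (t - r / θ₀.2, θ₀.1)‖ₑ) ?_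
          exact ((hR.comp (by fun_prop)).sub (hR.comp (by fun_prop))).enorm
      _ = _ := lintegral_const_mul' _ _ (by simp)
  have hdom (τ : ℝ × ℝ) (hτ : τ ∈ paramSet M) :
      ∫⁻ r in Ioc 0 (T : ℝ), ‖R (t - r / τ.2, τ.1)‖ₑ ^ 2 ≤
        ENNReal.ofReal M * ∫⁻ u in Ioc 0 t, S u := by
    calc _ ≤ ∫⁻ r in Ioi 0, (Ioc 0 t).indicator S (t - r / τ.2) := by
          refine le_trans (setLIntegral_mono' measurableSet_Ioc fun r hr => ?_)
            (lintegral_mono_set Ioc_subset_Ioi_self)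
          have h1 := div_nonneg hr.1.le hτ.2.1.le
          by_cases h : 0 < t - r / τ.2
          · rw [indicator_of_mem (show _ ∈ Ioc 0 t from ⟨h, by linarith⟩)]
            exact hRS _ _ hτ.1
          · rw [hR0 _ _ (not_lt.1 h)]
            simp
      _ = ENNReal.ofReal τ.2 * ∫⁻ u in Iio t, (Ioc 0 t).indicator S u :=
          setLIntegral_Ioi_comp_sub_div hτ.2.1 t _
      _ ≤ _ := by
          refine mul_le_mul' (ENNReal.ofReal_le_ofReal hτ.2.2) ?_
          refine (setLIntegral_le_lintegral _ _).trans (le_of_eq ?_)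
          rw [← lintegral_indicator measurableSet_Ioc]
  let C : ℝ≥0∞ := 2 * (ENNReal.ofReal M * ∫⁻ u in Ioc 0 t, S u) +
    2 * (ENNReal.ofReal M * ∫⁻ u in Ioc 0 t, S u)
  have hC : C ≠ ∞ := by
    have h1 := ENNReal.mul_ne_top (a := ENNReal.ofReal M) ENNReal.ofReal_ne_top hSi
    exact ENNReal.add_ne_top.2 ⟨ENNReal.mul_ne_top (by simp) h1, ENNReal.mul_ne_top (by simp) h1⟩
  have hρC (τ : ℝ × ℝ) (hτ : τ ∈ paramSet M) : ρ τ ≤ C := by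
    have h2 (x y : ℝ) : ‖x - y‖ₑ ^ 2 ≤ 2 * ‖x‖ₑ ^ 2 + 2 * ‖y‖ₑ ^ 2 := by
      simp only [enorm_sq_eq_ofReal]
      rw [show (2 : ℝ≥0∞) = ENNReal.ofReal 2 by simp, ← ENNReal.ofReal_mul (by positivity),
        ← ENNReal.ofReal_mul (by positivity), ← ENNReal.ofReal_add (by positivity) (by positivity)]
      exact ENNReal.ofReal_le_ofReal (by nlinarith [sq_nonneg (x + y)])
    have hm1 : Measurable fun r : ℝ => 2 * ‖R (t - r / τ.2, τ.1)‖ₑ ^ 2 :=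
      (((hR.comp (by fun_prop)).enorm).pow_const 2).const_mul 2
    calc ρ τ ≤ ∫⁻ r in Ioc 0 (T : ℝ), (2 * ‖R (t - r / τ.2, τ.1)‖ₑ ^ 2 +
          2 * ‖R (t - r / θ₀.2, θ₀.1)‖ₑ ^ 2) := lintegral_mono fun r => h2 _ _
      _ = 2 * (∫⁻ r in Ioc 0 (T : ℝ), ‖R (t - r / τ.2, τ.1)‖ₑ ^ 2) +
          2 * ∫⁻ r in Ioc 0 (T : ℝ), ‖R (t - r / θ₀.2, θ₀.1)‖ₑ ^ 2 := by
          rw [lintegral_add_left hm1, lintegral_const_mul' _ _ (by simp),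
            lintegral_const_mul' _ _ (by simp)]
      _ ≤ C := add_le_add (mul_le_mul' le_rfl (hdom τ hτ)) (mul_le_mul' le_rfl (hdom θ₀ hθ₀))
  have hfinite (n : ℕ) : ∫⁻ ω, ‖D n ω‖ₑ ^ 2 ∂P ≠ ∞ := by
    refine ne_top_of_le_ne_top (b := (1 + T) * C) (ENNReal.mul_ne_top (by simp) hC)
      ((hL2 n).trans ?_)
    gcongr
    calc _ ≤ ∫⁻ _ : Ω, C ∂P := lintegral_mono_ae ((hθ n).mono fun ω h => hρC _ h)
      _ = C := by simp
  have hρlim : Tendsto (fun n => ∫⁻ ω, ρ (θ n ω) ∂P) atTop (𝓝 0) := by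
    -- Almost sure convergence of the parameters along a further subsequence of every subsequence is
    -- enough; there ρ(θ) tends to 0 and is dominated by `C`.
    refine tendsto_of_subseq_tendsto fun ns hns => ?_
    obtain ⟨ms, hms⟩ := hcons ns hns
    refine ⟨ms, ?_⟩
    have h := tendsto_lintegral_of_dominated_convergence (μ := P) (fun _ => C)
      (F := fun k ω => ρ (θ (ns (ms k)) ω)) (f := fun _ => 0)
      (fun k => hρm.comp (hθm _)) (fun k => (hθ _).mono fun ω h => hρC _ h) (by simpa using hC) ?_
    · simpa using h
    · filter_upwards [hms, ae_all_iff.2 hθ] with ω h1 h2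
      exact tendsto_lintegral_sq_dilation hR hR0 hRc hS hSi (fun u β _ hβ => hRS u β hβ) T
        (fun k => h2 _) hθ₀ h1
  have hDlim : Tendsto (fun n => ∫⁻ ω, ‖D n ω‖ₑ ^ 2 ∂P) atTop (𝓝 0) := by
    have h := ENNReal.Tendsto.const_mul (a := 1 + (T : ℝ≥0∞)) hρlim (Or.inr (by simp))
    rw [mul_zero] at h
    exact tendsto_of_tendsto_of_tendsto_of_le_of_le tendsto_const_nhds h (fun _ => zero_le) hL2
  have hsq (n : ℕ) : ∫ ω, |D n ω| ^ 2 ∂P = (∫⁻ ω, ‖D n ω‖ₑ ^ 2 ∂P).toReal := by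
    rw [integral_eq_lintegral_of_nonneg_ae (ae_of_all _ fun ω => sq_nonneg _)
      ((continuous_abs.comp_aestronglyMeasurable (hDm n)).pow 2)]
    simp only [enorm_sq_eq_ofReal, sq_abs]
  refine ⟨fun n => ?_, ?_⟩
  · rw [memLp_two_iff_integrable_sq (hDm n)]
    refine ⟨(hDm n).pow 2, ?_⟩
    rw [hasFiniteIntegral_iff_enorm]
    simpa [enorm_pow] using (hfinite n).lt_top
  · change Tendsto (fun n => ∫ ω, |D n ω| ^ 2 ∂P) atTop (𝓝 0)
    simp_rw [hsq]
    exact (ENNReal.tendsto_toReal ENNReal.zero_ne_top).comp hDlim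

end Approximation

/-! ### Weak laws of large numbers in mean -/

section WeakLaw

variable {Ω : Type*} [MeasurableSpace Ω] {P : Measure Ω} [IsProbabilityMeasure P]

lemma abs_covariance_le_of_variance_le {X Y : Ω → ℝ} (hX : MemLp X 2 P) (hY : MemLp Y 2 P) {V : ℝ}
    (hXV : Var[X; P] ≤ V) (hYV : Var[Y; P] ≤ V) : |cov[X, Y; P]| ≤ V := by
  have h1 : MemLp (fun ω => X ω - ∫ ω, X ω ∂P) 2 P := hX.sub (memLp_const _)
  have h2 : MemLp (fun ω => Y ω - ∫ ω, Y ω ∂P) 2 P := hY.sub (memLp_const _)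
  rw [variance_eq_integral hX.aemeasurable] at hXV
  rw [variance_eq_integral hY.aemeasurable] at hYV
  calc |cov[X, Y; P]| ≤ ∫ ω, |(X ω - ∫ ω, X ω ∂P) * (Y ω - ∫ ω, Y ω ∂P)| ∂P :=
        abs_integral_le_integral_abs
    _ ≤ ∫ ω, ((X ω - ∫ ω, X ω ∂P) ^ 2 / 2 + (Y ω - ∫ ω, Y ω ∂P) ^ 2 / 2) ∂P := by
        refine integral_mono (h1.integrable_mul h2).abs
          ((h1.integrable_sq.div_const 2).add (h2.integrable_sq.div_const 2)) fun ω => ?_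
        simp only
        rw [abs_mul]
        have := sq_abs (X ω - ∫ ω, X ω ∂P)
        have := sq_abs (Y ω - ∫ ω, Y ω ∂P)
        nlinarith [sq_nonneg (|X ω - ∫ ω, X ω ∂P| - |Y ω - ∫ ω, Y ω ∂P|)]
    _ ≤ V := by
        rw [integral_add (h1.integrable_sq.div_const 2) (h2.integrable_sq.div_const 2),
          integral_div, integral_div]
        linarith

/-- Each row of the covariance matrix has at most 2m nonzero entries, so the variance of the sum
grows only linearly in n. -/
lemma variance_sum_range_le_of_covariance_eq_zero {Z : ℕ → Ω → ℝ} (hZ : ∀ i, MemLp (Z i) 2 P)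
    {V : ℝ} (hV : ∀ i, Var[Z i; P] ≤ V) {m : ℕ}
    (hcov : ∀ i j, i + m ≤ j → cov[Z i, Z j; P] = 0) (n : ℕ) :
    Var[fun ω => ∑ i ∈ Finset.range n, Z i ω; P] ≤ n * (2 * m * V) := by
  have hV0 : 0 ≤ V := (variance_nonneg _ _).trans (hV 0)
  rw [variance_fun_sum' fun i _ => hZ i]
  calc _ ≤ ∑ i ∈ Finset.range n, 2 * (m : ℝ) * V := by
        refine Finset.sum_le_sum fun i _ => ?_
        calc _ ≤ ∑ j ∈ Finset.range n, if j ∈ Finset.Ico (i + 1 - m) (i + m) then V else 0 := by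
              refine Finset.sum_le_sum fun j _ => ?_
              split_ifs with h
              · exact (le_abs_self _).trans
                  (abs_covariance_le_of_variance_le (hZ i) (hZ j) (hV i) (hV j))
              · rw [Finset.mem_Ico] at h
                by_cases h1 : i + m ≤ j
                · exact (hcov i j h1).le
                · rw [covariance_comm]
                  exact (hcov j i (by omega)).le
          _ ≤ ∑ j ∈ Finset.Ico (i + 1 - m) (i + m), V := by
              rw [← Finset.sum_filter]
              refine Finset.sum_le_sum_of_subset_of_nonneg (fun j hj => (Finset.mem_filter.1 hj).2)
                fun _ _ _ => hV0
          _ ≤ _ := by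
              rw [Finset.sum_const, Nat.card_Ico, nsmul_eq_mul]
              refine mul_le_mul_of_nonneg_right ?_ hV0
              exact_mod_cast (by omega : i + m - (i + 1 - m) ≤ 2 * m)
    _ = _ := by simp

/-- The weak law of large numbers in mean, for square integrable variables whose correlations have
finite range. -/
theorem tendsto_integral_abs_average_sub {Z : ℕ → Ω → ℝ} (hZ : ∀ i, MemLp (Z i) 2 P)
    {V : ℝ} (hV : ∀ i, Var[Z i; P] ≤ V) {m : ℕ}
    (hcov : ∀ i j, i + m ≤ j → cov[Z i, Z j; P] = 0) :
    Tendsto (fun n : ℕ => ∫ ω, |(n : ℝ)⁻¹ * ∑ i ∈ Finset.range n, (Z i ω - ∫ ω, Z i ω ∂P)| ∂P)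
      atTop (𝓝 0) := by
  have hV0 : 0 ≤ V := (variance_nonneg _ _).trans (hV 0)
  have hS (n : ℕ) : MemLp (fun ω => ∑ i ∈ Finset.range n, Z i ω) 2 P :=
    memLp_finsetSum _ fun i _ => hZ i
  have hint (i : ℕ) : Integrable (Z i) P := (hZ i).integrable one_le_two
  let A : ℕ → Ω → ℝ := fun n ω => (n : ℝ)⁻¹ * ∑ i ∈ Finset.range n, (Z i ω - ∫ ω, Z i ω ∂P)
  have hA (n : ℕ) : MemLp (A n) 2 P :=
    (memLp_finsetSum _ fun i _ => (hZ i).sub (memLp_const _)).const_mul _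
  have hA2 (n : ℕ) : ∫ ω, A n ω ^ 2 ∂P ≤ (n : ℝ)⁻¹ * (2 * m * V) := by
    have h1 : ∫ ω, A n ω ^ 2 ∂P =
        (n : ℝ)⁻¹ ^ 2 * Var[fun ω => ∑ i ∈ Finset.range n, Z i ω; P] := by
      rw [variance_eq_integral (hS n).aemeasurable, ← integral_const_mul]
      simp only [A, Finset.sum_sub_distrib, mul_pow]
      rw [integral_finsetSum _ fun i _ => hint i]
    rw [h1]
    calc _ ≤ (n : ℝ)⁻¹ ^ 2 * (n * (2 * m * V)) := mul_le_mul_of_nonneg_left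
          (variance_sum_range_le_of_covariance_eq_zero hZ hV hcov n) (by positivity)
      _ = _ := by
          rcases eq_or_ne (n : ℝ) 0 with h | h
          · simp [h]
          · field_simp
  refine Metric.tendsto_atTop.2 fun η hη => ?_
  have hlim : Tendsto (fun n : ℕ => (2 / η) * ((n : ℝ)⁻¹ * (2 * m * V))) atTop (𝓝 0) := by
    simpa using ((tendsto_inv_atTop_nhds_zero_nat (𝕜 := ℝ)).mul_const (2 * m * V)).const_mul (2 / η)
  obtain ⟨n₀, hn₀⟩ := eventually_atTop.1 (hlim.eventually_lt_const (half_pos hη))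
  refine ⟨n₀, fun n hn => ?_⟩
  rw [Real.dist_eq, sub_zero, abs_of_nonneg (integral_nonneg fun ω => abs_nonneg _)]
  -- The arithmetic–geometric mean inequality passes from second to first moments without square
  -- roots.
  calc ∫ ω, |A n ω| ∂P ≤ ∫ ω, (η / 2 + 2 / η * A n ω ^ 2) ∂P := by
        refine integral_mono ((hA n).integrable one_le_two).abs
          ((integrable_const _).add ((hA n).integrable_sq.const_mul _)) fun ω => ?_
        simp only
        rw [← sq_abs (A n ω), div_add' _ _ _ two_ne_zero, le_div_iff₀ two_pos]
        have : 2 / η * |A n ω| ^ 2 * 2 = (2 * |A n ω|) ^ 2 / η := by ring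
        rw [this, ← sub_nonneg]
        have h3 : η + (2 * |A n ω|) ^ 2 / η - |A n ω| * 2 =
          (η ^ 2 + (2 * |A n ω|) ^ 2 - η * (2 * |A n ω|)) / η := by field_simp
        rw [h3]
        refine div_nonneg ?_ hη.le
        nlinarith [sq_nonneg (η - 2 * |A n ω|), abs_nonneg (A n ω)]
    _ ≤ η / 2 + 2 / η * ((n : ℝ)⁻¹ * (2 * m * V)) := by
        rw [integral_add (integrable_const _) ((hA n).integrable_sq.const_mul _),
          integral_const_mul]
        simp only [integral_const, probReal_univ, smul_eq_mul, one_mul]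
        gcongr
        exact hA2 n
    _ < η := by linarith [hn₀ n hn]

lemma variance_le_sq_of_abs_le {Z : Ω → ℝ} (hZ : AEMeasurable Z P) {B : ℝ} (hB : ∀ ω, |Z ω| ≤ B) :
    Var[Z; P] ≤ B ^ 2 := by
  refine (variance_le_expectation_sq hZ.aestronglyMeasurable).trans ?_
  calc _ ≤ ∫ _ : Ω, B ^ 2 ∂P := by
        refine integral_mono_of_nonneg (ae_of_all _ fun ω => sq_nonneg _) (integrable_const _)
          (ae_of_all _ fun ω => ?_)
        simp only [Pi.pow_apply]
        rw [← sq_abs]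
        have := hB ω
        gcongr
    _ = _ := by simp

/-- The weak law of large numbers in mean, for bounded variables which are uniformly approximated
by variables with a finite range of dependence. -/
theorem tendsto_integral_abs_average_sub_of_approx {K : ℕ → Ω → ℝ} (hK : ∀ i, Measurable (K i))
    {B : ℝ} (hB : ∀ i ω, |K i ω| ≤ B)
    (happrox : ∀ η > 0, ∃ (m : ℕ) (Z : ℕ → Ω → ℝ), (∀ i, Measurable (Z i)) ∧
      (∀ i ω, |Z i ω| ≤ B) ∧ (∀ i j, i + m ≤ j → IndepFun (Z i) (Z j) P) ∧
      ∀ i, ∫ ω, |K i ω - Z i ω| ∂P ≤ η)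
    {c : ℝ} (hc : Tendsto (fun i => ∫ ω, K i ω ∂P) atTop (𝓝 c)) :
    Tendsto (fun n : ℕ => ∫ ω, |(n : ℝ)⁻¹ * ∑ i ∈ Finset.range n, K i ω - c| ∂P)
      atTop (𝓝 0) := by
  have hKi (i : ℕ) : Integrable (K i) P := (integrable_const B).mono' (hK i).aestronglyMeasurable
    (ae_of_all _ fun ω => hB i ω)
  refine Metric.tendsto_atTop.2 fun η hη => ?_
  obtain ⟨m, Z, hZm, hZB, hZi, hKZ⟩ := happrox (η / 4) (by positivity)
  have hZ2 (i : ℕ) : MemLp (Z i) 2 P := MemLp.of_bound (hZm i).aestronglyMeasurable B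
    (ae_of_all _ fun ω => hZB i ω)
  have hZint (i : ℕ) : Integrable (Z i) P := (hZ2 i).integrable one_le_two
  have h1 := tendsto_integral_abs_average_sub hZ2
    (fun i => variance_le_sq_of_abs_le (hZm i).aemeasurable (hZB i))
    (fun i j hij => (hZi i j hij).covariance_eq_zero (hZ2 i) (hZ2 j))
  have h2 : Tendsto (fun n : ℕ => |(n : ℝ)⁻¹ * ∑ i ∈ Finset.range n, ∫ ω, K i ω ∂P - c|) atTop
      (𝓝 0) := by
    have := (hc.cesaro.sub_const c).abs
    simpa using this
  obtain ⟨n₁, hn₁⟩ := eventually_atTop.1 (h1.eventually_lt_const (by positivity : 0 < η / 4))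
  obtain ⟨n₂, hn₂⟩ := eventually_atTop.1 (h2.eventually_lt_const (by positivity : 0 < η / 4))
  refine ⟨max n₁ n₂, fun n hn => ?_⟩
  rw [Real.dist_eq, sub_zero, abs_of_nonneg (integral_nonneg fun ω => abs_nonneg _)]
  have hd1 : ∀ i, Integrable (fun ω => |K i ω - Z i ω|) P := fun i => ((hKi i).sub (hZint i)).abs
  have hI1 : Integrable (fun ω => (n : ℝ)⁻¹ * ∑ i ∈ Finset.range n, |K i ω - Z i ω|) P :=
    (integrable_finsetSum _ fun i _ => hd1 i).const_mul _
  have hI2 : Integrable (fun ω =>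
      |(n : ℝ)⁻¹ * ∑ i ∈ Finset.range n, (Z i ω - ∫ ω, Z i ω ∂P)|) P :=
    ((integrable_finsetSum _ fun i _ => (hZint i).sub (integrable_const _)).const_mul _).abs
  have hI0 : Integrable (fun ω => |(n : ℝ)⁻¹ * ∑ i ∈ Finset.range n, K i ω - c|) P :=
    (((integrable_finsetSum _ fun i _ => hKi i).const_mul _).sub (integrable_const _)).abs
  have havg {u : ℕ → ℝ} (hu : ∀ i, u i ≤ η / 4) :
      (n : ℝ)⁻¹ * ∑ i ∈ Finset.range n, u i ≤ η / 4 := by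
    rcases eq_or_ne (n : ℝ) 0 with h | h
    · simp [h]; positivity
    · calc _ ≤ (n : ℝ)⁻¹ * ∑ i ∈ Finset.range n, η / 4 := by gcongr; exact hu _
        _ = η / 4 := by simp; field_simp
  have hE (i : ℕ) : |∫ ω, Z i ω ∂P - ∫ ω, K i ω ∂P| ≤ η / 4 := by
    rw [abs_sub_comm, ← integral_sub (hKi i) (hZint i)]
    exact abs_integral_le_integral_abs.trans (hKZ i)
  have hE' := havg hE
  calc ∫ ω, |(n : ℝ)⁻¹ * ∑ i ∈ Finset.range n, K i ω - c| ∂P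
      ≤ ∫ ω, ((n : ℝ)⁻¹ * ∑ i ∈ Finset.range n, |K i ω - Z i ω| +
        |(n : ℝ)⁻¹ * ∑ i ∈ Finset.range n, (Z i ω - ∫ ω, Z i ω ∂P)| + (η / 4 +
          |(n : ℝ)⁻¹ * ∑ i ∈ Finset.range n, ∫ ω, K i ω ∂P - c|)) ∂P := by
        refine integral_mono hI0 ((hI1.add hI2).add (integrable_const _)) fun ω => ?_
        -- Four errors, each at most η/4 in mean: replacing K by Z, the fluctuation of Z, replacing
        -- the means of Z by those of K, and the Cesàro average of the latter against c.
        have e : (n : ℝ)⁻¹ * ∑ i ∈ Finset.range n, K i ω - c =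
            (n : ℝ)⁻¹ * ∑ i ∈ Finset.range n, (K i ω - Z i ω) +
            (n : ℝ)⁻¹ * ∑ i ∈ Finset.range n, (Z i ω - ∫ ω, Z i ω ∂P) +
            (n : ℝ)⁻¹ * ∑ i ∈ Finset.range n, (∫ ω, Z i ω ∂P - ∫ ω, K i ω ∂P) +
            ((n : ℝ)⁻¹ * ∑ i ∈ Finset.range n, ∫ ω, K i ω ∂P - c) := by
          simp only [Finset.sum_sub_distrib]; ring
        have hs (u : ℕ → ℝ) : |(n : ℝ)⁻¹ * ∑ i ∈ Finset.range n, u i| ≤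
            (n : ℝ)⁻¹ * ∑ i ∈ Finset.range n, |u i| := by
          rw [abs_mul, abs_of_nonneg (by positivity : (0 : ℝ) ≤ (n : ℝ)⁻¹)]
          gcongr
          exact Finset.abs_sum_le_sum_abs _ _
        rw [e]
        have a1 := hs fun i => K i ω - Z i ω
        have a2 := hs fun i => ∫ ω, Z i ω ∂P - ∫ ω, K i ω ∂P
        refine (abs_add_le _ _).trans ?_
        have a3 := abs_add_three ((n : ℝ)⁻¹ * ∑ i ∈ Finset.range n, (K i ω - Z i ω))
          ((n : ℝ)⁻¹ * ∑ i ∈ Finset.range n, (Z i ω - ∫ ω, Z i ω ∂P))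
          ((n : ℝ)⁻¹ * ∑ i ∈ Finset.range n, (∫ ω, Z i ω ∂P - ∫ ω, K i ω ∂P))
        linarith
    _ = (n : ℝ)⁻¹ * ∑ i ∈ Finset.range n, ∫ ω, |K i ω - Z i ω| ∂P +
        ∫ ω, |(n : ℝ)⁻¹ * ∑ i ∈ Finset.range n, (Z i ω - ∫ ω, Z i ω ∂P)| ∂P + (η / 4 +
          |(n : ℝ)⁻¹ * ∑ i ∈ Finset.range n, ∫ ω, K i ω ∂P - c|) := by
        refine (integral_add (hI1.add hI2) (integrable_const _)).trans ?_
        refine congrArg₂ (· + ·) ((integral_add hI1 hI2).trans ?_) (by simp)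
        rw [integral_const_mul, integral_finsetSum _ fun i _ => hd1 i]
    _ < η := by
        have := havg hKZ
        linarith [hn₁ n (le_of_max_le_left hn), hn₂ n (le_of_max_le_right hn)]

/-- A bounded continuous function maps variables which are close in probability to variables which
are close in mean, uniformly on tight families. -/
lemma exists_integral_abs_comp_sub_le (P : Measure Ω) [IsProbabilityMeasure P] (k : ℝ →ᵇ ℝ)
    {C : ℝ≥0∞} (hC : C ≠ ∞) {η : ℝ} (hη : 0 < η) :
    ∃ δ > 0, ∀ X Y : Ω → ℝ, Measurable X → Measurable Y → ∫⁻ ω, ‖Y ω‖ₑ ∂P ≤ C →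
      P {ω | δ ≤ |X ω - Y ω|} ≤ ENNReal.ofReal δ → ∫ ω, |k (X ω) - k (Y ω)| ∂P ≤ η := by
  -- By Markov's inequality |Y| ≥ R has probability at most C/R. The summand 1 in the witness only
  -- keeps R positive.
  obtain ⟨R, hR0, hR⟩ : ∃ R : ℝ, 0 < R ∧ 2 * ‖k‖ * (C.toReal / R) ≤ η / 3 := by
    refine ⟨6 * ‖k‖ * C.toReal / η + 1, by positivity, ?_⟩
    have h : 0 < 6 * ‖k‖ * C.toReal / η + 1 := by positivity
    rw [mul_div_assoc', div_le_iff₀ h]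
    have : η / 3 * (6 * ‖k‖ * C.toReal / η + 1) = 2 * ‖k‖ * C.toReal + η / 3 := by
      field_simp; ring
    rw [this]
    linarith
  -- The margin 1 keeps X in the compact interval when |Y| < R and |X - Y| < δ ≤ 1.
  have huc := isCompact_Icc (a := -(R + 1)) (b := R + 1) |>.uniformContinuousOn_of_continuous
    k.continuous.continuousOn
  obtain ⟨δ₁, hδ₁, hk⟩ := Metric.uniformContinuousOn_iff.1 huc (η / 3) (by positivity)
  obtain ⟨δ, hδ, hδ1, hδ2, hδ3⟩ : ∃ δ > 0, δ ≤ δ₁ ∧ δ ≤ 1 ∧ 2 * ‖k‖ * δ ≤ η / 3 := by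
    refine ⟨min δ₁ (min 1 (η / (6 * ‖k‖ + 1))), by positivity, min_le_left _ _,
      (min_le_right _ _).trans (min_le_left _ _), ?_⟩
    calc _ ≤ 2 * ‖k‖ * (η / (6 * ‖k‖ + 1)) := by
          gcongr; exact (min_le_right _ _).trans (min_le_right _ _)
      _ ≤ η / 3 := by
          rw [mul_div_assoc', div_le_iff₀ (by positivity)]
          nlinarith [norm_nonneg k]
  refine ⟨δ, hδ, fun X Y hX hY hYC hXY => ?_⟩
  let S : Set Ω := {ω | δ ≤ |X ω - Y ω|}
  let T : Set Ω := {ω | ENNReal.ofReal R ≤ ‖Y ω‖ₑ}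
  have hS : MeasurableSet S := measurableSet_le measurable_const (hX.sub hY).abs
  have hT : MeasurableSet T := measurableSet_le measurable_const hY.enorm
  have hPS : P.real S ≤ δ := ENNReal.toReal_le_of_le_ofReal hδ.le hXY
  have hPT : P.real T ≤ C.toReal / R := by
    have h := (meas_ge_le_lintegral_div (μ := P) hY.enorm.aemeasurable
      (ε := ENNReal.ofReal R) (by simpa using hR0) ENNReal.ofReal_ne_top).trans
      (ENNReal.div_le_div_right hYC _)
    have h' := ENNReal.toReal_mono (ENNReal.div_ne_top hC (by simpa using hR0)) h
    rwa [ENNReal.toReal_div, ENNReal.toReal_ofReal hR0.le] at h'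
  have hkm : Measurable k := k.continuous.measurable
  have hint : Integrable (fun ω => |k (X ω) - k (Y ω)|) P := by
    refine (integrable_const (2 * ‖k‖)).mono'
      ((hkm.comp hX).sub (hkm.comp hY)).abs.aestronglyMeasurable (ae_of_all _ fun ω => ?_)
    rw [Real.norm_eq_abs, abs_abs, two_mul]
    exact (abs_sub _ _).trans (add_le_add (k.norm_coe_le_norm _) (k.norm_coe_le_norm _))
  have hi1 : Integrable (S.indicator fun _ => 2 * ‖k‖) P := (integrable_const _).indicator hS
  have hi2 : Integrable (T.indicator fun _ => 2 * ‖k‖) P := (integrable_const _).indicator hT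
  calc ∫ ω, |k (X ω) - k (Y ω)| ∂P
      ≤ ∫ ω, (η / 3 +
          (S.indicator (fun _ => 2 * ‖k‖) ω + T.indicator (fun _ => 2 * ‖k‖) ω)) ∂P := by
        refine integral_mono hint ((integrable_const _).add (hi1.add hi2)) fun ω => ?_
        have hk0 : 0 ≤ 2 * ‖k‖ := by positivity
        have hb : |k (X ω) - k (Y ω)| ≤ 2 * ‖k‖ := by
          rw [two_mul]
          exact (abs_sub _ _).trans (add_le_add (k.norm_coe_le_norm _) (k.norm_coe_le_norm _))
        have n1 : 0 ≤ S.indicator (fun _ => 2 * ‖k‖) ω := indicator_nonneg (fun _ _ => hk0) _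
        have n2 : 0 ≤ T.indicator (fun _ => 2 * ‖k‖) ω := indicator_nonneg (fun _ _ => hk0) _
        by_cases hωS : ω ∈ S
        · rw [indicator_of_mem hωS]; linarith
        by_cases hωT : ω ∈ T
        · rw [indicator_of_mem hωT]; linarith
        have h1 : |X ω - Y ω| < δ := not_le.1 hωS
        have h2 : |Y ω| < R := by
          have h : ‖Y ω‖ₑ < ENNReal.ofReal R := not_le.1 hωT
          rw [← ofReal_norm] at h
          exact (ENNReal.ofReal_lt_ofReal_iff hR0).1 h
        have h3 := abs_lt.1 h1
        have h4 := abs_lt.1 h2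
        have h5 := hk (X ω) ⟨by linarith, by linarith⟩ (Y ω) ⟨by linarith, by linarith⟩
          (by rw [Real.dist_eq]; linarith)
        rw [Real.dist_eq] at h5
        linarith
    _ = η / 3 + (P.real S * (2 * ‖k‖) + P.real T * (2 * ‖k‖)) := by
        refine (integral_add (integrable_const _) (hi1.add hi2)).trans ?_
        refine congrArg₂ (· + ·) (by simp) ((integral_add hi1 hi2).trans ?_)
        rw [integral_indicator_const _ hS, integral_indicator_const _ hT, smul_eq_mul, smul_eq_mul]
    _ ≤ η / 3 + (δ * (2 * ‖k‖) + C.toReal / R * (2 * ‖k‖)) := by gcongr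
    _ ≤ η := by linarith

end WeakLaw

/-! ### Laws of large numbers for shot noise -/

section ShotNoise

variable {Ω : Type*} [MeasurableSpace Ω] {P : Measure Ω} {N : ℝ≥0 → Ω → ℕ}

lemma CountingPath.integral_comp_sub_eq_setIntegral (p : CountingPath) {f : ℝ → ℝ}
    (hf0 : ∀ u ≤ 0, f u = 0) (c : ℝ) :
    ∫ r, f (c - r) ∂p.jumps = ∫ r in Ioc 0 c, f (c - r) ∂p.jumps := by
  conv_lhs => rw [← p.jumps_restrict_Ioi]
  refine setIntegral_eq_of_subset_of_forall_sdiff_eq_zero measurableSet_Ioi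
    Ioc_subset_Ioi_self fun r hr => hf0 _ ?_
  by_contra h
  exact hr.2 ⟨hr.1, by linarith⟩

lemma lintegral_enorm_comp_sub_le (f : ℝ → ℝ) (c : ℝ) :
    ∫⁻ r in Ioi 0, ‖f (c - r)‖ₑ ≤ ∫⁻ u, ‖f u‖ₑ :=
  (setLIntegral_le_lintegral _ _).trans
    (lintegral_sub_left_eq_self (fun u => ‖f u‖ₑ) c).le

lemma IsStandardPoisson.lintegral_enorm_shotNoise_le (hN : IsStandardPoisson N P) {f : ℝ → ℝ}
    (hf : Measurable f) (c : ℝ) :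
    ∫⁻ ω, ‖∫ r, f (c - r) ∂(hN.path ω).jumps‖ₑ ∂P ≤ ∫⁻ u, ‖f u‖ₑ := by
  refine le_trans ?_ (lintegral_enorm_comp_sub_le f c)
  rw [← hN.lintegral_jumps (H := fun r => ‖f (c - r)‖ₑ) (hf.comp (by fun_prop)).enorm]
  exact lintegral_mono fun ω => enorm_integral_le_lintegral_enorm _

/-- The mean of a bounded continuous function of shot noise converges to its stationary value. -/
lemma IsStandardPoisson.tendsto_integral_comp_shotNoise [IsProbabilityMeasure P]
    (hN : IsStandardPoisson N P) {f : ℝ → ℝ} (hf : Measurable f) (hfi : Integrable f)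
    (hf0 : ∀ u ≤ 0, f u = 0) {c : ℕ → ℝ} (hc0 : ∀ i, 0 ≤ c i) (hc : Tendsto c atTop atTop)
    (hcm : Monotone c) (k : ℝ →ᵇ ℝ) :
    Tendsto (fun i => ∫ ω, k (∫ r, f (c i - r) ∂(hN.path ω).jumps) ∂P) atTop
      (𝓝 (∫ ω, k (∫ r, f r ∂(hN.path ω).jumps) ∂P)) := by
  have hmeas (i : ℕ) : Measurable fun ω => ∫ r in Ioc 0 (c i), f r ∂(hN.path ω).jumps := by
    simp_rw [← integral_indicator measurableSet_Ioc]
    exact hN.measurable_integral (hf.indicator measurableSet_Ioc)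
  have hmeas' (i : ℕ) : Measurable fun ω => ∫ r in Ioc 0 (c i), f (c i - r) ∂(hN.path ω).jumps := by
    simp_rw [← integral_indicator measurableSet_Ioc]
    exact hN.measurable_integral ((hf.comp (by fun_prop)).indicator measurableSet_Ioc)
  -- Time reversal replaces f(c - r) by f(r) without changing the law. The reversed integrals
  -- converge for almost every path as the interval grows, whereas the original ones have no reason
  -- to.
  have hlaw (i : ℕ) : ∫ ω, k (∫ r, f (c i - r) ∂(hN.path ω).jumps) ∂P =
      ∫ ω, k (∫ r in Ioc 0 (c i), f r ∂(hN.path ω).jumps) ∂P := by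
    simp_rw [fun ω => (hN.path ω).integral_comp_sub_eq_setIntegral hf0 (c i)]
    rw [← integral_map (hmeas' i).aemeasurable k.continuous.aestronglyMeasurable,
      hN.map_integral_reverse hf hfi.integrableOn (hc0 i),
      integral_map (hmeas i).aemeasurable k.continuous.aestronglyMeasurable]
  simp_rw [hlaw]
  refine tendsto_integral_of_dominated_convergence (fun _ => ‖k‖)
    (fun i => (k.continuous.measurable.comp (hmeas i)).aestronglyMeasurable) (integrable_const _)
    (fun i => ae_of_all _ fun ω => k.norm_coe_le_norm _) ?_
  filter_upwards [hN.ae_integrable hf hfi.integrableOn] with ω h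
  refine (k.continuous.tendsto _).comp ?_
  have h1 := tendsto_setIntegral_of_monotone (μ := (hN.path ω).jumps) (f := f)
    (s := fun i => Ioc 0 (c i)) (fun i => measurableSet_Ioc)
    (fun i j hij => Ioc_subset_Ioc_right (hcm hij)) h.integrableOn
  have h2 : ⋃ i, Ioc 0 (c i) = Ioi 0 := by
    refine subset_antisymm (iUnion_subset fun i => Ioc_subset_Ioi_self) fun r hr => ?_
    obtain ⟨i, hi⟩ := (hc.eventually_ge_atTop r).exists
    exact mem_iUnion.2 ⟨i, hr, hi⟩
  rwa [h2, (hN.path ω).jumps_restrict_Ioi] at h1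

lemma tendsto_lintegral_enorm_sub_indicator_Iio {f : ℝ → ℝ} (hfi : Integrable f)
    {d : ℝ} (hd : 0 < d) :
    Tendsto (fun m : ℕ => ∫⁻ u, ‖f u - (Iio (m * d)).indicator f u‖ₑ) atTop (𝓝 0) := by
  have h := tendsto_lintegral_of_dominated_convergence' (μ := volume) (fun u => ‖f u‖ₑ)
    (F := fun (m : ℕ) u => ‖f u - (Iio (m * d)).indicator f u‖ₑ) (f := fun _ => 0)
    (fun m => (hfi.1.sub (hfi.1.indicator measurableSet_Iio)).enorm)
    (fun m => ae_of_all _ fun u => ?_) hfi.2.ne (ae_of_all _ fun u => ?_)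
  · simpa using h
  · by_cases hu : u ∈ Iio (m * d)
    · simp [indicator_of_mem hu]
    · simp [indicator_of_notMem hu]
  · refine tendsto_const_nhds.congr' ?_
    filter_upwards [(tendsto_natCast_atTop_atTop.atTop_mul_const hd).eventually_gt_atTop u]
      with m hm
    simp [indicator_of_mem (show u ∈ Iio (m * d) from hm)]

/-- The law of large numbers in mean for bounded continuous functions of shot noise. -/
theorem IsStandardPoisson.tendsto_average_shotNoise [IsProbabilityMeasure P]
    (hN : IsStandardPoisson N P) {f : ℝ → ℝ} (hf : Measurable f) (hfi : Integrable f)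
    (hf0 : ∀ u ≤ 0, f u = 0) {d : ℝ} (hd : 0 < d) (k : ℝ →ᵇ ℝ) :
    Tendsto (fun n : ℕ => ∫ ω, |(n : ℝ)⁻¹ * ∑ i ∈ Finset.range n,
      k (∫ r, f ((i + 1 : ℕ) * d - r) ∂(hN.path ω).jumps) -
        ∫ ω, k (∫ r, f r ∂(hN.path ω).jumps) ∂P| ∂P) atTop (𝓝 0) := by
  have hshift {g : ℝ → ℝ} (hg : Measurable g) (c : ℝ) : Measurable fun r => g (c - r) :=
    hg.comp (by fun_prop)
  have hkm : Measurable k := k.continuous.measurable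
  refine tendsto_integral_abs_average_sub_of_approx (B := ‖k‖)
    (fun i => hkm.comp (hN.measurable_integral (hshift hf _)))
    (fun i ω => k.norm_coe_le_norm _) (fun η hη => ?_) ?_
  · obtain ⟨δ, hδ, hδk⟩ := exists_integral_abs_comp_sub_le P k hfi.2.ne hη
    -- The tolerance is δ² because Markov's inequality will divide it by δ.
    obtain ⟨m, hm⟩ := ((tendsto_lintegral_enorm_sub_indicator_Iio hfi hd).eventually_le_const
      (by simpa using hδ : 0 < ENNReal.ofReal δ * ENNReal.ofReal δ)).exists
    -- Cutting off the memory after m sampling periods: the i-th variable then sees only the jumps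
    -- of the preceding window of length md.
    let g : ℝ → ℝ := (Iio (m * d)).indicator f
    have hg : Measurable g := hf.indicator measurableSet_Iio
    have hgi : Integrable g := hfi.indicator measurableSet_Iio
    refine ⟨m, fun i ω => k (∫ r, g ((i + 1 : ℕ) * d - r) ∂(hN.path ω).jumps),
      fun i => hkm.comp (hN.measurable_integral (hshift hg _)), fun i ω => k.norm_coe_le_norm _,
      fun i j hij => ?_, fun i => ?_⟩
    · refine (hN.indepFun_integral (hshift hg _) (hgi.comp_sub_left _).integrableOn (hshift hg _)
        (hgi.comp_sub_left _).integrableOn fun r => ?_).comp hkm hkm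
      -- A jump at or after the i-th sampling time is not yet seen by the first integral; an earlier
      -- one is more than m periods old for the second.
      rcases le_or_gt ((i + 1 : ℕ) * d) r with h | h
      · left
        simp only [g]
        rw [indicator_apply_eq_zero]
        exact fun _ => hf0 _ (by linarith)
      · right
        simp only [g]
        refine indicator_of_notMem ?_ _
        rw [mem_Iio, not_lt]
        have h1 : ((i + 1 : ℕ) : ℝ) + m ≤ (j + 1 : ℕ) := by exact_mod_cast (by omega)
        nlinarith
    · refine hδk _ _ (hN.measurable_integral (hshift hf _)) (hN.measurable_integral (hshift hg _))
        ((hN.lintegral_enorm_shotNoise_le hg _).trans (lintegral_mono fun u => ?_)) ?_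
      · simp only [g]
        exact enorm_indicator_le_enorm_self f u
      · let c : ℝ := (i + 1 : ℕ) * d
        have h1 := meas_ge_le_lintegral_div (μ := P) (f := fun ω =>
          ‖(∫ r, f (c - r) ∂(hN.path ω).jumps) - ∫ r, g (c - r) ∂(hN.path ω).jumps‖ₑ)
          ((hN.measurable_integral (hshift hf _)).sub
            (hN.measurable_integral (hshift hg _))).enorm.aemeasurable
          (ε := ENNReal.ofReal δ) (by simpa using hδ) ENNReal.ofReal_ne_top
        refine le_trans (le_trans (measure_mono fun ω hω => ?_) h1) ?_
        · rw [mem_ofPred_eq, ← ofReal_norm]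
          exact ENNReal.ofReal_le_ofReal hω
        · refine ENNReal.div_le_of_le_mul (le_trans ?_ hm)
          refine (hN.lintegral_enorm_integral_sub_le (hshift hf c)
            (hfi.comp_sub_left c).integrableOn (hshift hg c)
            (hgi.comp_sub_left c).integrableOn).trans ?_
          exact lintegral_enorm_comp_sub_le (fun u => f u - g u) c
  · refine hN.tendsto_integral_comp_shotNoise hf hfi hf0 (c := fun i => (i + 1 : ℕ) * d)
      (fun i => by positivity) ?_ (fun i j hij => ?_) k
    · exact (tendsto_natCast_atTop_atTop.comp (tendsto_add_atTop_nat 1)).atTop_mul_const hd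
    · have : ((i + 1 : ℕ) : ℝ) ≤ (j + 1 : ℕ) := by exact_mod_cast (by omega)
      simp only
      gcongr

end ShotNoise

/-! ### Convergence in mean of noisy sample moments -/

section Noise

variable {Ω : Type*} [MeasurableSpace Ω] {P : Measure Ω}

/-- `A n` converges in `L¹(P)` to the constant `c`. -/
structure TendstoInMean (P : Measure Ω) (A : ℕ → Ω → ℝ) (c : ℝ) : Prop where
  integrable : ∀ n, Integrable (A n) P
  tendsto : Tendsto (fun n => ∫ ω, |A n ω - c| ∂P) atTop (𝓝 0)

lemma TendstoInMean.congr_ae {A B : ℕ → Ω → ℝ} {c : ℝ} (hA : TendstoInMean P A c)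
    (h : ∀ n, A n =ᵐ[P] B n) : TendstoInMean P B c where
  integrable n := (hA.integrable n).congr (h n)
  tendsto := hA.tendsto.congr fun n => integral_congr_ae ((h n).mono fun ω h => by
    simp only [h])

lemma TendstoInMean.add [IsFiniteMeasure P] {A B : ℕ → Ω → ℝ} {c d : ℝ} (hA : TendstoInMean P A c)
    (hB : TendstoInMean P B d) : TendstoInMean P (fun n ω => A n ω + B n ω) (c + d) where
  integrable n := (hA.integrable n).add (hB.integrable n)
  tendsto := by
    have hlim := hA.tendsto.add hB.tendsto
    rw [add_zero] at hlim
    refine squeeze_zero (fun n => integral_nonneg fun ω => abs_nonneg _) (fun n => ?_) hlim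
    have h1 := ((hA.integrable n).sub (integrable_const c)).abs
    have h2 := ((hB.integrable n).sub (integrable_const d)).abs
    refine le_trans (integral_mono (((hA.integrable n).add (hB.integrable n)).sub
      (integrable_const _)).abs (h1.add h2) fun ω => ?_) (integral_add h1 h2).le
    simp only [Pi.sub_apply, Pi.add_apply]
    rw [add_sub_add_comm]
    exact abs_add_le _ _

lemma TendstoInMean.average {u : ℕ → Ω → ℝ} (hu : TendstoInMean P u 0) :
    TendstoInMean P (fun n ω => (n : ℝ)⁻¹ * ∑ i ∈ Finset.range n, u i ω) 0 where
  integrable n := (integrable_finsetSum _ fun i _ => hu.integrable i).const_mul _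
  tendsto := by
    have hlim := hu.tendsto.cesaro
    simp only [sub_zero] at hlim ⊢
    refine squeeze_zero (fun n => integral_nonneg fun ω => abs_nonneg _) (fun n => ?_) hlim
    have h1 (i : ℕ) := (hu.integrable i).abs
    rw [← integral_finsetSum _ fun i _ => h1 i, ← integral_const_mul]
    refine integral_mono ((integrable_finsetSum _ fun i _ => hu.integrable i).const_mul _).abs
      ((integrable_finsetSum _ fun i _ => h1 i).const_mul _) fun ω => ?_
    simp only
    rw [abs_mul, abs_of_nonneg (by positivity : (0 : ℝ) ≤ (n : ℝ)⁻¹)]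
    gcongr
    exact Finset.abs_sum_le_sum_abs _ _

lemma tendstoInMean_average_of_covariance_eq_zero [IsProbabilityMeasure P] {Z : ℕ → Ω → ℝ}
    (hZ : ∀ i, MemLp (Z i) 2 P) {V c : ℝ} (hV : ∀ i, Var[Z i; P] ≤ V)
    (hcov : ∀ i j, i < j → cov[Z i, Z j; P] = 0) (hc : ∀ i, ∫ ω, Z i ω ∂P = c) :
    TendstoInMean P (fun n ω => (n : ℝ)⁻¹ * ∑ i ∈ Finset.range n, Z i ω) c where
  integrable n :=
    (integrable_finsetSum _ fun i _ => (hZ i).integrable one_le_two).const_mul _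
  tendsto := by
    have h := tendsto_integral_abs_average_sub hZ hV (m := 1) hcov
    refine h.congr' ?_
    filter_upwards [eventually_ne_atTop 0] with n hn
    refine integral_congr_ae (ae_of_all _ fun ω => ?_)
    simp only [Finset.sum_sub_distrib, hc, Finset.sum_const, Finset.card_range, nsmul_eq_mul,
      mul_sub]
    rw [inv_mul_cancel_left₀ (by exact_mod_cast hn)]

lemma memLp_of_hasLaw_gaussianReal {X : Ω → ℝ} (hX : HasLaw X (gaussianReal 0 1) P) (p : ℝ≥0) :
    MemLp X p P := by
  have h := memLp_id_gaussianReal (μ := 0) (v := 1) p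
  rw [← hX.map_eq, memLp_map_measure_iff aestronglyMeasurable_id hX.aemeasurable] at h
  exact h

lemma integral_sq_of_hasLaw_gaussianReal {X : Ω → ℝ} (hX : HasLaw X (gaussianReal 0 1) P) :
    ∫ ω, X ω ^ 2 ∂P = 1 := by
  have h := hX.variance_eq
  rw [variance_id_gaussianReal, variance_of_integral_eq_zero hX.aemeasurable] at h
  · simpa using h
  · rw [hX.integral_eq, integral_id_gaussianReal]

lemma memLp_sq_of_hasLaw_gaussianReal {X : Ω → ℝ} (hX : HasLaw X (gaussianReal 0 1) P) :
    MemLp (fun ω => X ω ^ 2) 2 P := by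
  rw [memLp_two_iff_integrable_sq (hX.aemeasurable.pow_const 2).aestronglyMeasurable]
  have h := (memLp_of_hasLaw_gaussianReal hX 4).integrable_norm_pow (p := 4) (by norm_num)
  refine h.congr (ae_of_all _ fun ω => ?_)
  simp only [Real.norm_eq_abs]
  rw [← pow_mul, ← abs_pow, abs_of_nonneg (by positivity)]

variable [IsProbabilityMeasure P] {ε : ℕ → Ω → ℝ}

lemma tendstoInMean_average_noise (hε : ∀ i, HasLaw (ε i) (gaussianReal 0 1) P)
    (hind : iIndepFun ε P) :
    TendstoInMean P (fun n ω => (n : ℝ)⁻¹ * ∑ i ∈ Finset.range n, ε i ω) 0 := by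
  have h2 (i : ℕ) : MemLp (ε i) 2 P := memLp_of_hasLaw_gaussianReal (hε i) 2
  refine tendstoInMean_average_of_covariance_eq_zero h2 (V := 1) (fun i => ?_)
    (fun i j hij => (hind.indepFun hij.ne).covariance_eq_zero (h2 i) (h2 j)) fun i => ?_
  · rw [(hε i).variance_eq, variance_id_gaussianReal]; simp
  · rw [(hε i).integral_eq, integral_id_gaussianReal]

lemma tendstoInMean_average_sq_noise (hε : ∀ i, HasLaw (ε i) (gaussianReal 0 1) P)
    (hind : iIndepFun ε P) :
    TendstoInMean P (fun n ω => (n : ℝ)⁻¹ * ∑ i ∈ Finset.range n, ε i ω ^ 2) 1 := by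
  have h2 (i : ℕ) := memLp_sq_of_hasLaw_gaussianReal (hε i)
  have hsq : Measurable fun x : ℝ => x ^ 2 := by fun_prop
  refine tendstoInMean_average_of_covariance_eq_zero h2
    (V := Var[fun x => x ^ 2; gaussianReal 0 1]) (fun i => ?_)
    (fun i j hij => ((hind.indepFun hij.ne).comp hsq hsq).covariance_eq_zero (h2 i) (h2 j))
    fun i => integral_sq_of_hasLaw_gaussianReal (hε i)
  rw [← (hε i).map_eq, variance_map (by fun_prop) (hε i).aemeasurable]
  rfl

/-- Independence from the noise makes the products centred and pairwise uncorrelated, however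
dependent the W are among themselves. -/
lemma tendstoInMean_average_mul_noise (hε : ∀ i, HasLaw (ε i) (gaussianReal 0 1) P)
    (hind : iIndepFun ε P) {W : ℕ → Ω → ℝ} (hW : ∀ i, Measurable (W i)) {B : ℝ}
    (hB : ∀ i ω, |W i ω| ≤ B) (hWε : IndepFun (fun ω i => W i ω) (fun ω i => ε i ω) P) :
    TendstoInMean P (fun n ω => (n : ℝ)⁻¹ * ∑ i ∈ Finset.range n, W i ω * ε i ω) 0 := by
  have hε2 (i : ℕ) : MemLp (ε i) 2 P := memLp_of_hasLaw_gaussianReal (hε i) 2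
  have hε0 (i : ℕ) : ∫ ω, ε i ω ∂P = 0 := by
    rw [(hε i).integral_eq, integral_id_gaussianReal]
  have hB0 : 0 ≤ B := by
    obtain ⟨ω⟩ := P.nonempty_of_neZero
    exact (abs_nonneg _).trans (hB 0 ω)
  have h2 (i : ℕ) : MemLp (fun ω => W i ω * ε i ω) 2 P := by
    refine ((hε2 i).const_mul B).mono
      ((hW i).aestronglyMeasurable.mul (hε2 i).aestronglyMeasurable) (ae_of_all _ fun ω => ?_)
    rw [norm_mul, norm_mul, Real.norm_of_nonneg hB0]
    exact mul_le_mul_of_nonneg_right (hB i ω) (norm_nonneg _)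
  have hmean (i : ℕ) : ∫ ω, W i ω * ε i ω ∂P = 0 := by
    have := (hWε.comp (φ := fun w : ℕ → ℝ => w i) (ψ := fun w : ℕ → ℝ => w i) (by fun_prop)
      (by fun_prop)).integral_fun_mul_eq_mul_integral (hW i).aestronglyMeasurable
      (hε2 i).aestronglyMeasurable
    simp only [Function.comp_apply, hε0, mul_zero] at this
    exact this
  refine tendstoInMean_average_of_covariance_eq_zero h2 (V := B ^ 2) (fun i => ?_)
    (fun i j hij => ?_) hmean
  · refine (variance_le_expectation_sq (h2 i).aestronglyMeasurable).trans ?_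
    calc _ ≤ ∫ ω, B ^ 2 * ε i ω ^ 2 ∂P := by
          refine integral_mono (h2 i).integrable_sq ((hε2 i).integrable_sq.const_mul _) fun ω => ?_
          simp only [Pi.pow_apply, mul_pow]
          refine mul_le_mul_of_nonneg_right ?_ (sq_nonneg _)
          rw [← sq_abs]
          have := hB i ω
          gcongr
      _ = B ^ 2 := by
          rw [integral_const_mul, integral_sq_of_hasLaw_gaussianReal (hε i), mul_one]
  · rw [covariance_eq_sub (h2 i) (h2 j), hmean i, zero_mul, sub_zero]
    have h1 := (hWε.comp (φ := fun w : ℕ → ℝ => w i * w j) (ψ := fun w : ℕ → ℝ => w i * w j)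
      (by fun_prop) (by fun_prop)).integral_fun_mul_eq_mul_integral
      ((hW i).mul (hW j)).aestronglyMeasurable
      ((hε2 i).aestronglyMeasurable.mul (hε2 j).aestronglyMeasurable)
    have h3 := (hind.indepFun hij.ne).integral_fun_mul_eq_mul_integral
      (hε2 i).aestronglyMeasurable (hε2 j).aestronglyMeasurable
    simp only [Function.comp_apply] at h1 h3
    rw [h3, hε0, zero_mul, mul_zero] at h1
    refine Eq.trans (integral_congr_ae (ae_of_all _ fun ω => ?_)) h1
    simp only [Pi.mul_apply]
    ring

/-- The inequality |Dε| ≤ (B/η)|D| + (η/2)ε² replaces independence. This matters because D will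
carry the effect of the initial measure, which is not assumed independent of the noise. -/
lemma TendstoInMean.mul_noise (hε : ∀ i, HasLaw (ε i) (gaussianReal 0 1) P) {D : ℕ → Ω → ℝ}
    (hD : TendstoInMean P D 0) {B : ℝ} (hB : ∀ i ω, |D i ω| ≤ B) :
    TendstoInMean P (fun i ω => D i ω * ε i ω) 0 := by
  have hε2 (i : ℕ) : MemLp (ε i) 2 P := memLp_of_hasLaw_gaussianReal (hε i) 2
  have hint (i : ℕ) : Integrable (fun ω => D i ω * ε i ω) P := by
    refine ((hε2 i).integrable one_le_two).bdd_mul (c := B) (hD.integrable i).1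
      (ae_of_all _ fun ω => hB i ω)
  refine ⟨hint, ?_⟩
  have hD' := hD.tendsto
  simp only [sub_zero] at hD' ⊢
  refine Metric.tendsto_atTop.2 fun η hη => ?_
  have hlim := hD'.const_mul (B / η)
  rw [mul_zero] at hlim
  obtain ⟨n₀, hn₀⟩ := eventually_atTop.1 (hlim.eventually_lt_const (by positivity : 0 < η / 2))
  refine ⟨n₀, fun n hn => ?_⟩
  rw [Real.dist_eq, sub_zero, abs_of_nonneg (integral_nonneg fun ω => abs_nonneg _)]
  have i1 : Integrable (fun ω => B / η * |D n ω|) P := (hD.integrable n).abs.const_mul _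
  have i2 : Integrable (fun ω => η / 2 * ε n ω ^ 2) P := (hε2 n).integrable_sq.const_mul _
  calc ∫ ω, |D n ω * ε n ω| ∂P ≤ ∫ ω, (B / η * |D n ω| + η / 2 * ε n ω ^ 2) ∂P := by
        refine integral_mono (hint n).abs (i1.add i2) fun ω => ?_
        simp only
        have h1 : |D n ω| * |D n ω| ≤ B * |D n ω| :=
          mul_le_mul_of_nonneg_right (hB n ω) (abs_nonneg _)
        have h2 : η * |D n ω * ε n ω| ≤ η * (B / η * |D n ω| + η / 2 * ε n ω ^ 2) := by
          have e : η * (B / η * |D n ω| + η / 2 * ε n ω ^ 2) =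
            B * |D n ω| + η ^ 2 / 2 * |ε n ω| ^ 2 := by rw [sq_abs]; field_simp
          rw [e, abs_mul]
          nlinarith [sq_nonneg (|D n ω| - η * |ε n ω|), sq_nonneg (|D n ω|)]
        exact le_of_mul_le_mul_left h2 hη
    _ = B / η * ∫ ω, |D n ω| ∂P + η / 2 := by
        refine (integral_add i1 i2).trans ?_
        rw [integral_const_mul, integral_const_mul, integral_sq_of_hasLaw_gaussianReal (hε n),
          mul_one]
    _ < η := by linarith [hn₀ n hn]

/-- Sample moments of noisy observations of `h (X i)`, when `X i` is close to a sequence `S i` that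
is independent of the noise and obeys the law of large numbers. -/
theorem tendstoInMean_average_observation (hε : ∀ i, HasLaw (ε i) (gaussianReal 0 1) P)
    (hind : iIndepFun ε P) {X S : ℕ → Ω → ℝ} (h : ℝ →ᵇ ℝ) (hS : ∀ i, Measurable (S i))
    (hSε : IndepFun (fun ω i => S i ω) (fun ω i => ε i ω) P)
    (hXS : TendstoInMean P (fun i ω => h (X i ω) - h (S i ω)) 0) {c₁ c₂ : ℝ}
    (h₁ : TendstoInMean P (fun n ω => (n : ℝ)⁻¹ * ∑ i ∈ Finset.range n, h (S i ω)) c₁)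
    (h₂ : TendstoInMean P (fun n ω => (n : ℝ)⁻¹ * ∑ i ∈ Finset.range n, h (S i ω) ^ 2) c₂) :
    TendstoInMean P (fun n ω => (n : ℝ)⁻¹ * ∑ i ∈ Finset.range n, (h (X i ω) + ε i ω)) c₁ ∧
    TendstoInMean P (fun n ω => (n : ℝ)⁻¹ * ∑ i ∈ Finset.range n, (h (X i ω) + ε i ω) ^ 2)
      (c₂ + 1) := by
  have hhS (i : ℕ) : Measurable fun ω => h (S i ω) := h.continuous.measurable.comp (hS i)
  have hb (x : ℝ) : |h x| ≤ ‖h‖ := h.norm_coe_le_norm x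
  have hDb (i : ℕ) (ω : Ω) : |h (X i ω) - h (S i ω)| ≤ 2 * ‖h‖ := by
    rw [two_mul]
    exact (abs_sub _ _).trans (add_le_add (hb _) (hb _))
  have hcross : IndepFun (fun ω i => 2 * h (S i ω)) (fun ω i => ε i ω) P :=
    hSε.comp (φ := fun (w : ℕ → ℝ) i => 2 * h (w i)) (measurable_pi_lambda _ fun i =>
      (h.continuous.measurable.comp (measurable_pi_apply i)).const_mul 2) measurable_id
  refine ⟨?_, ?_⟩
  · have := (h₁.add hXS.average).add (tendstoInMean_average_noise hε hind)
    rw [add_zero, add_zero] at this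
    refine this.congr_ae fun n => ae_of_all _ fun ω => ?_
    simp only [← mul_add, ← Finset.sum_add_distrib]
    congr 1
    exact Finset.sum_congr rfl fun i _ => by ring
  · have hsq : TendstoInMean P (fun i ω => h (X i ω) ^ 2 - h (S i ω) ^ 2) 0 := by
      have hXh (i : ℕ) : AEStronglyMeasurable (fun ω => h (X i ω)) P := by
        have := (hXS.integrable i).1.add (hhS i).aestronglyMeasurable
        refine this.congr (ae_of_all _ fun ω => ?_)
        simp
      have hi (i : ℕ) : Integrable (fun ω => h (X i ω) ^ 2 - h (S i ω) ^ 2) P := by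
        refine Integrable.sub ?_ ?_
        · refine (integrable_const (‖h‖ ^ 2)).mono' ((hXh i).pow 2) (ae_of_all _ fun ω => ?_)
          rw [norm_pow, Real.norm_eq_abs]
          exact pow_le_pow_left₀ (abs_nonneg _) (hb _) 2
        · refine (integrable_const (‖h‖ ^ 2)).mono' ((hhS i).aestronglyMeasurable.pow 2)
            (ae_of_all _ fun ω => ?_)
          rw [norm_pow, Real.norm_eq_abs]
          exact pow_le_pow_left₀ (abs_nonneg _) (hb _) 2
      refine ⟨hi, ?_⟩
      have hlim := hXS.tendsto.const_mul (2 * ‖h‖)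
      simp only [sub_zero, mul_zero] at hlim ⊢
      refine squeeze_zero (fun n => integral_nonneg fun ω => abs_nonneg _) (fun n => ?_) hlim
      rw [← integral_const_mul]
      refine integral_mono (hi n).abs ((hXS.integrable n).abs.const_mul _) fun ω => ?_
      simp only
      rw [sq_sub_sq, abs_mul, two_mul]
      exact mul_le_mul_of_nonneg_right ((abs_add_le _ _).trans (add_le_add (hb _) (hb _)))
        (abs_nonneg _)
    have hDε := (hXS.mul_noise hε hDb).average
    -- Expansion of (h(X) + ε)² as h(S)² + (h(X)² - h(S)²) + 2(h(X) - h(S))ε + 2h(S)ε + ε². The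
    -- third term is added as two copies of `hDε`, and the last one produces the extra 1.
    have := ((((h₂.add hsq.average).add hDε).add hDε).add
      (tendstoInMean_average_mul_noise hε hind (fun i => (hhS i).const_mul 2) (B := 2 * ‖h‖)
        (fun i ω => by rw [abs_mul, abs_two]; gcongr; exact hb _) hcross)).add
      (tendstoInMean_average_sq_noise hε hind)
    simp only [add_zero] at this
    refine this.congr_ae fun n => ae_of_all _ fun ω => ?_
    simp only [← mul_add, ← Finset.sum_add_distrib]
    congr 1
    exact Finset.sum_congr rfl fun i _ => by ring

end Noise

/-! ### Sample moments of the observations -/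

lemma measurable_integral_finiteMeasure {A : Type*} [MeasurableSpace A] {f : A → ℝ}
    (hf : Measurable f) {B : ℝ} (hB : ∀ x, |f x| ≤ B) :
    Measurable fun μ : FiniteMeasure A => ∫ x, f x ∂(μ : Measure A) := by
  have h (μ : FiniteMeasure A) : ∫ x, f x ∂(μ : Measure A) =
      (∫⁻ x, ENNReal.ofReal (f x) ∂(μ : Measure A)).toReal -
        (∫⁻ x, ENNReal.ofReal (-f x) ∂(μ : Measure A)).toReal :=
    integral_eq_lintegral_pos_part_sub_lintegral_neg_part
      ((integrable_const B).mono' hf.aestronglyMeasurable (ae_of_all _ hB))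
  simp_rw [h]
  have hm {g : A → ℝ} (hg : Measurable g) : Measurable fun μ : FiniteMeasure A =>
      (∫⁻ x, ENNReal.ofReal (g x) ∂(μ : Measure A)).toReal :=
    ((Measure.measurable_lintegral hg.ennreal_ofReal).comp measurable_subtype_coe).ennreal_toReal
  exact (hm hf).sub (hm hf.neg)

lemma Sensor.abs_kernel_le (φ₀ : Sensor) {a : ℝ} (ha : 0 < a) (b α : ℝ) {t : ℝ} (ht : 0 < t)
    {β : ℝ} (hβ : β ∈ Icc (0 : ℝ) 1) : |φ₀.kernel a b α t β| ≤
      (ENNReal.ofReal (φ₀.bound * amplitude a b ^ 2) * kernelBound a b α t).toReal := by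
  have h := φ₀.enorm_kernel_le ha b α t hβ
  rw [← ofReal_norm] at h
  exact (ENNReal.ofReal_le_iff_le_toReal
    (ENNReal.mul_ne_top ENNReal.ofReal_ne_top (kernelBound_lt_top ha b α ht).ne)).1 h

/-- The reading of the contribution of the initial measure. -/
lemma Sensor.read_initialPart (φ₀ : Sensor) {a : ℝ} (ha : 0 < a) (b α : ℝ) (μ : FiniteMeasure I)
    {t : ℝ} (ht : 0 < t) :
    φ₀.read (initialPart a b α μ t) = ∫ y : I, φ₀.kernel a b α t y ∂(μ : Measure I) := by
  simp only [Sensor.kernel, Sensor.response, if_pos ht]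
  rw [integral_const_mul]
  cases φ₀ with
  | dirac z => rfl
  | weight φ =>
    simp only [Sensor.read, pairing, initialPart]
    have hm : Measurable fun q : I × I => φ q.1 * green a b t q.2 q.1 :=
      (φ.continuous.measurable.comp measurable_fst).mul ((measurable_green a b).comp
        (by fun_prop : Measurable fun q : I × I => (t, (q.2 : ℝ), (q.1 : ℝ))))
    have hB : ENNReal.ofReal ‖φ‖ * (ENNReal.ofReal (amplitude a b ^ 2) * heatTrace a b t) ≠ ∞ := by
      rw [heatTrace_eq_ofReal ha b ht]
      exact ENNReal.mul_ne_top ENNReal.ofReal_ne_top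
        (ENNReal.mul_ne_top ENNReal.ofReal_ne_top ENNReal.ofReal_ne_top)
    have hint : Integrable (fun q : I × I => φ q.1 * green a b t q.2 q.1)
        ((volume : Measure I).prod (μ : Measure I)) := by
      refine (integrable_const (ENNReal.ofReal ‖φ‖ *
        (ENNReal.ofReal (amplitude a b ^ 2) * heatTrace a b t)).toReal).mono'
        hm.aestronglyMeasurable (ae_of_all _ fun q => ?_)
      refine (ENNReal.ofReal_le_iff_le_toReal hB).1 ?_
      rw [ofReal_norm, enorm_mul, ← ofReal_norm (φ q.1)]
      gcongr
      exacts [φ.norm_coe_le_norm _, enorm_green_le ha b t q.2.2 q.1.2]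
    calc _ = Real.exp (-(α * t)) * ∫ x : I, ∫ y : I, φ x * green a b t y x ∂(μ : Measure I) := by
          rw [← integral_const_mul]
          refine integral_congr_ae (ae_of_all _ fun x => ?_)
          simp only
          rw [integral_const_mul]
          ring
      _ = _ := by rw [integral_integral_swap hint]

lemma heatTrace_anti {a : ℝ} (ha : 0 < a) (b : ℝ) {s t : ℝ} (hst : s ≤ t) :
    heatTrace a b t ≤ heatTrace a b s := by
  refine ENNReal.tsum_le_tsum fun j => ENNReal.ofReal_le_ofReal (Real.exp_le_exp.2 ?_)
  exact neg_le_neg (mul_le_mul_of_nonneg_left hst (eigenvalue_nonneg ha b j))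

lemma tendsto_kernelBound {a : ℝ} (ha : 0 < a) (b : ℝ) {α : ℝ} (hα : 0 < α) :
    Tendsto (kernelBound a b α) atTop (𝓝 0) := by
  have h1 : Tendsto (fun t => ENNReal.ofReal (Real.exp (-(α * t))) * heatTrace a b 1) atTop
      (𝓝 0) := by
    have h2 : Tendsto (fun t => ENNReal.ofReal (Real.exp (-(α * t)))) atTop (𝓝 0) := by
      rw [← ENNReal.ofReal_zero]
      exact ENNReal.tendsto_ofReal
        (Real.tendsto_exp_neg_atTop_nhds_zero.comp (tendsto_id.const_mul_atTop hα))
    have := ENNReal.Tendsto.mul_const (b := heatTrace a b 1) h2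
      (Or.inr (by rw [heatTrace_eq_ofReal ha b one_pos]; exact ENNReal.ofReal_ne_top))
    rwa [zero_mul] at this
  refine tendsto_of_tendsto_of_tendsto_of_le_of_le' tendsto_const_nhds h1
    (Eventually.of_forall fun _ => zero_le) ?_
  filter_upwards [eventually_ge_atTop 1] with t ht
  exact mul_le_mul' le_rfl (heatTrace_anti ha b ht)

section Moments

variable {Ω : Type*} [MeasurableSpace Ω] {P : Measure Ω}
  {N : ℝ≥0 → Ω → ℕ} {a b α β l Δ M : ℝ}

lemma Sensor.integrable_kernel_div (φ₀ : Sensor) (ha : 0 < a) (b : ℝ) (hα : 0 < α)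
    (hβ : β ∈ Icc (0 : ℝ) 1) (hl : 0 < l) : Integrable fun u => φ₀.kernel a b α (u / l) β := by
  have h1 : Integrable fun u => φ₀.kernel a b α u β := by
    rw [← integrableOn_univ, ← Iic_union_Ioi (a := (0 : ℝ)), integrableOn_union]
    refine ⟨?_, φ₀.integrableOn_kernel ha b hα hβ⟩
    exact (integrableOn_zero (s := Iic (0 : ℝ))).congr_fun
      (fun u hu => (φ₀.kernel_of_nonpos a b α hu β).symm) measurableSet_Iic
  exact h1.comp_div hl.ne'

/-- The stationary moments in terms of shot noise. -/
lemma IsStandardPoisson.stationaryMoment_eq (hN : IsStandardPoisson N P) (ha : 0 < a) (b : ℝ)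
    (hα : 0 < α) (hβ : β ∈ Icc (0 : ℝ) 1) (hl : 0 < l) (h : ℝ →ᵇ ℝ) (φ₀ : Sensor) (r : ℕ) :
    stationaryMoment P N a b α h φ₀ r (β, l) =
      ∫ ω, (h ^ r) (∫ s, φ₀.kernel a b α (s / l) β ∂(hN.path ω).jumps) ∂P := by
  refine integral_congr_ae ?_
  have hfin : ∫⁻ s in Ioi 0, kernelBound a b α (s / l) ≠ ∞ := by
    rw [setLIntegral_Ioi_comp_div hl]
    exact ENNReal.mul_ne_top ENNReal.ofReal_ne_top (lintegral_exp_mul_heatTrace_lt_top ha b hα).ne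
  filter_upwards [hN.ae_lintegral_lt_top (H := fun s => kernelBound a b α (s / l))
    ((measurable_kernelBound a b α).comp (by fun_prop)) hfin] with ω hω
  have := φ₀.read_stationarySignal ha b α (hN.path ω) hβ hl hω.ne
  simp only [BoundedContinuousFunction.coe_pow, Pi.pow_apply]
  rw [← this]
  rfl

lemma measurable_read_initialPart (φ₀ : Sensor) (ha : 0 < a) (b α : ℝ) {t : ℝ} (ht : 0 < t)
    {U₀ : Ω → FiniteMeasure I} (hU₀ : Measurable U₀) :
    Measurable fun ω => φ₀.read (initialPart a b α (U₀ ω) t) := by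
  simp_rw [φ₀.read_initialPart ha b α _ ht]
  exact (measurable_integral_finiteMeasure (f := fun y : I => φ₀.kernel a b α t y)
    ((φ₀.measurable_kernel a b α).comp (by fun_prop : Measurable fun y : I => (t, (y : ℝ))))
    fun y => φ₀.abs_kernel_le ha b α ht y.2).comp hU₀

lemma tendsto_read_initialPart (φ₀ : Sensor) (ha : 0 < a) (b : ℝ) (hα : 0 < α)
    (μ : FiniteMeasure I) {t : ℕ → ℝ} (ht : Tendsto t atTop atTop) :
    Tendsto (fun i => φ₀.read (initialPart a b α μ (t i))) atTop (𝓝 0) := by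
  rw [tendsto_zero_iff_enorm_tendsto_zero]
  have h1 := ENNReal.Tendsto.const_mul (a := ENNReal.ofReal φ₀.bound *
    (ENNReal.ofReal (amplitude a b ^ 2) * (μ : Measure I) univ))
    ((tendsto_kernelBound ha b hα).comp ht) (Or.inr (ENNReal.mul_ne_top ENNReal.ofReal_ne_top
      (ENNReal.mul_ne_top ENNReal.ofReal_ne_top (measure_ne_top _ _))))
  rw [mul_zero] at h1
  refine tendsto_of_tendsto_of_tendsto_of_le_of_le tendsto_const_nhds h1 (fun _ => zero_le)
    fun i => ?_
  refine (φ₀.enorm_read_le _ _ fun x => enorm_initialPart_le ha b α μ (t i) x).trans ?_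
  simp only [Function.comp_apply, mul_assoc, le_refl]

/-- The sample moments of the observations converge in mean to the moments of the stationary
observations. -/
theorem IsStandardPoisson.tendstoInMean_sampleMoment [IsProbabilityMeasure P]
    (hN : IsStandardPoisson N P) (ha : 0 < a)
    (b : ℝ) (hα : 0 < α) (hΔ : 0 < Δ) (hβ : β ∈ Icc (0 : ℝ) 1) (hl : 0 < l) (h : ℝ →ᵇ ℝ)
    (φ₀ : Sensor) {U₀ : Ω → FiniteMeasure I} (hU₀ : Measurable U₀) {ε : ℕ → Ω → ℝ}
    (hε : ∀ i, HasLaw (ε i) (gaussianReal 0 1) P) (hind : iIndepFun ε P)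
    (hεN : IndepFun (fun ω i => ε i ω) (fun ω t => N t ω) P) :
    TendstoInMean P (sampleMoment (observation a b α Δ h φ₀ U₀ N ε β l) 1)
      (stationaryMoment P N a b α h φ₀ 1 (β, l)) ∧
    TendstoInMean P (sampleMoment (observation a b α Δ h φ₀ U₀ N ε β l) 2)
      (stationaryMoment P N a b α h φ₀ 2 (β, l) + 1) := by
  let f : ℝ → ℝ := fun u => φ₀.kernel a b α (u / l) β
  have hf : Measurable f := (φ₀.measurable_kernel a b α).comp
    (by fun_prop : Measurable fun u : ℝ => (u / l, β))
  have hfi : Integrable f := φ₀.integrable_kernel_div ha b hα hβ hl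
  have hf0 : ∀ u ≤ 0, f u = 0 := fun u hu =>
    φ₀.kernel_of_nonpos a b α (div_nonpos_of_nonpos_of_nonneg hu hl.le) β
  have hd : 0 < l * Δ := mul_pos hl hΔ
  have hfs (i : ℕ) : Measurable fun r => f ((i + 1 : ℕ) * (l * Δ) - r) := hf.comp (by fun_prop)
  let S : ℕ → Ω → ℝ := fun i ω => ∫ r, f ((i + 1 : ℕ) * (l * Δ) - r) ∂(hN.path ω).jumps
  let X : ℕ → Ω → ℝ := fun i ω =>
    φ₀.read (signal a b α (U₀ ω) (fun t => N t ω) β l ((i + 1 : ℕ) * Δ))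
  let J : ℕ → Ω → ℝ := fun i ω => φ₀.read (initialPart a b α (U₀ ω) ((i + 1 : ℕ) * Δ))
  have hSm (i : ℕ) : Measurable (S i) := hN.measurable_integral (hfs i)
  have hti (i : ℕ) : 0 < ((i + 1 : ℕ) : ℝ) * Δ := by positivity
  have hJm (i : ℕ) : Measurable (J i) := measurable_read_initialPart φ₀ ha b α (hti i) hU₀
  have hX (i : ℕ) : X i =ᵐ[P] fun ω => J i ω + S i ω := by
    filter_upwards [hN.ae_lintegral_kernelBound_ne_top ha b hα ((i + 1 : ℕ) * Δ) (M := l)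
      (θ := fun _ => (1 / 2, l)) measurable_const (ae_of_all _ fun _ => by
        exact ⟨by norm_num, hl, le_rfl⟩) (indepFun_const_right _ _)] with ω hω
    refine (φ₀.read_signal ha b α (U₀ ω) (hN.path ω) hβ hl (hti i) hω).trans ?_
    simp only [J, S, f]
    congr 1
    refine integral_congr_ae (ae_of_all _ fun r => ?_)
    simp only
    congr 1
    field_simp
  have hk (r : ℕ) : TendstoInMean P (fun n ω => (n : ℝ)⁻¹ * ∑ i ∈ Finset.range n, h (S i ω) ^ r)
      (stationaryMoment P N a b α h φ₀ r (β, l)) := by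
    refine ⟨fun n => ?_, ?_⟩
    · refine (integrable_finsetSum _ fun i _ => ?_).const_mul _
      exact (integrable_const ‖h ^ r‖).mono'
        ((h ^ r).continuous.measurable.comp (hSm i)).aestronglyMeasurable
        (ae_of_all _ fun ω => (h ^ r).norm_coe_le_norm _)
    · rw [hN.stationaryMoment_eq ha b hα hβ hl]
      exact hN.tendsto_average_shotNoise hf hfi hf0 hd (h ^ r)
  have hJ0 : TendstoInMeasure P J atTop fun _ => 0 := by
    refine tendstoInMeasure_of_tendsto_ae (fun i => (hJm i).aestronglyMeasurable)
      (ae_of_all _ fun ω => tendsto_read_initialPart φ₀ ha b hα (U₀ ω) ?_)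
    exact (tendsto_natCast_atTop_atTop.comp (tendsto_add_atTop_nat 1)).atTop_mul_const hΔ
  have hXS : TendstoInMean P (fun i ω => h (X i ω) - h (S i ω)) 0 := by
    refine TendstoInMean.congr_ae (A := fun i ω => h (J i ω + S i ω) - h (S i ω)) ?_ fun i => ?_
    · have hm := h.continuous.measurable
      refine ⟨fun i => Integrable.sub ?_ ?_, ?_⟩
      · exact (integrable_const ‖h‖).mono' (hm.comp ((hJm i).add (hSm i))).aestronglyMeasurable
          (ae_of_all _ fun ω => h.norm_coe_le_norm _)
      · exact (integrable_const ‖h‖).mono' (hm.comp (hSm i)).aestronglyMeasurable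
          (ae_of_all _ fun ω => h.norm_coe_le_norm _)
      · simp only [sub_zero]
        refine Metric.tendsto_atTop.2 fun η hη => ?_
        obtain ⟨δ, hδ, hδh⟩ := exists_integral_abs_comp_sub_le P h hfi.2.ne (half_pos hη)
        have h1 := tendstoInMeasure_iff_norm.1 hJ0 δ hδ
        obtain ⟨n₀, hn₀⟩ := eventually_atTop.1 (h1.eventually_le_const
          (by simpa using hδ : 0 < ENNReal.ofReal δ))
        refine ⟨n₀, fun n hn => ?_⟩
        rw [Real.dist_eq, sub_zero, abs_of_nonneg (integral_nonneg fun ω => abs_nonneg _)]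
        refine lt_of_le_of_lt (hδh _ _ ((hJm n).add (hSm n)) (hSm n)
          (hN.lintegral_enorm_shotNoise_le hf _) ?_) (half_lt_self hη)
        simpa [Real.norm_eq_abs] using hn₀ n hn
    · filter_upwards [hX i] with ω hω
      rw [hω]
  have hε' (i : ℕ) := hε (i + 1)
  have hind' : iIndepFun (fun i => ε (i + 1)) P := hind.precomp (add_left_injective 1)
  -- The shot noise is a function of the driving path alone, so independence of the noise from N
  -- suffices.
  have hSε : IndepFun (fun ω i => S i ω) (fun ω i => ε (i + 1) ω) P :=
    (hN.indepFun_path hεN.symm).comp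
      (φ := fun (p : CountingPath) i => ∫ r, f ((i + 1 : ℕ) * (l * Δ) - r) ∂p.jumps)
      (ψ := fun (w : ℕ → ℝ) i => w (i + 1))
      (measurable_pi_lambda _ fun i => measurable_integral_jumps (hfs i)) (by fun_prop)
  have key := tendstoInMean_average_observation (X := X) (S := S) hε' hind' h hSm hSε hXS
    (by simpa using hk 1) (hk 2)
  -- Observations are numbered from 1, the averages above from 0.
  have hreindex (r n : ℕ) (ω : Ω) : sampleMoment (observation a b α Δ h φ₀ U₀ N ε β l) r n ω =
      (n : ℝ)⁻¹ * ∑ i ∈ Finset.range n, (h (X i ω) + ε (i + 1) ω) ^ r := by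
    rw [sampleMoment, show Finset.Icc 1 n = Finset.Ico (0 + 1) (n + 1) by ext; simp,
      ← Finset.sum_Ico_add', Finset.range_eq_Ico]
    rfl
  refine ⟨key.1.congr_ae fun n => ae_of_all _ fun ω => ?_,
    key.2.congr_ae fun n => ae_of_all _ fun ω => (hreindex 2 n ω).symm⟩
  simp only [hreindex, pow_one]

end Moments

/-! ### Consistency of the moment estimators -/

/-- Continuous partial derivatives near an interior point give strict differentiability. Because l <
M there, the one-sided derivatives within the half-open interval are ordinary ones. -/
lemma HasContinuousPartials.hasStrictFDerivAt {M : ℝ} {g : ℝ × ℝ → ℝ}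
    (hg : HasContinuousPartials M g) {θ₀ : ℝ × ℝ} (hθ₀ : θ₀ ∈ Ioo (0 : ℝ) 1 ×ˢ Ioo 0 M) :
    HasStrictFDerivAt g ((partialβ g θ₀ • ContinuousLinearMap.id ℝ ℝ).coprod
      (partialL M g θ₀ • ContinuousLinearMap.id ℝ ℝ)) θ₀ := by
  have hopen : Ioo (0 : ℝ) 1 ×ˢ Ioo 0 M ∈ 𝓝 θ₀ := (isOpen_Ioo.prod isOpen_Ioo).mem_nhds hθ₀
  have hsub : Ioo (0 : ℝ) 1 ×ˢ Ioo 0 M ⊆ paramSet M := prod_mono_right Ioo_subset_Ioc_self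
  have hid (x : ℝ) : ContinuousLinearMap.toSpanSingleton ℝ x =
      x • ContinuousLinearMap.id ℝ ℝ := by ext; simp
  have hcont {p : ℝ × ℝ → ℝ} (hp : ContinuousOn p (paramSet M)) :
      ContinuousAt (fun v : ℝ × ℝ => p v • ContinuousLinearMap.id ℝ ℝ) θ₀ :=
    (hp.continuousAt (mem_of_superset hopen hsub)).smul continuousAt_const
  refine hasStrictFDerivAt_uncurry_coprod (f := fun β l => g (β, l))
    (f₁ := fun β l => partialβ g (β, l) • ContinuousLinearMap.id ℝ ℝ)
    (f₂ := fun β l => partialL M g (β, l) • ContinuousLinearMap.id ℝ ℝ) ?_ ?_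
    (hcont hg.continuous_β) (hcont hg.continuous_l)
  · filter_upwards [hopen] with v hv
    have h := (hg.differentiable_β v (hsub hv)).hasDerivWithinAt.hasDerivAt
      (isOpen_Ioo.mem_nhds hv.1)
    have h' := h.hasFDerivAt
    rw [hid] at h'
    exact h'
  · filter_upwards [hopen] with v hv
    have h := (hg.differentiable_l v (hsub hv)).hasDerivWithinAt.hasDerivAt
      (Ioc_mem_nhds hv.2.1 hv.2.2)
    have h' := h.hasFDerivAt
    rw [hid] at h'
    exact h'

/-- Near a point with nonvanishing Jacobian determinant the moment map is open. -/
lemma map_nhds_of_jacobian_ne_zero {M : ℝ} {g₁ g₂ : ℝ × ℝ → ℝ} (hg₁ : HasContinuousPartials M g₁)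
    (hg₂ : HasContinuousPartials M g₂) {θ₀ : ℝ × ℝ} (hθ₀ : θ₀ ∈ Ioo (0 : ℝ) 1 ×ˢ Ioo 0 M)
    (hJ : (jacobian M g₁ g₂ θ₀).det ≠ 0) :
    map (fun θ => (g₁ θ, g₂ θ)) (𝓝 θ₀) = 𝓝 (g₁ θ₀, g₂ θ₀) := by
  refine ((hg₁.hasStrictFDerivAt hθ₀).prodMk (hg₂.hasStrictFDerivAt hθ₀)).map_nhds_eq_of_surj ?_
  rw [LinearMap.range_eq_top]
  rw [jacobian, Matrix.det_fin_two_of] at hJ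
  generalize partialβ g₁ θ₀ = p, partialL M g₁ θ₀ = q, partialβ g₂ θ₀ = r, partialL M g₂ θ₀ = s
    at hJ ⊢
  rintro ⟨x, y⟩
  -- Cramer's rule.
  refine ⟨((s * x - q * y) / (p * s - q * r), (p * y - r * x) / (p * s - q * r)),
    Prod.ext ?_ ?_⟩
  · have : p * ((s * x - q * y) / (p * s - q * r)) + q * ((p * y - r * x) / (p * s - q * r)) =
        x * ((p * s - q * r) / (p * s - q * r)) := by ring
    rw [div_self hJ, mul_one] at this
    simpa using this
  · have : r * ((s * x - q * y) / (p * s - q * r)) + s * ((p * y - r * x) / (p * s - q * r)) =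
        y * ((p * s - q * r) / (p * s - q * r)) := by ring
    rw [div_self hJ, mul_one] at this
    simpa using this

section Consistency

variable {Ω : Type*} [MeasurableSpace Ω] {P : Measure Ω}

lemma TendstoInMean.tendstoInMeasure [IsFiniteMeasure P] {A : ℕ → Ω → ℝ} {c : ℝ}
    (hA : TendstoInMean P A c) :
    TendstoInMeasure P A atTop fun _ => c := by
  refine tendstoInMeasure_of_tendsto_eLpNorm one_ne_zero (fun n => (hA.integrable n).1)
    aestronglyMeasurable_const ?_
  have h (n : ℕ) : eLpNorm (A n - fun _ => c) 1 P = ENNReal.ofReal (∫ ω, |A n ω - c| ∂P) := by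
    rw [eLpNorm_one_eq_lintegral_enorm]
    exact (ofReal_integral_norm_eq_lintegral_enorm
      ((hA.integrable n).sub (integrable_const c))).symm
  simp_rw [h]
  rw [← ENNReal.ofReal_zero]
  exact ENNReal.tendsto_ofReal hA.tendsto

/-- If the sample moments converge in mean to the moments of an interior parameter, then the moment
estimators are consistent. -/
theorem IsMomentEstimator.exists_subseq_tendsto [IsFiniteMeasure P] {M : ℝ} {g₁ g₂ : ℝ × ℝ → ℝ}
    {Y : ℕ → Ω → ℝ} {θhat : ℕ → Ω → ℝ × ℝ} (hθ : IsMomentEstimator P M g₁ g₂ Y θhat)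
    (hg₁ : HasContinuousPartials M g₁) (hg₂ : HasContinuousPartials M g₂) {θ₀ : ℝ × ℝ}
    (hθ₀ : θ₀ ∈ Ioo (0 : ℝ) 1 ×ˢ Ioo 0 M) (hJ : (jacobian M g₁ g₂ θ₀).det ≠ 0)
    (h₁ : TendstoInMean P (sampleMoment Y 1) (g₁ θ₀))
    (h₂ : TendstoInMean P (sampleMoment Y 2) (g₂ θ₀ + 1))
    {ns : ℕ → ℕ} (hns : Tendsto ns atTop atTop) :
    ∃ ms : ℕ → ℕ, ∀ᵐ ω ∂P, Tendsto (fun k => θhat (ns (ms k)) ω) atTop (𝓝 θ₀) := by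
  -- Two successive extractions, so that both moments converge almost surely along the same
  -- subsequence.
  obtain ⟨m₁, hm₁, hlim₁⟩ := (h₁.tendstoInMeasure.comp hns).exists_seq_tendsto_ae
  obtain ⟨m₂, hm₂, hlim₂⟩ :=
    (h₂.tendstoInMeasure.comp (hns.comp hm₁.tendsto_atTop)).exists_seq_tendsto_ae
  refine ⟨fun k => m₁ (m₂ k), ?_⟩
  filter_upwards [hlim₁, hlim₂, hθ.unique_solution] with ω h1 h2 h3
  have h1' := h1.comp hm₂.tendsto_atTop
  have hsub := hns.comp (hm₁.tendsto_atTop.comp hm₂.tendsto_atTop)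
  have hΘ : paramSet M ∈ 𝓝 θ₀ := mem_of_superset ((isOpen_Ioo.prod isOpen_Ioo).mem_nhds hθ₀)
    (prod_mono_right Ioo_subset_Ioc_self)
  have hpair := h1'.prodMk_nhds (h2.sub_const 1)
  rw [add_sub_cancel_right] at hpair
  intro U hU
  -- By openness of the moment map the sample moments are eventually attained at a point of `U` in
  -- Θ, and uniqueness forces that point to be the estimator. No global injectivity of the moment
  -- map is needed.
  have himage : (fun θ => (g₁ θ, g₂ θ)) '' (U ∩ paramSet M) ∈ 𝓝 (g₁ θ₀, g₂ θ₀) := by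
    rw [← map_nhds_of_jacobian_ne_zero hg₁ hg₂ hθ₀ hJ]
    exact image_mem_map (inter_mem hU hΘ)
  change ∀ᶠ k in atTop, θhat (ns (m₁ (m₂ k))) ω ∈ U
  filter_upwards [hpair himage, hsub.eventually h3] with k hk huniq
  obtain ⟨θ, ⟨hθU, hθΘ⟩, heq⟩ := hk
  have e := (huniq θ hθΘ).1 ⟨(congrArg Prod.fst heq).symm, by
    rw [show g₂ θ = _ from congrArg Prod.snd heq]; simp⟩
  exact e ▸ hθU

end Consistency

end RiverFilter

end

/-! ### The theorem -/

theorem theorem3p3 {Ω : Type*} [MeasurableSpace Ω] (P : Measure Ω) [IsProbabilityMeasure P]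
    (a b α Δ M : ℝ) (ha : 0 < a) (hα : 0 < α) (hΔ : 0 < Δ)
    -- the observation function and the observation weight
    (h : ℝ →ᵇ ℝ) (φ₀ : RiverFilter.Sensor)
    -- the true parameters
    (β₀ l₀ : ℝ) (hβ₀ : β₀ ∈ Ioo (0 : ℝ) 1) (hl₀ : l₀ ∈ Ioo 0 M)
    -- initial condition, driving Poisson process and noise of the observed signal
    (U₀ : Ω → FiniteMeasure unitInterval) (hU₀ : Measurable U₀)
    (N : ℝ≥0 → Ω → ℕ) (hN : RiverFilter.IsStandardPoisson N P)
    (hNU : IndepFun (fun ω t => N t ω) U₀ P)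
    (ε : ℕ → Ω → ℝ) (hε : ∀ i, HasLaw (ε i) (gaussianReal 0 1) P) (hε_indep : iIndepFun ε P)
    (hεN : IndepFun (fun ω i => ε i ω) (fun ω t => N t ω) P)
    -- regularity of the stationary moments on the parameter set
    (hg : ∀ r ∈ ({1, 2} : Set ℕ), RiverFilter.HasContinuousPartials M
      (RiverFilter.stationaryMoment P N a b α h φ₀ r))
    (hJ : ∀ θ ∈ RiverFilter.paramSet M,
      (RiverFilter.jacobian M (RiverFilter.stationaryMoment P N a b α h φ₀ 1)
        (RiverFilter.stationaryMoment P N a b α h φ₀ 2) θ).det ≠ 0)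
    -- the moment estimators computed from the observations
    (θhat : ℕ → Ω → ℝ × ℝ)
    (hθ : RiverFilter.IsMomentEstimator P M
      (RiverFilter.stationaryMoment P N a b α h φ₀ 1)
      (RiverFilter.stationaryMoment P N a b α h φ₀ 2)
      (RiverFilter.observation a b α Δ h φ₀ U₀ N ε β₀ l₀) θhat)
    -- random initial measures of the approximating signals, of arbitrary law
    (V₀ : ℕ → Ω → FiniteMeasure unitInterval) (hV₀ : ∀ n, Measurable (V₀ n))
    -- a standard Poisson process that is independent of everything else
    (N' : ℝ≥0 → Ω → ℕ) (hN' : RiverFilter.IsStandardPoisson N' P)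
    (hN'_indep : IndepFun (fun ω t => N' t ω)
      (fun ω => (U₀ ω, fun t => N t ω, fun i => ε i ω, fun n => θhat n ω, fun n => V₀ n ω)) P)
    (φ : unitInterval →ᵇ ℝ) :
    let approx : ℕ → Ω → ℝ := fun n ω => RiverFilter.pairing (RiverFilter.signal a b α (V₀ n ω)
      (fun t => N' t ω) (θhat n ω).1 (θhat n ω).2 Δ) φ
    let target : ℕ → Ω → ℝ := fun n ω => RiverFilter.pairing (RiverFilter.signal a b α (V₀ n ω)
      (fun t => N' t ω) β₀ l₀ Δ) φ
    (∀ n, MemLp (fun ω => approx n ω - target n ω) 2 P) ∧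
      Tendsto (fun n => ∫ ω, |approx n ω - target n ω| ^ 2 ∂P) atTop (𝓝 0) := by
  have hβ : β₀ ∈ Icc (0 : ℝ) 1 := Ioo_subset_Icc_self hβ₀
  obtain ⟨h₁, h₂⟩ := hN.tendstoInMean_sampleMoment ha b hα hΔ hβ hl₀.1 h φ₀ hU₀ hε hε_indep hεN
  have hmem : (β₀, l₀) ∈ Ioo (0 : ℝ) 1 ×ˢ Ioo 0 M := ⟨hβ₀, hl₀⟩
  have hmem' : (β₀, l₀) ∈ RiverFilter.paramSet M := ⟨hβ₀, hl₀.1, hl₀.2.le⟩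
  refine hN'.tendsto_pairing_signal ha b hα hΔ hmem' hθ.measurable hθ.mem (fun n => ?_)
    (fun ns hns => hθ.exists_subseq_tendsto (hg 1 (by simp)) (hg 2 (by simp)) hmem (hJ _ hmem')
      h₁ h₂ hns) V₀ φ
  -- The estimators are the fourth component of the family that is independent of the new Poisson
  -- process.
  exact (hN'.indepFun_path hN'_indep).comp (φ := id) (ψ := fun x => x.2.2.2.1 n) measurable_id
    (by fun_prop)
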